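/- Let $T\subseteq\mathbb{R}$ be an interval with $0\in T$, and let $\mathbf{Q}(x,t)$, $(x,t)\in\mathbb{R}\times T$, be a classical solution with values in the symmetric complex $2\times2$ matrices of the spin-1 Gross--Pitaevskii equation $$\mathrm{i}\mathbf{Q}_t+\mathbf{Q}_{xx}+2\mathbf{Q}\mathbf{Q}^\dagger\mathbf{Q}=\mathbf{0}$$ ($\mathbf{Q},\mathbf{Q}_x,\mathbf{Q}_{xx}$ continuous on $\mathbb{R}\times T$). Assume that for each $t\in T$ one has $\mathbf{Q}(\cdot,t)\in L^1(\mathbb{R})$ and $\mathbf{Q},\mathbf{Q}_x\to\mathbf{0}$ as $x\to\pm\infty$, and that $\mathbf{Q},\mathbf{Q}_x$ are bounded on $\mathbb{R}\times K$ for every compact $K\subseteq T$. Put $\sigma=\mathrm{diag}(1,1,-1,-1)$, $\mathbf{U}=\begin{pmatrix}\mathbf{0}&\mathbf{Q}\\-\mathbf{Q}^\dagger&\mathbf{0}\end{pmatrix}$, $\theta(x,t;\lambda)=\lambda x+2\lambda^2t$ and $\Theta=\mathrm{e}^{2\mathrm{i}\theta}$. Let $\mu_\pm(x,t;\lambda)$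 be the $4\times4$ matrices whose columns are the bounded continuous (in $x$) solutions of $$\mu_\pm(x,t;\lambda)=\mathbf{I}_4+\int_{\pm\infty}^x\mathrm{e}^{\mathrm{i}\lambda(y-x)\sigma}\,\mathbf{U}(y,t)\mu_\pm(y,t;\lambda)\,\mathrm{e}^{-\mathrm{i}\lambda(y-x)\sigma}\,\mathrm{d}y ,$$ and let $\psi_\pm=\mu_\pm\mathrm{e}^{-\mathrm{i}\theta\sigma}$ be the Jost solutions. The subscripts $\mathrm{L}$ and $\mathrm{R}$ denote the first two and the last two columns; $\mu_{-\mathrm{L}},\mu_{+\mathrm{R}}$ are defined for $\operatorname{Im}\lambda\ge0$ and $\mu_{+\mathrm{L}},\mu_{-\mathrm{R}}$ for $\operatorname{Im}\lambda\le0$. The scattering matrix $\mathbf{S}(\lambda)$ is defined by $\psi_-=\psi_+\mathbf{S}$ for $\lambda\in\mathbb{R}$, and $\mathbf{a}(\lambda)$ is its upper left $2\times2$ block, continued analytically to $\operatorname{Im}\lambda>0$ (continuously up to $\mathbb{R}$). Let $\lambda_0$ with $\operatorname{Im}\lambda_0>0$ be a zero of $\det\mathbf{a}(\lambda)$ of multiplicity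 $m+1$, $m\ge0$. Then there are symmetric complex $2\times2$ matrices $\mathbf{B}_0,\dots,\mathbf{B}_m$, independent of $(x,t)$, with $\mathbf{B}_0\neq\mathbf{0}$ if and only if $\mathbf{a}(\lambda_0)\neq\mathbf{0}$, such that for all $x\in\mathbb{R}$, $t\in T$ and $n\in\{0,\dots,m\}$ the dependence relations of the Jost solutions $$\frac1{n!}\frac{\mathrm{d}^n}{\mathrm{d}\lambda^n}\Big[\psi_{-\mathrm{L}}(x,t;\lambda)\,\mathrm{adj}\,\mathbf{a}(\lambda)\Big]_{\lambda=\lambda_0}=\sum_{j+k=n}\frac{\psi_{+\mathrm{R}}^{(k)}(x,t;\lambda_0)\mathbf{B}_j}{j!\,k!},$$ $$\frac1{n!}\frac{\mathrm{d}^n}{\mathrm{d}\lambda^n}\Big[\psi_{-\mathrm{R}}(x,t;\lambda)\,\mathrm{adj}\,\overline{\mathbf{a}(\bar\lambda)}\Big]_{\lambda=\bar\lambda_0}=-\sum_{j+k=n}\frac{\psi_{+\mathrm{L}}^{(k)}(x,t;\bar\lambda_0)\mathbf{B}_j^\dagger}{j!\,k!}$$ hold, and, with the same matrices $\mathbf{B}_j$,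 so do the relations of the modified eigenfunctions $$\frac1{n!}\frac{\mathrm{d}^n}{\mathrm{d}\lambda^n}\Big[\mu_{-\mathrm{L}}(x,t;\lambda)\,\mathrm{adj}\,\mathbf{a}(\lambda)\Big]_{\lambda=\lambda_0}=\sum_{j+k+l=n}\frac{\Theta^{(k)}(x,t;\lambda_0)\,\mu_{+\mathrm{R}}^{(l)}(x,t;\lambda_0)\mathbf{B}_j}{j!\,k!\,l!},$$ $$\frac1{n!}\frac{\mathrm{d}^n}{\mathrm{d}\lambda^n}\Big[\mu_{-\mathrm{R}}(x,t;\lambda)\,\mathrm{adj}\,\overline{\mathbf{a}(\bar\lambda)}\Big]_{\lambda=\bar\lambda_0}=-\sum_{j+k+l=n}\frac{\overline{\Theta^{(k)}(x,t;\lambda_0)}\,\mu_{+\mathrm{L}}^{(l)}(x,t;\bar\lambda_0)\mathbf{B}_j^\dagger}{j!\,k!\,l!}.$$ Here indices are nonnegative integers and $(\cdot)^{(k)}$ is the $k$-th derivative in $\lambda$. -/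

import Mathlib

open MeasureTheory Filter Topology
open scoped Matrix ComplexConjugate

noncomputable section

namespace SpinorGP

/-- Index set of `4 × 4` matrices written as `2 × 2` blocks of size `2`. The columns in the left
summand form the part `L`, those in the right summand the part `R`. -/
abbrev Idx := Fin 2 ⊕ Fin 2

/-- The space derivative of a matrix-valued function of `(x, t)`, entry by entry. -/
def dx (Q : ℝ → ℝ → Matrix (Fin 2) (Fin 2) ℂ) (x t : ℝ) : Matrix (Fin 2) (Fin 2) ℂ :=
  Matrix.of fun i j => deriv (fun y => Q y t i j) x

/-- `Q` is a classical solution on `ℝ × T` of the spin-1 Gross-Pitaevskii equation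
`i Q_t + Q_xx + 2 Q Q† Q = 0` with values in the symmetric `2 × 2` matrices:
`Q`, `Q_x`, `Q_xx` exist and are continuous on `ℝ × T`, and `Q_t` exists. -/
structure IsSolution (Q : ℝ → ℝ → Matrix (Fin 2) (Fin 2) ℂ) (T : Set ℝ) : Prop where
  symm : ∀ x, ∀ t ∈ T, (Q x t).IsSymm
  contDiff_space : ∀ t ∈ T, ∀ i j, ContDiff ℝ 2 fun x => Q x t i j
  cont : ∀ i j, ContinuousOn (fun p : ℝ × ℝ => Q p.1 p.2 i j) (Set.univ ×ˢ T)
  cont_dx : ∀ i j, ContinuousOn (fun p : ℝ × ℝ => dx Q p.1 p.2 i j) (Set.univ ×ˢ T)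
  cont_dxx : ∀ i j, ContinuousOn (fun p : ℝ × ℝ => dx (dx Q) p.1 p.2 i j) (Set.univ ×ˢ T)
  equation : ∀ x, ∀ t ∈ T, ∀ i j, ∃ q' : ℂ,
    HasDerivWithinAt (fun s => Q x s i j) q' T t ∧
      Complex.I * q' + dx (dx Q) x t i j + 2 * (Q x t * (Q x t)ᴴ * Q x t) i j = 0

/-- For every time `t ∈ T`, `Q(·, t)` is integrable and `Q`, `Q_x` tend to zero as `x → ± ∞`;
moreover `Q` and `Q_x` are bounded on `ℝ × K` for compact `K ⊆ T`. -/
structure IsDecaying (Q : ℝ → ℝ → Matrix (Fin 2) (Fin 2) ℂ) (T : Set ℝ) : Prop where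
  integrable : ∀ t ∈ T, ∀ i j, Integrable fun x => Q x t i j
  tendsto : ∀ t ∈ T, ∀ i j, Tendsto (fun x => Q x t i j) (atBot ⊔ atTop) (𝓝 0)
  tendsto_dx : ∀ t ∈ T, ∀ i j, Tendsto (fun x => dx Q x t i j) (atBot ⊔ atTop) (𝓝 0)
  bounded : ∀ K ⊆ T, IsCompact K → ∃ C : ℝ, ∀ x, ∀ t ∈ K, ∀ i j,
    ‖Q x t i j‖ ≤ C ∧ ‖dx Q x t i j‖ ≤ C

/-- The potential `U = [[0, Q], [-Q†, 0]]` of the spectral problem `ψ_x = (-iλσ + U) ψ`. -/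
def potential (Q : ℝ → ℝ → Matrix (Fin 2) (Fin 2) ℂ) (x t : ℝ) : Matrix Idx Idx ℂ :=
  Matrix.fromBlocks 0 (Q x t) (-(Q x t)ᴴ) 0

/-- The diagonal of `σ = diag(1, 1, -1, -1)`. -/
def sgn : Idx → ℂ := Sum.elim (fun _ => 1) (fun _ => -1)

/-- The phase `θ(x, t; λ) = λ x + 2 λ² t`. -/
def theta (x t : ℝ) (lam : ℂ) : ℂ := lam * x + 2 * lam ^ 2 * t

/-- `Θ = exp(2iθ)`. -/
def Theta (x t : ℝ) (lam : ℂ) : ℂ := Complex.exp (2 * Complex.I * theta x t lam)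

/-- `f` is the bounded continuous solution of the `j`-th column of the Volterra equation
`μ(x) = I + ∫_{-∞}^x e^{iλ(y-x)σ} U(y) μ(y) e^{-iλ(y-x)σ} dy`. -/
def IsMuMinusColumn (U : ℝ → Matrix Idx Idx ℂ) (lam : ℂ) (j : Idx) (f : ℝ → Idx → ℂ) : Prop :=
  Continuous f ∧ (∃ C : ℝ, ∀ x i, ‖f x i‖ ≤ C) ∧
    ∀ x i, f x i = (1 : Matrix Idx Idx ℂ) i j +
      ∫ y in Set.Iic x,
        Complex.exp (Complex.I * lam * ((y : ℂ) - x) * (sgn i - sgn j)) * (U y *ᵥ f y) i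

/-- `f` is the bounded continuous solution of the `j`-th column of the Volterra equation
`μ(x) = I + ∫_{+∞}^x e^{iλ(y-x)σ} U(y) μ(y) e^{-iλ(y-x)σ} dy`. -/
def IsMuPlusColumn (U : ℝ → Matrix Idx Idx ℂ) (lam : ℂ) (j : Idx) (f : ℝ → Idx → ℂ) : Prop :=
  Continuous f ∧ (∃ C : ℝ, ∀ x i, ‖f x i‖ ≤ C) ∧
    ∀ x i, f x i = (1 : Matrix Idx Idx ℂ) i j -
      ∫ y in Set.Ioi x,
        Complex.exp (Complex.I * lam * ((y : ℂ) - x) * (sgn i - sgn j)) * (U y *ᵥ f y) i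

/-- The modified eigenfunction `μ₋(x, t; λ)`, column by column. It is meaningful in the columns `L`
for `0 ≤ Im λ` and in the columns `R` for `Im λ ≤ 0`, and is only used there. -/
def muMinus (Q : ℝ → ℝ → Matrix (Fin 2) (Fin 2) ℂ) (x t : ℝ) (lam : ℂ) : Matrix Idx Idx ℂ :=
  Matrix.of fun i j =>
    Classical.epsilon (IsMuMinusColumn (fun y => potential Q y t) lam j) x i

/-- The modified eigenfunction `μ₊(x, t; λ)`, column by column. It is meaningful in the columns `L`
for `Im λ ≤ 0` and in the columns `R` for `0 ≤ Im λ`, and is only used there. -/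
def muPlus (Q : ℝ → ℝ → Matrix (Fin 2) (Fin 2) ℂ) (x t : ℝ) (lam : ℂ) : Matrix Idx Idx ℂ :=
  Matrix.of fun i j =>
    Classical.epsilon (IsMuPlusColumn (fun y => potential Q y t) lam j) x i

/-- The diagonal matrix `e^{-iθσ}`. -/
def phase (x t : ℝ) (lam : ℂ) : Matrix Idx Idx ℂ :=
  Matrix.diagonal fun i => Complex.exp (-Complex.I * theta x t lam * sgn i)

/-- The Jost solution `ψ₋ = μ₋ e^{-iθσ}`. -/
def psiMinus (Q : ℝ → ℝ → Matrix (Fin 2) (Fin 2) ℂ) (x t : ℝ) (lam : ℂ) : Matrix Idx Idx ℂ :=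
  muMinus Q x t lam * phase x t lam

/-- The Jost solution `ψ₊ = μ₊ e^{-iθσ}`. -/
def psiPlus (Q : ℝ → ℝ → Matrix (Fin 2) (Fin 2) ℂ) (x t : ℝ) (lam : ℂ) : Matrix Idx Idx ℂ :=
  muPlus Q x t lam * phase x t lam

/-- The scattering matrix `S(λ)`, `λ` real, defined by `ψ₋ = ψ₊ S`. It does not depend on the point
`(x, t)`; the point `(0, 0)` is used. -/
def scattering (Q : ℝ → ℝ → Matrix (Fin 2) (Fin 2) ℂ) (s : ℝ) : Matrix Idx Idx ℂ :=
  (psiPlus Q 0 0 s)⁻¹ * psiMinus Q 0 0 s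

/-- `A` is continuous on the closed upper half-plane, analytic on the open one, and equal to `f` on
the real line. -/
def IsUpperContinuation (f : ℝ → Matrix (Fin 2) (Fin 2) ℂ)
    (A : ℂ → Matrix (Fin 2) (Fin 2) ℂ) : Prop :=
  (∀ i j, ContinuousOn (fun z => A z i j) {z : ℂ | 0 ≤ z.im}) ∧
    (∀ i j, DifferentiableOn ℂ (fun z => A z i j) {z : ℂ | 0 < z.im}) ∧
    ∀ s : ℝ, A (s : ℂ) = f s

/-- `a(λ)`: the upper left block of the scattering matrix, continued analytically to the upper
half-plane. -/
def scatA (Q : ℝ → ℝ → Matrix (Fin 2) (Fin 2) ℂ) : ℂ → Matrix (Fin 2) (Fin 2) ℂ :=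
  Classical.epsilon (IsUpperContinuation fun s => (scattering Q s).toBlocks₁₁)

/-- `λ ↦ conj (a (conj λ))`, on the lower half-plane. -/
def scatABar (Q : ℝ → ℝ → Matrix (Fin 2) (Fin 2) ℂ) (lam : ℂ) : Matrix (Fin 2) (Fin 2) ℂ :=
  (scatA Q (conj lam)).map conj

/-- The `n`-th complex derivative of a matrix-valued function, entry by entry. -/
def matDeriv {r c : Type*} (n : ℕ) (F : ℂ → Matrix r c ℂ) (z : ℂ) : Matrix r c ℂ :=
  Matrix.of fun i j => iteratedDeriv n (fun w => F w i j) z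

end SpinorGP

end

/-! Everything reduces to one statement at `λ₀` (`exists_normingMatrix`): there is an analytic
matrix function `B(λ)`, symmetric and independent of `(x, t)`, for which the defect `μ₋L adj a - Θ
μ₊R B` vanishes at `λ₀` to order `m + 1` for every `(x, t)`. The norming matrices are the
derivatives `B_j = B^{(j)}(λ₀)`: derivatives of order at most `m` do not see the defect, so the
relations at `λ₀` are the Leibniz formula.

Construction of `B`. Let `E, D` be the upper and lower blocks of `μ₊R`, and `P, N` those of `μ₋L`,
at a point `(x₀, 0)` where `D(λ₀)` is invertible; this holds for large `x₀`. Symmetry of `Q` makes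
the potential infinitesimally symplectic, hence `EᵀD = DᵀE`, `PᵀN = NᵀP` and `a = DᵀP - EᵀN`. For `B
= Θ⁻¹ D⁻¹ N adj a` the lower block of the defect is zero and the upper one is `det a • D⁻ᵀ`
(`upper_block_eq`), so the order is right at this one point. The same identities make `det a • B`
symmetric (`det_smul_isSymm`), and `det a` has an isolated zero.

Propagation to all `(x, t)`. For fixed `λ` the columns of `μ₋L` and `Θ μ₊R` solve one common linear
system in `x` and one in `t`, while `a` and `B` are constant. Grönwall bounds the defect at `(x, t)`
by a constant times its value at `(x₀, 0)`, locally uniformly in `λ` (`exists_norm_jostComb_le`),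
and such a bound transfers orders of vanishing. The system in `t` comes from zero curvature: the
solution of the time equation that starts at `μ₋(·, 0)` stays bounded, keeps its limit at `-∞` and
solves the spectral problem at every later time, so by uniqueness it is `μ₋` there
(`exists_evolution_mcol`).

The relations at `conj λ₀` are the images of those at `λ₀` under `M ↦ J⁻¹ conj M`, with `B†= conj B`
by symmetry. Finally `a(λ₀) = 0` clearly gives `B₀ = 0`; conversely `B₀ = 0` gives `μ₋L adj a = 0`
at `λ₀`, and `x → -∞` gives `adj a = 0`. -/

noncomputable section

namespace SpinorGP

section

/-! ### Linear Volterra equations on a left half-line -/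

/-- The mass of `κ` to the left of `x`. -/
def leftMass (κ : ℝ → ℝ) (x : ℝ) : ℝ := ∫ y in Set.Iic x, κ y

section LeftMass

variable {κ : ℝ → ℝ}

lemma hasDerivAt_leftMass (hκc : Continuous κ) (hκi : Integrable κ) (x : ℝ) :
    HasDerivAt (leftMass κ) (κ x) x := by
  have h : leftMass κ = fun x => leftMass κ 0 + ∫ y in (0 : ℝ)..x, κ y := by
    funext z
    simp only [leftMass]
    rw [← intervalIntegral.integral_Iic_sub_Iic hκi.integrableOn hκi.integrableOn]
    ring
  rw [h]
  exact (intervalIntegral.integral_hasDerivAt_right (hκc.intervalIntegrable _ _)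
    (hκc.stronglyMeasurableAtFilter _ _) hκc.continuousAt).const_add _

lemma continuous_leftMass (hκc : Continuous κ) (hκi : Integrable κ) :
    Continuous (leftMass κ) :=
  continuous_iff_continuousAt.2 fun x => (hasDerivAt_leftMass hκc hκi x).continuousAt

lemma leftMass_nonneg (hκ0 : ∀ x, 0 ≤ κ x) (x : ℝ) : 0 ≤ leftMass κ x :=
  setIntegral_nonneg measurableSet_Iic fun y _ => hκ0 y

lemma leftMass_le (hκi : Integrable κ) (hκ0 : ∀ x, 0 ≤ κ x) (x : ℝ) :
    leftMass κ x ≤ ∫ y, κ y :=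
  setIntegral_le_integral hκi (ae_of_all _ hκ0)

lemma tendsto_leftMass_atBot (hκi : Integrable κ) :
    Tendsto (leftMass κ) atBot (𝓝 0) := by
  have h := intervalIntegral_tendsto_integral_Iic (f := κ) (μ := volume) 0 hκi.integrableOn
    (tendsto_id (α := ℝ) (x := atBot))
  have h2 : Tendsto (fun x : ℝ => leftMass κ 0 - ∫ y in x..(0 : ℝ), κ y) atBot
      (𝓝 (leftMass κ 0 - leftMass κ 0)) := tendsto_const_nhds.sub h
  rw [sub_self] at h2
  refine h2.congr fun x => ?_
  rw [← intervalIntegral.integral_Iic_sub_Iic hκi.integrableOn hκi.integrableOn]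
  simp [leftMass]

lemma integrable_mul_leftMass_pow (hκc : Continuous κ) (hκi : Integrable κ)
    (hκ0 : ∀ x, 0 ≤ κ x) (n : ℕ) : Integrable fun y => κ y * leftMass κ y ^ n := by
  refine (hκi.mul_const ((∫ y, κ y) ^ n)).mono'
    (hκc.mul ((continuous_leftMass hκc hκi).pow n)).aestronglyMeasurable (ae_of_all _ fun y => ?_)
  rw [Real.norm_of_nonneg (mul_nonneg (hκ0 y) (pow_nonneg (leftMass_nonneg hκ0 y) n))]
  exact mul_le_mul_of_nonneg_left (pow_le_pow_left₀ (leftMass_nonneg hκ0 y)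
    (leftMass_le hκi hκ0 y) n) (hκ0 y)

/-- The integrand is an exact derivative because `leftMass κ` has derivative `κ` and tends to zero
at `-∞`. Each integration raises the power and the factorial by one, which is the induction step of
every Picard estimate below. -/
lemma integral_mul_leftMass_pow (hκc : Continuous κ) (hκi : Integrable κ)
    (hκ0 : ∀ x, 0 ≤ κ x) (n : ℕ) (M x : ℝ) :
    ∫ y in Set.Iic x, κ y * (M * leftMass κ y ^ n / n.factorial)
      = M * leftMass κ x ^ (n + 1) / (n + 1).factorial := by
  have hd : ∀ y : ℝ, HasDerivAt (fun y => M * leftMass κ y ^ (n + 1) / (n + 1).factorial)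
      (κ y * (M * leftMass κ y ^ n / n.factorial)) y := by
    intro y
    have h := (((hasDerivAt_leftMass hκc hκi y).pow (n + 1)).const_mul M).div_const
      ((n + 1).factorial : ℝ)
    refine h.congr_deriv ?_
    have h1 : ((n.factorial : ℕ) : ℝ) ≠ 0 := by exact_mod_cast n.factorial_ne_zero
    have h2 : ((n : ℝ) + 1) ≠ 0 := by positivity
    rw [Nat.factorial_succ]
    push_cast
    field_simp
    try ring_nf
  have hlim : Tendsto (fun y => M * leftMass κ y ^ (n + 1) / (n + 1).factorial) atBot (𝓝 0) := by
    have h := (((tendsto_leftMass_atBot hκi).pow (n + 1)).const_mul M).div_const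
      ((n + 1).factorial : ℝ)
    simpa using h
  have hint : Integrable fun y => κ y * (M * leftMass κ y ^ n / n.factorial) := by
    refine ((integrable_mul_leftMass_pow hκc hκi hκ0 n).mul_const (M / n.factorial)).congr
      (ae_of_all _ fun y => ?_)
    simp only
    ring
  rw [integral_Iic_of_hasDerivAt_of_tendsto' (fun y _ => hd y) hint.integrableOn hlim, sub_zero]

lemma integrable_mul_leftMass_pow' (hκc : Continuous κ) (hκi : Integrable κ)
    (hκ0 : ∀ x, 0 ≤ κ x) (n : ℕ) (M : ℝ) :
    Integrable fun y => κ y * (M * leftMass κ y ^ n / n.factorial) := by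
  refine ((integrable_mul_leftMass_pow hκc hκi hκ0 n).mul_const (M / n.factorial)).congr
    (ae_of_all _ fun y => ?_)
  simp only
  ring

end LeftMass

/-- A bounded nonnegative subsolution of a homogeneous Volterra inequality vanishes. -/
lemma eq_zero_of_le_integral_Iic {κ u : ℝ → ℝ} (hκc : Continuous κ) (hκi : Integrable κ)
    (hκ0 : ∀ x, 0 ≤ κ x) (hu0 : ∀ x, 0 ≤ u x) {M : ℝ}
    (huM : ∀ x, u x ≤ M) (hu : ∀ x, u x ≤ ∫ y in Set.Iic x, κ y * u y) (x : ℝ) : u x = 0 := by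
  -- Feeding the inequality into itself gains a factorial each time, so no smallness of the mass is
  -- needed.
  have hn : ∀ n : ℕ, ∀ x, u x ≤ M * leftMass κ x ^ n / n.factorial := by
    intro n
    induction n with
    | zero => intro x; simpa using huM x
    | succ n ih =>
      intro x
      refine (hu x).trans ?_
      rw [← integral_mul_leftMass_pow hκc hκi hκ0 n M x]
      refine integral_mono_of_nonneg (ae_of_all _ fun y => mul_nonneg (hκ0 y) (hu0 y))
        (integrable_mul_leftMass_pow' hκc hκi hκ0 n M).integrableOn
        (ae_of_all _ fun y => mul_le_mul_of_nonneg_left (ih y) (hκ0 y))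
  have hlim : Tendsto (fun n : ℕ => M * leftMass κ x ^ n / n.factorial) atTop (𝓝 0) := by
    have := (FloorSemiring.tendsto_pow_div_factorial_atTop (leftMass κ x)).const_mul M
    simpa [mul_div_assoc] using this
  exact le_antisymm (ge_of_tendsto' hlim fun n => hn n x) (hu0 x)

/-- A parameter integral of holomorphic functions with an integrable bound is holomorphic. -/
lemma differentiableOn_integral_of_dominated {α E : Type*} [MeasurableSpace α] {μ : Measure α}
    [NormedAddCommGroup E] [NormedSpace ℂ E] {F : ℂ → α → E}
    {b : α → ℝ} {Ω : Set ℂ} (hΩ : IsOpen Ω)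
    (hmeas : ∀ z ∈ Ω, AEStronglyMeasurable (F z) μ)
    (hbound : ∀ᵐ a ∂μ, ∀ z ∈ Ω, ‖F z a‖ ≤ b a) (hb : Integrable b μ)
    (hdiff : ∀ᵐ a ∂μ, DifferentiableOn ℂ (fun z => F z a) Ω) :
    DifferentiableOn ℂ (fun z => ∫ a, F z a ∂μ) Ω := by
  intro z₀ hz₀
  obtain ⟨ε, hε, hball⟩ := Metric.isOpen_iff.1 hΩ z₀ hz₀
  have hsub : ∀ z ∈ Metric.ball z₀ (ε / 2), Metric.closedBall z (ε / 2 / 2) ⊆ Ω := by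
    intro z hz w hw
    apply hball
    rw [Metric.mem_ball] at hz ⊢
    rw [Metric.mem_closedBall] at hw
    linarith [dist_triangle w z z₀]
  have hmem : ∀ z ∈ Metric.ball z₀ (ε / 2), z ∈ Ω := fun z hz =>
    hsub z hz (Metric.mem_closedBall_self (by positivity))
  have hder : ∀ᵐ a ∂μ, ∀ z ∈ Metric.ball z₀ (ε / 2),
      HasDerivAt (fun z => F z a) (deriv (fun z => F z a) z) z := by
    filter_upwards [hdiff] with a ha z hz
    exact (ha.differentiableAt (hΩ.mem_nhds (hmem z hz))).hasDerivAt
  refine (hasDerivAt_integral_of_dominated_loc_of_deriv_le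
    (F := F) (F' := fun z a => deriv (fun z => F z a) z)
    (bound := fun a => b a / (ε / 2 / 2)) (Metric.ball_mem_nhds z₀ (half_pos hε))
    ?_ ?_ ?_ ?_ (hb.div_const _) hder).2.differentiableAt.differentiableWithinAt
  · filter_upwards [hΩ.mem_nhds hz₀] with z hz using hmeas z hz
  · exact hb.mono' (hmeas z₀ hz₀) (hbound.mono fun a ha => ha z₀ hz₀)
  -- Measurability of the derivative: it is an almost everywhere limit of difference quotients along
  -- `z₀ + 1/(n+1)`. The later shift by `N` keeps these points inside `Ω`.
  · have hseq : Tendsto (fun n : ℕ => (((n : ℝ) + 1)⁻¹ : ℝ)) atTop (𝓝 0) := by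
      simpa using tendsto_one_div_add_atTop_nhds_zero_nat (𝕜 := ℝ)
    have hseqC : Tendsto (fun n : ℕ => ((((n : ℝ) + 1)⁻¹ : ℝ) : ℂ)) atTop (𝓝[≠] 0) := by
      refine tendsto_nhdsWithin_iff.2 ⟨?_, Eventually.of_forall fun n => ?_⟩
      · have := (Complex.continuous_ofReal.tendsto 0).comp hseq
        simpa [Function.comp_def] using this
      · have : (0 : ℝ) < ((n : ℝ) + 1)⁻¹ := by positivity
        simpa using (Nat.cast_add_one_ne_zero n : (n : ℂ) + 1 ≠ 0)
    have hmemseq : ∀ᶠ n : ℕ in atTop, z₀ + ((((n : ℝ) + 1)⁻¹ : ℝ) : ℂ) ∈ Ω := by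
      have hc : Tendsto (fun n : ℕ => z₀ + ((((n : ℝ) + 1)⁻¹ : ℝ) : ℂ)) atTop (𝓝 (z₀ + 0)) :=
        tendsto_const_nhds.add (hseqC.mono_right nhdsWithin_le_nhds)
      rw [add_zero] at hc
      exact hc (hΩ.mem_nhds hz₀)
    obtain ⟨N, hN⟩ := eventually_atTop.1 hmemseq
    refine aestronglyMeasurable_of_tendsto_ae atTop
      (f := fun n : ℕ => fun a => ((((((n + N : ℕ) : ℝ) + 1)⁻¹ : ℝ) : ℂ))⁻¹ •
        (F (z₀ + (((((n + N : ℕ) : ℝ) + 1)⁻¹ : ℝ) : ℂ)) a - F z₀ a)) (fun n => ?_) ?_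
    · exact ((hmeas _ (hN (n + N) (Nat.le_add_left _ _))).sub (hmeas _ hz₀)).const_smul _
    · filter_upwards [hder] with a ha
      have h1 := (ha z₀ (Metric.mem_ball_self (half_pos hε))).tendsto_slope_zero
      exact (h1.comp hseqC).comp (tendsto_add_atTop_nat N)
  -- Cauchy's estimate on discs of radius `ε / 4`, which still lie in `Ω`, dominates the derivative
  -- by `b a / (ε / 4)`.
  · filter_upwards [hbound, hdiff] with a ha hd z hz
    refine Complex.norm_deriv_le_of_forall_mem_sphere_norm_le (by positivity) ?_ ?_
    · exact (hd.mono (hsub z hz)).diffContOnCl_ball subset_rfl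
    · exact fun w hw => ha w (hsub z hz (Metric.sphere_subset_closedBall hw))

/-! ### Neumann series of Volterra equations with a dominated kernel. -/

section Solver

variable {P E : Type*} [NormedAddCommGroup E] [NormedSpace ℂ E]

/-- Picard iterates of the Volterra equation with kernel `k` and inhomogeneity `g`. -/
def picard (k : P → ℝ → ℝ → E →L[ℂ] E) (g : P → ℝ → E) : ℕ → P → ℝ → E
  | 0 => g
  | n + 1 => fun p x => ∫ y in Set.Iic x, k p x y (picard k g n p y)

/-- The Neumann series of the Volterra equation. -/
def volterraSol (k : P → ℝ → ℝ → E →L[ℂ] E) (g : P → ℝ → E) (p : P) (x : ℝ) : E :=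
  ∑' n, picard k g n p x

/-- A continuous Volterra kernel dominated by an integrable function. -/
structure DominatedKernel [TopologicalSpace P] (k : P → ℝ → ℝ → E →L[ℂ] E) (κ : ℝ → ℝ) :
    Prop where
  cont_bound : Continuous κ
  integrable_bound : Integrable κ
  nonneg : ∀ x, 0 ≤ κ x
  cont : Continuous fun q : P × ℝ × ℝ => k q.1 q.2.1 q.2.2
  le : ∀ p x y, y ≤ x → ‖k p x y‖ ≤ κ y

variable [TopologicalSpace P] {k : P → ℝ → ℝ → E →L[ℂ] E} {κ : ℝ → ℝ} {g : P → ℝ → E} {M : ℝ}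

lemma DominatedKernel.norm_apply_le (hk : DominatedKernel k κ) {p : P} {x y : ℝ} (hxy : y ≤ x)
    {v : E} {c : ℝ} (hv : ‖v‖ ≤ c) : ‖k p x y v‖ ≤ κ y * c :=
  ((k p x y).le_opNorm v).trans (mul_le_mul (hk.le p x y hxy) hv (norm_nonneg _) (hk.nonneg y))

/-- Continuity and the factorial bound are proved in one induction, because continuity of the next
iterate rests on dominated convergence with the bound of the current one. -/
lemma picard_spec [FirstCountableTopology P] (hk : DominatedKernel k κ)
    (hg : Continuous fun q : P × ℝ => g q.1 q.2) (hgM : ∀ p x, ‖g p x‖ ≤ M) (n : ℕ) :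
    (Continuous fun q : P × ℝ => picard k g n q.1 q.2) ∧
      ∀ p x, ‖picard k g n p x‖ ≤ M * leftMass κ x ^ n / n.factorial := by
  induction n with
  | zero => exact ⟨hg, fun p x => by simpa [picard] using hgM p x⟩
  | succ n ih =>
    obtain ⟨hc, hb⟩ := ih
    have hint := integrable_mul_leftMass_pow' hk.cont_bound hk.integrable_bound hk.nonneg n M
    refine ⟨?_, fun p x => ?_⟩
    · have heq : ∀ q : P × ℝ, picard k g (n + 1) q.1 q.2 =
          ∫ y, (Set.Iic q.2).indicator (fun y => k q.1 q.2 y (picard k g n q.1 y)) y := fun q =>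
        (integral_indicator measurableSet_Iic).symm
      simp_rw [heq]
      have hcont : Continuous fun r : (P × ℝ) × ℝ =>
          k r.1.1 r.1.2 r.2 (picard k g n r.1.1 r.2) := by
        have h1 : Continuous fun r : (P × ℝ) × ℝ => k r.1.1 r.1.2 r.2 :=
          hk.cont.comp (f := fun r : (P × ℝ) × ℝ => (r.1.1, r.1.2, r.2)) (by fun_prop)
        have h2 : Continuous fun r : (P × ℝ) × ℝ => picard k g n r.1.1 r.2 :=
          hc.comp (f := fun r : (P × ℝ) × ℝ => (r.1.1, r.2)) (by fun_prop)
        exact h1.clm_apply h2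
      refine continuous_iff_continuousAt.2 fun q₀ => ?_
      refine continuousAt_of_dominated
        (bound := fun y => κ y * (M * leftMass κ y ^ n / n.factorial)) ?_ ?_ hint ?_
      · refine Eventually.of_forall fun q => ?_
        refine Continuous.aestronglyMeasurable ?_ |>.indicator measurableSet_Iic
        exact hcont.comp (f := fun y : ℝ => (q, y)) (by fun_prop)
      · refine Eventually.of_forall fun q => ae_of_all _ fun y => ?_
        by_cases hy : y ∈ Set.Iic q.2
        · rw [Set.indicator_of_mem hy]
          exact hk.norm_apply_le hy (hb _ _)
        · rw [Set.indicator_of_notMem hy, norm_zero]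
          exact mul_nonneg (hk.nonneg y) ((norm_nonneg _).trans (hb q₀.1 y))
      -- As a function of the endpoint the indicator jumps only at `y = q₀.2`, a null set of `y`.
      · have hne : ∀ᵐ y : ℝ, y ≠ q₀.2 := by simp [ae_iff, measure_singleton]
        filter_upwards [hne] with y hy
        have hF : ContinuousAt (fun q : P × ℝ => k q.1 q.2 y (picard k g n q.1 y)) q₀ :=
          (hcont.comp (f := fun q : P × ℝ => (q, y)) (by fun_prop)).continuousAt
        rcases lt_or_gt_of_ne hy with h | h
        · refine hF.congr ?_
          have : ∀ᶠ q : P × ℝ in 𝓝 q₀, y < q.2 :=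
            continuousAt_snd.eventually (lt_mem_nhds h)
          filter_upwards [this] with q hq
          rw [Set.indicator_of_mem (show y ∈ Set.Iic q.2 from hq.le)]
        · refine (continuousAt_const (y := (0 : E))).congr ?_
          have : ∀ᶠ q : P × ℝ in 𝓝 q₀, q.2 < y :=
            continuousAt_snd.eventually (gt_mem_nhds h)
          filter_upwards [this] with q hq
          rw [Set.indicator_of_notMem (show y ∉ Set.Iic q.2 from not_le.2 hq)]
    · rw [← integral_mul_leftMass_pow hk.cont_bound hk.integrable_bound hk.nonneg n M x]
      refine norm_integral_le_of_norm_le hint.integrableOn ?_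
      filter_upwards [ae_restrict_mem measurableSet_Iic] with y hy
      exact hk.norm_apply_le hy (hb _ _)

lemma summable_volterra_bound (c : ℝ) : Summable fun n : ℕ => M * c ^ n / n.factorial := by
  simpa [mul_div_assoc] using (Real.summable_pow_div_factorial c).mul_left M

lemma norm_picard_le [FirstCountableTopology P] (hk : DominatedKernel k κ)
    (hg : Continuous fun q : P × ℝ => g q.1 q.2) (hgM : ∀ p x, ‖g p x‖ ≤ M) (n : ℕ) (p : P)
    (x : ℝ) : ‖picard k g n p x‖ ≤ M * (∫ y, κ y) ^ n / n.factorial := by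
  refine ((picard_spec hk hg hgM n).2 p x).trans ?_
  have hM : 0 ≤ M := (norm_nonneg _).trans (hgM p x)
  have := pow_le_pow_left₀ (leftMass_nonneg hk.nonneg x)
    (leftMass_le hk.integrable_bound hk.nonneg x) n
  gcongr

lemma norm_volterraSol_le [FirstCountableTopology P] (hk : DominatedKernel k κ)
    (hg : Continuous fun q : P × ℝ => g q.1 q.2) (hgM : ∀ p x, ‖g p x‖ ≤ M) (p : P) (x : ℝ) :
    ‖volterraSol k g p x‖ ≤ ∑' n : ℕ, M * (∫ y, κ y) ^ n / n.factorial :=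
  tsum_of_norm_bounded (summable_volterra_bound (M := M) (∫ y, κ y)).hasSum
    fun n => norm_picard_le hk hg hgM n p x

variable [CompleteSpace E]

lemma continuous_volterraSol [FirstCountableTopology P] (hk : DominatedKernel k κ)
    (hg : Continuous fun q : P × ℝ => g q.1 q.2) (hgM : ∀ p x, ‖g p x‖ ≤ M) :
    Continuous fun q : P × ℝ => volterraSol k g q.1 q.2 :=
  continuous_tsum (fun n => (picard_spec hk hg hgM n).1)
    (summable_volterra_bound (M := M) (∫ y, κ y)) fun n q => norm_picard_le hk hg hgM n q.1 q.2

lemma volterraSol_eq [FirstCountableTopology P] (hk : DominatedKernel k κ)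
    (hg : Continuous fun q : P × ℝ => g q.1 q.2) (hgM : ∀ p x, ‖g p x‖ ≤ M) (p : P) (x : ℝ) :
    volterraSol k g p x = g p x + ∫ y in Set.Iic x, k p x y (volterraSol k g p y) := by
  have hs : ∀ y, Summable fun n => picard k g n p y := fun y =>
    Summable.of_norm_bounded (summable_volterra_bound (M := M) (∫ y, κ y))
      fun n => norm_picard_le hk hg hgM n p y
  have hint : ∀ n, Integrable (fun y => k p x y (picard k g n p y))
      (volume.restrict (Set.Iic x)) := by
    intro n
    refine (integrable_mul_leftMass_pow' hk.cont_bound hk.integrable_bound hk.nonneg n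
      M).integrableOn.mono' (μ := volume.restrict (Set.Iic x)) ?_ ?_
    · have h1 : Continuous fun y : ℝ => k p x y :=
        hk.cont.comp (f := fun y : ℝ => (p, x, y)) (by fun_prop)
      have h2 : Continuous fun y : ℝ => picard k g n p y :=
        (picard_spec hk hg hgM n).1.comp (f := fun y : ℝ => (p, y)) (by fun_prop)
      exact (h1.clm_apply h2).aestronglyMeasurable
    · filter_upwards [ae_restrict_mem measurableSet_Iic] with y hy
      exact hk.norm_apply_le hy ((picard_spec hk hg hgM n).2 _ _)
  have hsum : Summable fun n => ∫ y in Set.Iic x, ‖k p x y (picard k g n p y)‖ := by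
    refine Summable.of_nonneg_of_le (fun n => integral_nonneg fun y => norm_nonneg _)
      (fun n => ?_) ((summable_nat_add_iff 1).2
        (summable_volterra_bound (M := M) (leftMass κ x)))
    rw [← integral_mul_leftMass_pow hk.cont_bound hk.integrable_bound hk.nonneg n M x]
    refine integral_mono_ae (hint n).norm
      (integrable_mul_leftMass_pow' hk.cont_bound hk.integrable_bound hk.nonneg n M).integrableOn ?_
    filter_upwards [ae_restrict_mem measurableSet_Iic] with y hy
    exact hk.norm_apply_le hy ((picard_spec hk hg hgM n).2 _ _)
  have h := integral_tsum_of_summable_integral_norm hint hsum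
  have h2 : ∀ y, ∑' n, k p x y (picard k g n p y) = k p x y (volterraSol k g p y) := fun y =>
    ((k p x y).map_tsum (hs y)).symm
  simp only [h2] at h
  rw [← h, volterraSol, (hs x).tsum_eq_zero_add]
  rfl

/-- Each iterate is a parameter integral of holomorphic functions, and the series converges
uniformly. Holomorphy is asked only on `Ω`, while the kernel is continuous and dominated for all
complex parameters. -/
lemma differentiableOn_volterraSol {k : ℂ → ℝ → ℝ → E →L[ℂ] E} {g : ℂ → ℝ → E}
    (hk : DominatedKernel k κ)
    (hg : Continuous fun q : ℂ × ℝ => g q.1 q.2) (hgM : ∀ p x, ‖g p x‖ ≤ M) {Ω : Set ℂ}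
    (hΩ : IsOpen Ω) (hkd : ∀ x y, DifferentiableOn ℂ (fun z => k z x y) Ω)
    (hgd : ∀ x, DifferentiableOn ℂ (fun z => g z x) Ω) (x : ℝ) :
    DifferentiableOn ℂ (fun z => volterraSol k g z x) Ω := by
  have hn : ∀ n, ∀ x, DifferentiableOn ℂ (fun z => picard k g n z x) Ω := by
    intro n
    induction n with
    | zero => exact hgd
    | succ n ih =>
      intro x
      refine differentiableOn_integral_of_dominated hΩ
        (b := fun y => κ y * (M * leftMass κ y ^ n / n.factorial)) ?_ ?_
        (integrable_mul_leftMass_pow' hk.cont_bound hk.integrable_bound hk.nonneg n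
          M).integrableOn ?_
      · intro z _
        have h1 : Continuous fun y : ℝ => k z x y :=
          hk.cont.comp (f := fun y : ℝ => (z, x, y)) (by fun_prop)
        have h2 : Continuous fun y : ℝ => picard k g n z y :=
          (picard_spec hk hg hgM n).1.comp (f := fun y : ℝ => (z, y)) (by fun_prop)
        exact (h1.clm_apply h2).aestronglyMeasurable
      · filter_upwards [ae_restrict_mem measurableSet_Iic] with y hy z _
        exact hk.norm_apply_le hy ((picard_spec hk hg hgM n).2 _ _)
      · exact ae_of_all _ fun y => (hkd x y).clm_apply (ih y)
  exact Complex.differentiableOn_tsum_of_summable_norm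
    (summable_volterra_bound (M := M) (∫ y, κ y)) (fun n => hn n x) hΩ
    fun n z _ => norm_picard_le hk hg hgM n z x

end Solver

end

section

/-! ### Matrices acting on column vectors -/

/-- The action of a matrix on columns as a continuous linear map. -/
def matCLM (A : Matrix Idx Idx ℂ) : (Idx → ℂ) →L[ℂ] (Idx → ℂ) :=
  LinearMap.toContinuousLinearMap (Matrix.toLin' A)

@[simp] lemma matCLM_apply (A : Matrix Idx Idx ℂ) (v : Idx → ℂ) : matCLM A v = A *ᵥ v := by
  simp [matCLM]

/-- A finite combination of fixed operators with the entries as coefficients: this is how entrywise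
regularity passes to operator-valued maps. -/
lemma matCLM_eq_sum (A : Matrix Idx Idx ℂ) :
    matCLM A = ∑ i, ∑ l, A i l • matCLM (Matrix.single i l 1) := by
  conv_lhs => rw [Matrix.matrix_eq_sum_single A]
  have h : ∀ i l, Matrix.single i l (A i l) = A i l • Matrix.single i l (1 : ℂ) := by
    intro i l; simp [Matrix.smul_single]
  simp only [h, matCLM, map_sum, map_smul]

lemma norm_matCLM_le (A : Matrix Idx Idx ℂ) : ‖matCLM A‖ ≤ ∑ i, ∑ l, ‖A i l‖ := by
  refine ContinuousLinearMap.opNorm_le_bound _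
    (Finset.sum_nonneg fun i _ => Finset.sum_nonneg fun l _ => norm_nonneg _) fun v => ?_
  rw [matCLM_apply]
  refine (pi_norm_le_iff_of_nonneg (mul_nonneg (Finset.sum_nonneg fun i _ =>
    Finset.sum_nonneg fun l _ => norm_nonneg _) (norm_nonneg v))).2 fun i => ?_
  have h1 : ‖(A *ᵥ v) i‖ ≤ ∑ l, ‖A i l‖ * ‖v‖ := by
    refine (norm_sum_le Finset.univ fun l => A i l * v l).trans (Finset.sum_le_sum fun l _ => ?_)
    rw [norm_mul]
    exact mul_le_mul_of_nonneg_left (norm_le_pi_norm v l) (norm_nonneg _)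
  refine h1.trans ?_
  rw [← Finset.sum_mul]
  refine mul_le_mul_of_nonneg_right ?_ (norm_nonneg v)
  exact Finset.single_le_sum (f := fun i => ∑ l, ‖A i l‖)
    (fun i _ => Finset.sum_nonneg fun l _ => norm_nonneg _) (Finset.mem_univ i)

lemma continuous_matCLM {X : Type*} [TopologicalSpace X] {A : X → Matrix Idx Idx ℂ}
    (hA : ∀ i l, Continuous fun x => A x i l) : Continuous fun x => matCLM (A x) := by
  simp only [matCLM_eq_sum (A _)]
  exact continuous_finsetSum _ fun i _ => continuous_finsetSum _ fun l _ =>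
    (hA i l).smul continuous_const

lemma differentiableOn_matCLM {A : ℂ → Matrix Idx Idx ℂ} {Ω : Set ℂ}
    (hA : ∀ i l, DifferentiableOn ℂ (fun x => A x i l) Ω) :
    DifferentiableOn ℂ (fun x => matCLM (A x)) Ω := by
  simp only [matCLM_eq_sum (A _)]
  exact DifferentiableOn.fun_sum fun i _ => DifferentiableOn.fun_sum fun l _ =>
    (hA i l).smul_const _

lemma hasDerivAt_matCLM {A : ℝ → Matrix Idx Idx ℂ} {A' : Matrix Idx Idx ℂ} {x : ℝ}
    (hA : ∀ i l, HasDerivAt (fun x => A x i l) (A' i l) x) :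
    HasDerivAt (fun x => matCLM (A x)) (matCLM A') x := by
  simp only [matCLM_eq_sum (A _), matCLM_eq_sum A']
  exact HasDerivAt.fun_sum fun i _ => HasDerivAt.fun_sum fun l _ =>
    (((ContinuousLinearMap.toSpanSingleton ℂ
      (matCLM (Matrix.single i l 1))).restrictScalars ℝ).hasFDerivAt.comp_hasDerivAt x (hA i l))

/-! ### Eigenfunctions normalized at `-∞` -/

/-- An integrable continuous potential. -/
structure IsPotential (U : ℝ → Matrix Idx Idx ℂ) : Prop where
  cont : ∀ i l, Continuous fun x => U x i l
  integrable : ∀ i l, Integrable fun x => U x i l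

/-- The entry sum norm of the potential. -/
def potNorm (U : ℝ → Matrix Idx Idx ℂ) (x : ℝ) : ℝ := ∑ i, ∑ l, ‖U x i l‖

lemma potNorm_nonneg (U : ℝ → Matrix Idx Idx ℂ) (x : ℝ) : 0 ≤ potNorm U x :=
  Finset.sum_nonneg fun _ _ => Finset.sum_nonneg fun _ _ => norm_nonneg _

lemma IsPotential.continuous_potNorm {U : ℝ → Matrix Idx Idx ℂ} (hU : IsPotential U) :
    Continuous (potNorm U) :=
  continuous_finsetSum _ fun i _ => continuous_finsetSum _ fun l _ => (hU.cont i l).norm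

lemma IsPotential.integrable_potNorm {U : ℝ → Matrix Idx Idx ℂ} (hU : IsPotential U) :
    Integrable (potNorm U) :=
  integrable_finsetSum _ fun i _ => integrable_finsetSum _ fun l _ => (hU.integrable i l).norm

lemma norm_mulVec_le_potNorm (U : ℝ → Matrix Idx Idx ℂ) (y : ℝ) (v : Idx → ℂ) :
    ‖U y *ᵥ v‖ ≤ potNorm U y * ‖v‖ := by
  rw [← matCLM_apply]
  exact ((matCLM (U y)).le_opNorm v).trans
    (mul_le_mul_of_nonneg_right (norm_matCLM_le _) (norm_nonneg v))

/-- The closed half plane of spectral parameters in which the `j`-th column normalized at `-∞`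
exists. -/
def leftHalf (j : Idx) : Set ℂ := {z | 0 ≤ (sgn j).re * z.im}

/-- The interior of `leftHalf j`. -/
def leftHalfOpen (j : Idx) : Set ℂ := {z | 0 < (sgn j).re * z.im}

lemma leftHalfOpen_subset (j : Idx) : leftHalfOpen j ⊆ leftHalf j := fun _ hz =>
  le_of_lt (Set.mem_ofPred_eq ▸ hz)

lemma isOpen_leftHalfOpen (j : Idx) : IsOpen (leftHalfOpen j) :=
  isOpen_lt continuous_const (continuous_const.mul Complex.continuous_im)

@[simp] lemma leftHalf_inl (i : Fin 2) : leftHalf (Sum.inl i) = {z | 0 ≤ z.im} := by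
  ext z; simp [leftHalf, sgn]

@[simp] lemma leftHalf_inr (i : Fin 2) : leftHalf (Sum.inr i) = {z | z.im ≤ 0} := by
  ext z; simp [leftHalf, sgn]

@[simp] lemma leftHalfOpen_inl (i : Fin 2) : leftHalfOpen (Sum.inl i) = {z | 0 < z.im} := by
  ext z; simp [leftHalfOpen, sgn]

@[simp] lemma leftHalfOpen_inr (i : Fin 2) : leftHalfOpen (Sum.inr i) = {z | z.im < 0} := by
  ext z; simp [leftHalfOpen, sgn]

/-- The factor `e^{iλ(y-x)(σ_i-σ_j)}` of the Volterra kernel. -/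
def expFactor (z : ℂ) (i j : Idx) (x y : ℝ) : ℂ :=
  Complex.exp (Complex.I * z * ((y : ℂ) - x) * (sgn i - sgn j))

/-- A nonzero `σ_i - σ_j` equals `-2σ_j`, so the exponent has real part `-2 σ_j Im z (x - y) ≤ 0`.
This is what singles out the half plane of each column. -/
lemma norm_expFactor_le {z : ℂ} {j : Idx} (hz : z ∈ leftHalf j) (i : Idx) {x y : ℝ}
    (hxy : y ≤ x) : ‖expFactor z i j x y‖ ≤ 1 := by
  rw [expFactor, Complex.norm_exp, Real.exp_le_one_iff]
  have hz' : 0 ≤ (sgn j).re * z.im := hz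
  rcases i with i | i <;> rcases j with j | j <;> simp [sgn] at hz' ⊢ <;> nlinarith

lemma expFactor_self (z : ℂ) (i j : Idx) (x : ℝ) : expFactor z i j x x = 1 := by
  simp [expFactor]

lemma hasDerivAt_expFactor (z : ℂ) (i j : Idx) (x y : ℝ) :
    HasDerivAt (expFactor z i j x) (Complex.I * z * (sgn i - sgn j) * expFactor z i j x y) y := by
  have h0 : HasDerivAt (fun y : ℝ => (y : ℂ)) 1 y := Complex.ofRealCLM.hasDerivAt
  have h1 := (((h0.sub_const (x : ℂ)).const_mul (Complex.I * z)).mul_const (sgn i - sgn j)).cexp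
  refine h1.congr_deriv ?_
  rw [expFactor]
  ring

/-- Projection to the half plane `leftHalf j`. -/
def halfProj (j : Idx) (z : ℂ) : ℂ :=
  z.re + ((sgn j).re * max 0 ((sgn j).re * z.im) : ℝ) * Complex.I

lemma halfProj_mem (j : Idx) (z : ℂ) : halfProj j z ∈ leftHalf j := by
  rcases j with j | j <;> simp [leftHalf, halfProj, sgn]

lemma halfProj_of_mem {j : Idx} {z : ℂ} (hz : z ∈ leftHalf j) : halfProj j z = z := by
  have hz' : 0 ≤ (sgn j).re * z.im := hz
  rw [halfProj, max_eq_right hz']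
  apply Complex.ext
  · simp
  · rcases j with j | j <;> simp [sgn]

lemma continuous_halfProj (j : Idx) : Continuous (halfProj j) := by
  unfold halfProj
  fun_prop

/-- The kernel of the Volterra equation of the `j`-th column. -/
def minusKernel (U : ℝ → Matrix Idx Idx ℂ) (j : Idx) (z : ℂ) (x y : ℝ) :
    (Idx → ℂ) →L[ℂ] (Idx → ℂ) :=
  matCLM (Matrix.of fun i l => expFactor (halfProj j z) i j x y * U y i l)

lemma minusKernel_apply (U : ℝ → Matrix Idx Idx ℂ) (j : Idx) (z : ℂ) (x y : ℝ) (v : Idx → ℂ)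
    (i : Idx) :
    minusKernel U j z x y v i = expFactor (halfProj j z) i j x y * (U y *ᵥ v) i := by
  simp only [minusKernel, matCLM_apply, Matrix.mulVec, dotProduct, Matrix.of_apply, Finset.mul_sum,
    mul_assoc]

variable {U : ℝ → Matrix Idx Idx ℂ}

/-- Composing with `halfProj` makes the kernel continuous and dominated for every complex `z`, as
the solver demands; on `leftHalf j` the projection is the identity. -/
lemma dominatedKernel_minusKernel (hU : IsPotential U) (j : Idx) :
    DominatedKernel (minusKernel U j) (potNorm U) where
  cont_bound := hU.continuous_potNorm
  integrable_bound := hU.integrable_potNorm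
  nonneg := potNorm_nonneg U
  cont := by
    refine continuous_matCLM fun i l => ?_
    have h1 := continuous_halfProj j
    have h2 := hU.cont i l
    simp only [Matrix.of_apply, expFactor]
    fun_prop
  le := fun z x y hxy => by
    refine (norm_matCLM_le _).trans (Finset.sum_le_sum fun i _ => Finset.sum_le_sum fun l _ => ?_)
    rw [Matrix.of_apply, norm_mul]
    exact mul_le_of_le_one_left (norm_nonneg _) (norm_expFactor_le (halfProj_mem j z) i hxy)

/-- The `j`-th column of the identity matrix. -/
def unitCol (j : Idx) : Idx → ℂ := fun i => (1 : Matrix Idx Idx ℂ) i j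

/-- The `j`-th column of the eigenfunction normalized at `-∞`. -/
def minusCol (U : ℝ → Matrix Idx Idx ℂ) (j : Idx) (z : ℂ) (x : ℝ) : Idx → ℂ :=
  volterraSol (minusKernel U j) (fun _ _ => unitCol j) z x

lemma norm_expFactor_mulVec_le {z : ℂ} {j : Idx} (hz : z ∈ leftHalf j) (i : Idx) {x y : ℝ}
    (hxy : y ≤ x) {v : Idx → ℂ} {C : ℝ} (hv : ‖v‖ ≤ C) :
    ‖expFactor z i j x y * (U y *ᵥ v) i‖ ≤ potNorm U y * C := by
  rw [norm_mul]
  refine (mul_le_of_le_one_left (norm_nonneg _) (norm_expFactor_le hz i hxy)).trans ?_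
  exact (norm_le_pi_norm _ i).trans ((norm_mulVec_le_potNorm U y v).trans
    (mul_le_mul_of_nonneg_left hv (potNorm_nonneg U y)))

lemma IsPotential.continuous_mulVec (hU : IsPotential U) {f : ℝ → Idx → ℂ} (hf : Continuous f)
    (i : Idx) : Continuous fun y => (U y *ᵥ f y) i := by
  simp only [Matrix.mulVec, dotProduct]
  exact continuous_finsetSum _ fun l _ => (hU.cont i l).mul ((continuous_apply l).comp hf)

lemma continuous_expFactor (z : ℂ) (i j : Idx) (x : ℝ) : Continuous (expFactor z i j x) := by
  unfold expFactor
  fun_prop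

lemma integrableOn_expFactor_mulVec (hU : IsPotential U) {z : ℂ} {j : Idx} (hz : z ∈ leftHalf j)
    (i : Idx) (x : ℝ) {f : ℝ → Idx → ℂ} (hf : Continuous f) {C : ℝ} (hC : ∀ y, ‖f y‖ ≤ C) :
    IntegrableOn (fun y => expFactor z i j x y * (U y *ᵥ f y) i) (Set.Iic x) := by
  refine (hU.integrable_potNorm.mul_const C).integrableOn.mono'
    ((continuous_expFactor z i j x).mul
      (hU.continuous_mulVec hf i)).aestronglyMeasurable ?_
  filter_upwards [ae_restrict_mem measurableSet_Iic] with y hy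
  exact norm_expFactor_mulVec_le hz i hy (hC y)

lemma IsMuMinusColumn.exists_bound {z : ℂ} {j : Idx} {f : ℝ → Idx → ℂ}
    (hf : IsMuMinusColumn U z j f) : ∃ C, 0 ≤ C ∧ ∀ x, ‖f x‖ ≤ C := by
  obtain ⟨C, hC⟩ := hf.2.1
  have hC0 : 0 ≤ C := (norm_nonneg _).trans (hC 0 (Sum.inl 0))
  exact ⟨C, hC0, fun x => (pi_norm_le_iff_of_nonneg hC0).2 (hC x)⟩

lemma IsMuMinusColumn.eq {z : ℂ} {j : Idx} {f : ℝ → Idx → ℂ}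
    (hf : IsMuMinusColumn U z j f) (x : ℝ) (i : Idx) :
    f x i = unitCol j i + ∫ y in Set.Iic x, expFactor z i j x y * (U y *ᵥ f y) i :=
  hf.2.2 x i

lemma continuous_minusCol (hU : IsPotential U) (j : Idx) :
    Continuous fun q : ℂ × ℝ => minusCol U j q.1 q.2 :=
  continuous_volterraSol (dominatedKernel_minusKernel hU j) continuous_const
    (M := ‖unitCol j‖) fun _ _ => le_rfl

lemma isMuMinusColumn_minusCol (hU : IsPotential U) {j : Idx} {z : ℂ} (hz : z ∈ leftHalf j) :
    IsMuMinusColumn U z j (minusCol U j z) := by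
  have hk := dominatedKernel_minusKernel hU j
  have hg : Continuous fun q : ℂ × ℝ => (fun _ _ => unitCol j : ℂ → ℝ → Idx → ℂ) q.1 q.2 :=
    continuous_const
  have hcont : Continuous (minusCol U j z) :=
    (continuous_minusCol hU j).comp (f := fun x : ℝ => (z, x)) (by fun_prop)
  have hb := norm_volterraSol_le hk hg (M := ‖unitCol j‖) (fun _ _ => le_rfl) z
  refine ⟨hcont, ⟨_, fun x i => (norm_le_pi_norm _ i).trans (hb x)⟩, fun x i => ?_⟩
  have h := congrFun (volterraSol_eq hk hg (M := ‖unitCol j‖) (fun _ _ => le_rfl) z x) i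
  have hpr := (ContinuousLinearMap.proj (R := ℂ) (φ := fun _ : Idx => ℂ) i).integral_comp_comm
    (μ := volume.restrict (Set.Iic x)) (φ := fun y => minusKernel U j z x y (minusCol U j z y)) ?_
  · change minusCol U j z x i = unitCol j i + _
    change minusCol U j z x i = unitCol j i + _ at h
    rw [h]
    congr 1
    refine Eq.trans hpr.symm ?_
    refine integral_congr_ae (ae_of_all _ fun y => ?_)
    simp only [ContinuousLinearMap.proj_apply, minusKernel_apply, halfProj_of_mem hz]
    rfl
  · refine (hU.integrable_potNorm.mul_const
      (∑' n : ℕ, ‖unitCol j‖ * (∫ y, potNorm U y) ^ n / n.factorial)).integrableOn.mono'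
      (μ := volume.restrict (Set.Iic x)) ?_ ?_
    · have h1 : Continuous fun y : ℝ => minusKernel U j z x y :=
        hk.cont.comp (f := fun y : ℝ => (z, x, y)) (by fun_prop)
      exact (h1.clm_apply hcont).aestronglyMeasurable
    · filter_upwards [ae_restrict_mem measurableSet_Iic] with y hy
      exact hk.norm_apply_le hy (hb y)

/-- The norm of the difference of two bounded solutions is a bounded subsolution of the homogeneous
Volterra inequality. Uniqueness is used to identify the `Classical.epsilon` choices and, later, the
time-evolved columns. -/
lemma IsMuMinusColumn.unique (hU : IsPotential U) {j : Idx} {z : ℂ} (hz : z ∈ leftHalf j)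
    {f g : ℝ → Idx → ℂ} (hf : IsMuMinusColumn U z j f) (hg : IsMuMinusColumn U z j g) :
    f = g := by
  obtain ⟨C, hC0, hC⟩ := hf.exists_bound
  obtain ⟨D, hD0, hD⟩ := hg.exists_bound
  have hb : ∀ y, ‖f y - g y‖ ≤ C + D := fun y =>
    (norm_sub_le _ _).trans (add_le_add (hC y) (hD y))
  have hu : ∀ x, ‖f x - g x‖ ≤ ∫ y in Set.Iic x, potNorm U y * ‖f y - g y‖ := by
    intro x
    refine (pi_norm_le_iff_of_nonneg (integral_nonneg fun y =>
      mul_nonneg (potNorm_nonneg U y) (norm_nonneg _))).2 fun i => ?_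
    rw [Pi.sub_apply, hf.eq, hg.eq, add_sub_add_left_eq_sub,
      ← integral_sub (integrableOn_expFactor_mulVec hU hz i x hf.1 hC)
        (integrableOn_expFactor_mulVec hU hz i x hg.1 hD)]
    refine norm_integral_le_of_norm_le ?_ ?_
    · refine Integrable.integrableOn ?_
      refine (hU.integrable_potNorm.mul_const (C + D)).mono'
        (hU.continuous_potNorm.mul (hf.1.sub hg.1).norm).aestronglyMeasurable
        (ae_of_all _ fun y => ?_)
      rw [Real.norm_of_nonneg (mul_nonneg (potNorm_nonneg U y) (norm_nonneg _))]
      exact mul_le_mul_of_nonneg_left (hb y) (potNorm_nonneg U y)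
    · filter_upwards [ae_restrict_mem measurableSet_Iic] with y hy
      rw [← mul_sub, ← Pi.sub_apply, ← Matrix.mulVec_sub]
      exact norm_expFactor_mulVec_le hz i hy le_rfl
  funext x
  have := eq_zero_of_le_integral_Iic hU.continuous_potNorm hU.integrable_potNorm
    (potNorm_nonneg U) (u := fun x => ‖f x - g x‖) (fun x => norm_nonneg _) hb hu x
  exact sub_eq_zero.1 (norm_eq_zero.1 this)

lemma IsMuMinusColumn.eq_minusCol (hU : IsPotential U) {j : Idx} {z : ℂ} (hz : z ∈ leftHalf j)
    {f : ℝ → Idx → ℂ} (hf : IsMuMinusColumn U z j f) : f = minusCol U j z :=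
  hf.unique hU hz (isMuMinusColumn_minusCol hU hz)

lemma epsilon_isMuMinusColumn (hU : IsPotential U) {j : Idx} {z : ℂ} (hz : z ∈ leftHalf j) :
    Classical.epsilon (IsMuMinusColumn U z j) = minusCol U j z :=
  (Classical.epsilon_spec (p := IsMuMinusColumn U z j)
    ⟨_, isMuMinusColumn_minusCol hU hz⟩).eq_minusCol hU hz

lemma differentiableOn_minusCol (hU : IsPotential U) (j : Idx) (x : ℝ) :
    DifferentiableOn ℂ (fun z => minusCol U j z x) (leftHalfOpen j) := by
  refine differentiableOn_volterraSol (dominatedKernel_minusKernel hU j)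
    continuous_const (M := ‖unitCol j‖) (fun _ _ => le_rfl) (isOpen_leftHalfOpen j)
    (fun x y => ?_) (fun _ => differentiableOn_const _) x
  refine differentiableOn_matCLM fun i l => ?_
  have h : DifferentiableOn ℂ (fun z => expFactor z i j x y * U y i l) (leftHalfOpen j) := by
    unfold expFactor
    fun_prop
  refine h.congr fun z hz => ?_
  rw [Matrix.of_apply, halfProj_of_mem (leftHalfOpen_subset j hz)]

lemma tendsto_minusCol_atBot (hU : IsPotential U) {j : Idx} {z : ℂ} (hz : z ∈ leftHalf j) :
    Tendsto (minusCol U j z) atBot (𝓝 (unitCol j)) := by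
  have hf := isMuMinusColumn_minusCol hU hz
  obtain ⟨C, hC0, hC⟩ := hf.exists_bound
  rw [tendsto_iff_norm_sub_tendsto_zero]
  have hlim : Tendsto (fun x => leftMass (potNorm U) x * C) atBot (𝓝 0) := by
    simpa using (tendsto_leftMass_atBot hU.integrable_potNorm).mul_const C
  refine squeeze_zero (fun x => norm_nonneg _) (fun x => ?_) hlim
  refine (pi_norm_le_iff_of_nonneg
    (mul_nonneg (leftMass_nonneg (potNorm_nonneg U) x) hC0)).2 fun i => ?_
  rw [Pi.sub_apply, hf.eq, add_sub_cancel_left, leftMass, ← integral_mul_const]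
  refine norm_integral_le_of_norm_le (hU.integrable_potNorm.mul_const C).integrableOn ?_
  filter_upwards [ae_restrict_mem measurableSet_Iic] with y hy
  exact norm_expFactor_mulVec_le hz i hy (hC y)

/-- The coefficient matrix `-iλ(σ - σ_j) + U` of the spectral problem for the `j`-th column. -/
def specMat (U : ℝ → Matrix Idx Idx ℂ) (z : ℂ) (j : Idx) (x : ℝ) : Matrix Idx Idx ℂ :=
  Matrix.diagonal (fun i => -Complex.I * z * (sgn i - sgn j)) + U x

lemma specMat_mulVec (z : ℂ) (j : Idx) (x : ℝ) (v : Idx → ℂ) (i : Idx) :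
    (specMat U z j x *ᵥ v) i = -Complex.I * z * (sgn i - sgn j) * v i + (U x *ᵥ v) i := by
  simp [specMat, Matrix.add_mulVec, Matrix.mulVec_diagonal]

lemma hasDerivAt_integral_Iic {F : Type*} [NormedAddCommGroup F] [NormedSpace ℝ F]
    [CompleteSpace F] {g : ℝ → F} (hc : Continuous g) (hi : ∀ x, IntegrableOn g (Set.Iic x))
    (x : ℝ) : HasDerivAt (fun x => ∫ y in Set.Iic x, g y) (g x) x := by
  have h : (fun x => ∫ y in Set.Iic x, g y) =
      fun x => (∫ y in Set.Iic 0, g y) + ∫ y in (0 : ℝ)..x, g y := by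
    funext z
    rw [← intervalIntegral.integral_Iic_sub_Iic (hi 0) (hi z)]
    abel
  rw [h]
  exact (intervalIntegral.integral_hasDerivAt_right (hc.intervalIntegrable _ _)
    (hc.stronglyMeasurableAtFilter _ _) hc.continuousAt).const_add _

lemma expFactor_mul (z : ℂ) (i j : Idx) (x w y : ℝ) :
    expFactor z i j x y = expFactor z i j x w * expFactor z i j w y := by
  rw [expFactor, expFactor, expFactor, ← Complex.exp_add]
  congr 1
  ring

lemma hasDerivAt_expFactor_left (z : ℂ) (i j : Idx) (x y : ℝ) :
    HasDerivAt (fun x => expFactor z i j x y)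
      (-Complex.I * z * (sgn i - sgn j) * expFactor z i j x y) x := by
  have h0 : HasDerivAt (fun y : ℝ => (y : ℂ)) 1 x := Complex.ofRealCLM.hasDerivAt
  have h1 := (((h0.const_sub (y : ℂ)).const_mul (Complex.I * z)).mul_const (sgn i - sgn j)).cexp
  refine h1.congr_deriv ?_
  rw [expFactor]
  ring

/-- The exponential factors as `expFactor x 0 * expFactor 0 y`, so the dependence on `x` inside the
integral can be pulled out and the product rule applies. -/
lemma hasDerivAt_minusCol (hU : IsPotential U) {j : Idx} {z : ℂ} (hz : z ∈ leftHalf j) (x : ℝ) :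
    HasDerivAt (minusCol U j z) (specMat U z j x *ᵥ minusCol U j z x) x := by
  have hf := isMuMinusColumn_minusCol hU hz
  obtain ⟨C, hC0, hC⟩ := hf.exists_bound
  refine hasDerivAt_pi.2 fun i => ?_
  have hcont : Continuous fun y => expFactor z i j 0 y * (U y *ᵥ minusCol U j z y) i :=
    (continuous_expFactor z i j 0).mul (hU.continuous_mulVec hf.1 i)
  have hint : ∀ w, IntegrableOn (fun y => expFactor z i j 0 y * (U y *ᵥ minusCol U j z y) i)
      (Set.Iic w) := by
    intro w
    have h := (integrableOn_expFactor_mulVec hU hz i w hf.1 hC).const_mul (expFactor z i j 0 w)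
    refine h.congr (ae_of_all _ fun y => ?_)
    simp only
    rw [expFactor_mul z i j 0 w y]
    ring
  have heq : (fun x => minusCol U j z x i) = fun x => unitCol j i + expFactor z i j x 0 *
      ∫ y in Set.Iic x, expFactor z i j 0 y * (U y *ᵥ minusCol U j z y) i := by
    funext x
    rw [hf.eq, ← integral_const_mul]
    simp only [← mul_assoc, ← expFactor_mul]
  have hd := ((hasDerivAt_expFactor_left z i j x 0).mul
    (hasDerivAt_integral_Iic hcont hint x)).const_add (unitCol j i)
  rw [heq]
  refine hd.congr_deriv ?_
  rw [specMat_mulVec, congrFun heq x, ← mul_assoc, ← expFactor_mul, expFactor_self]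
  -- The diagonal part of the coefficient matrix annihilates the inhomogeneity.
  have h0 : (sgn i - sgn j) * unitCol j i = 0 := by
    by_cases hij : i = j
    · simp [hij]
    · simp [unitCol, hij]
  linear_combination (-Complex.I * z) * (-h0)

/-- A bounded solution of the spectral problem with the normalization at `-∞` solves the Volterra
equation. -/
lemma isMuMinusColumn_of_hasDerivAt (hU : IsPotential U) {j : Idx} {z : ℂ} (hz : z ∈ leftHalf j)
    {f : ℝ → Idx → ℂ} {C : ℝ} (hC : ∀ x, ‖f x‖ ≤ C)
    (hd : ∀ x, HasDerivAt f (specMat U z j x *ᵥ f x) x)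
    (hlim : Tendsto f atBot (𝓝 (unitCol j))) : IsMuMinusColumn U z j f := by
  have hcont : Continuous f := continuous_iff_continuousAt.2 fun x => (hd x).continuousAt
  refine ⟨hcont, ⟨C, fun x i => (norm_le_pi_norm _ i).trans (hC x)⟩, fun x i => ?_⟩
  -- `expFactor` is the integrating factor that removes the diagonal part of the system.
  have hder : ∀ y, HasDerivAt (fun y => expFactor z i j x y * f y i)
      (expFactor z i j x y * (U y *ᵥ f y) i) y := by
    intro y
    refine ((hasDerivAt_expFactor z i j x y).mul (hasDerivAt_pi.1 (hd y) i)).congr_deriv ?_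
    rw [specMat_mulVec]
    ring
  have hlim' : Tendsto (fun y => expFactor z i j x y * f y i) atBot (𝓝 (unitCol j i)) := by
    have hfi := (tendsto_pi_nhds.1 hlim) i
    by_cases hs : sgn i = sgn j
    · have : ∀ y, expFactor z i j x y = 1 := fun y => by simp [expFactor, hs]
      simpa [this] using hfi
    -- Components with `σ_i ≠ σ_j` tend to zero, and the factor is at most one in norm for `y ≤ x`,
    -- so the boundary term at `-∞` vanishes.
    · have h0 : unitCol j i = 0 := by
        have : i ≠ j := fun h => hs (by rw [h])
        simp [unitCol, this]
      rw [h0] at hfi ⊢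
      refine squeeze_zero_norm' ?_ (tendsto_zero_iff_norm_tendsto_zero.1 hfi)
      filter_upwards [eventually_le_atBot x] with y hy
      rw [norm_mul]
      exact mul_le_of_le_one_left (norm_nonneg _) (norm_expFactor_le hz i hy)
  have h := integral_Iic_of_hasDerivAt_of_tendsto' (a := x) (fun y _ => hder y)
    (integrableOn_expFactor_mulVec hU hz i x hcont hC) hlim'
  rw [expFactor_self, one_mul] at h
  change f x i = unitCol j i + ∫ y in Set.Iic x, expFactor z i j x y * (U y *ᵥ f y) i
  rw [h]
  ring

end

section

/-! ### The reflection `x ↦ -x` -/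

/-- The reflected field `-Q(-x, t)`. -/
def reflQ (Q : ℝ → ℝ → Matrix (Fin 2) (Fin 2) ℂ) (x t : ℝ) : Matrix (Fin 2) (Fin 2) ℂ :=
  -Q (-x) t

variable {Q : ℝ → ℝ → Matrix (Fin 2) (Fin 2) ℂ} {T : Set ℝ}

lemma dx_reflQ (x t : ℝ) : dx (reflQ Q) x t = dx Q (-x) t := by
  ext i j
  simp only [dx, Matrix.of_apply, reflQ, Matrix.neg_apply]
  rw [deriv.fun_neg, deriv_comp_neg (fun y => Q y t i j), neg_neg]

lemma dx_dx_reflQ (x t : ℝ) : dx (dx (reflQ Q)) x t = -dx (dx Q) (-x) t := by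
  ext i j
  have h : dx (reflQ Q) = fun x t => dx Q (-x) t := by
    funext x t; exact dx_reflQ x t
  rw [h]
  simp only [dx, Matrix.of_apply, Matrix.neg_apply]
  exact deriv_comp_neg (fun y => deriv (fun z => Q z t i j) y) x

lemma continuousOn_comp_neg {f : ℝ × ℝ → ℂ} (hf : ContinuousOn f (Set.univ ×ˢ T)) :
    ContinuousOn (fun p : ℝ × ℝ => f (-p.1, p.2)) (Set.univ ×ˢ T) :=
  hf.comp (f := fun p : ℝ × ℝ => (-p.1, p.2)) (by fun_prop) fun p hp => ⟨trivial, hp.2⟩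

lemma IsSolution.refl (hQ : IsSolution Q T) : IsSolution (reflQ Q) T where
  symm := fun x t ht => by
    have := hQ.symm (-x) t ht
    simp only [reflQ, Matrix.IsSymm, Matrix.transpose_neg] at this ⊢
    rw [this]
  contDiff_space := fun t ht i j =>
    ((hQ.contDiff_space t ht i j).comp contDiff_neg).neg
  cont := fun i j => (continuousOn_comp_neg (hQ.cont i j)).neg
  cont_dx := fun i j => by
    simp only [dx_reflQ]
    exact continuousOn_comp_neg (hQ.cont_dx i j)
  cont_dxx := fun i j => by
    simp only [dx_dx_reflQ, Matrix.neg_apply]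
    exact (continuousOn_comp_neg (hQ.cont_dxx i j)).neg
  equation := fun x t ht i j => by
    obtain ⟨q', h1, h2⟩ := hQ.equation (-x) t ht i j
    refine ⟨-q', h1.neg, ?_⟩
    rw [dx_dx_reflQ]
    simp only [reflQ, Matrix.neg_apply, Matrix.conjTranspose_neg, Matrix.neg_mul, neg_neg, mul_neg]
    linear_combination -h2

lemma tendsto_comp_neg {f : ℝ → ℂ} (hf : Tendsto f (atBot ⊔ atTop) (𝓝 0)) :
    Tendsto (fun x => f (-x)) (atBot ⊔ atTop) (𝓝 0) := by
  rw [tendsto_sup] at hf ⊢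
  exact ⟨hf.2.comp tendsto_neg_atBot_atTop, hf.1.comp tendsto_neg_atTop_atBot⟩

lemma IsDecaying.refl (hQ : IsDecaying Q T) : IsDecaying (reflQ Q) T where
  integrable := fun t ht i j => (hQ.integrable t ht i j).comp_neg.neg
  tendsto := fun t ht i j => by
    simpa [reflQ] using (tendsto_comp_neg (hQ.tendsto t ht i j)).neg
  tendsto_dx := fun t ht i j => by
    simpa [dx_reflQ] using tendsto_comp_neg (hQ.tendsto_dx t ht i j)
  bounded := fun K hKT hK => by
    obtain ⟨C, hC⟩ := hQ.bounded K hKT hK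
    refine ⟨C, fun x t ht i j => ?_⟩
    rw [dx_reflQ]
    simpa [reflQ] using hC (-x) t ht i j

lemma potential_reflQ (x t : ℝ) : potential (reflQ Q) x t = -potential Q (-x) t := by
  simp [potential, reflQ, Matrix.fromBlocks_neg]

lemma isPotential_potential (hQ : IsSolution Q T) (hd : IsDecaying Q T) {t : ℝ} (ht : t ∈ T) :
    IsPotential fun y => potential Q y t where
  cont := by
    have hc : ∀ i j, Continuous fun x => Q x t i j := fun i j =>
      (hQ.contDiff_space t ht i j).continuous
    rintro (i | i) (l | l) <;> simp only [potential, Matrix.fromBlocks_apply₁₁,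
      Matrix.fromBlocks_apply₁₂, Matrix.fromBlocks_apply₂₁, Matrix.fromBlocks_apply₂₂,
      Matrix.neg_apply, Matrix.conjTranspose_apply]
    · exact continuous_const
    · exact hc i l
    · exact (continuous_star.comp (hc l i)).neg
    · exact continuous_const
  integrable := by
    have hc : ∀ i j, Integrable fun x => Q x t i j := fun i j => hd.integrable t ht i j
    rintro (i | i) (l | l) <;> simp only [potential, Matrix.fromBlocks_apply₁₁,
      Matrix.fromBlocks_apply₁₂, Matrix.fromBlocks_apply₂₁, Matrix.fromBlocks_apply₂₂,
      Matrix.neg_apply, Matrix.conjTranspose_apply, Matrix.zero_apply]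
    · exact integrable_zero _ _ _
    · exact hc i l
    · refine (((hc l i).norm).mono' ?_ (ae_of_all _ fun x => ?_)).neg
      · exact continuous_star.comp_aestronglyMeasurable (hc l i).aestronglyMeasurable
      · exact (norm_star _).le
    · exact integrable_zero _ _ _

/-- The substitution `y ↦ -y` exchanges the two normalizations when `Q` becomes `-Q(-x)` and `λ`
becomes `-λ`. All facts about `μ₊` are thereby read off from those about `μ₋`. -/
lemma isMuPlusColumn_iff {U : ℝ → Matrix Idx Idx ℂ} {z : ℂ} {j : Idx} {f : ℝ → Idx → ℂ} :
    IsMuPlusColumn U z j f ↔ IsMuMinusColumn (fun y => -U (-y)) (-z) j (fun x => f (-x)) := by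
  have hint : ∀ (x : ℝ) (i : Idx), ∫ y in Set.Iic x,
      Complex.exp (Complex.I * -z * ((y : ℂ) - x) * (sgn i - sgn j)) *
        ((fun y => -U (-y)) y *ᵥ f (-y)) i = -∫ y in Set.Ioi (-x),
      Complex.exp (Complex.I * z * ((y : ℂ) - (-x : ℝ)) * (sgn i - sgn j)) * (U y *ᵥ f y) i := by
    intro x i
    rw [← integral_comp_neg_Iic x (fun y : ℝ =>
      Complex.exp (Complex.I * z * ((y : ℂ) - (-x : ℝ)) * (sgn i - sgn j)) * (U y *ᵥ f y) i),
      ← integral_neg]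
    refine integral_congr_ae (ae_of_all _ fun y => ?_)
    simp only [Matrix.neg_mulVec, Pi.neg_apply, mul_neg]
    congr 3
    push_cast
    ring
  constructor
  · rintro ⟨h1, ⟨C, hC⟩, h3⟩
    refine ⟨h1.comp continuous_neg, ⟨C, fun x i => hC (-x) i⟩, fun x i => ?_⟩
    refine (h3 (-x) i).trans ?_
    rw [sub_eq_add_neg]
    exact congrArg _ (hint x i).symm
  · rintro ⟨h1, ⟨C, hC⟩, h3⟩
    refine ⟨by simpa [Function.comp_def] using h1.comp continuous_neg,
      ⟨C, fun x i => by simpa using hC (-x) i⟩, fun x i => ?_⟩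
    have h : f (-(-x)) i = _ := h3 (-x) i
    rw [neg_neg] at h
    refine h.trans ?_
    refine Eq.trans (congrArg _ ((hint (-x) i).trans ?_)) (sub_eq_add_neg _ _).symm
    rw [neg_neg]

/-- The `j`-th column of `μ₋`. -/
def mcol (Q : ℝ → ℝ → Matrix (Fin 2) (Fin 2) ℂ) (t : ℝ) (j : Idx) (z : ℂ) (x : ℝ) : Idx → ℂ :=
  minusCol (fun y => potential Q y t) j z x

/-- The `j`-th column of `μ₊`. -/
def pcol (Q : ℝ → ℝ → Matrix (Fin 2) (Fin 2) ℂ) (t : ℝ) (j : Idx) (z : ℂ) (x : ℝ) : Idx → ℂ :=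
  mcol (reflQ Q) t j (-z) (-x)

lemma muMinus_apply (hQ : IsSolution Q T) (hd : IsDecaying Q T) {t : ℝ} (ht : t ∈ T) {j : Idx}
    {z : ℂ} (hz : z ∈ leftHalf j) (x : ℝ) (i : Idx) : muMinus Q x t z i j = mcol Q t j z x i := by
  rw [muMinus, Matrix.of_apply, epsilon_isMuMinusColumn (isPotential_potential hQ hd ht) hz]
  rfl

lemma muPlus_apply (hQ : IsSolution Q T) (hd : IsDecaying Q T) {t : ℝ} (ht : t ∈ T) {j : Idx}
    {z : ℂ} (hz : -z ∈ leftHalf j) (x : ℝ) (i : Idx) : muPlus Q x t z i j = pcol Q t j z x i := by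
  have hU : (fun y => potential (reflQ Q) y t) = fun y => -potential Q (-y) t := by
    funext y; exact potential_reflQ y t
  have hP := isPotential_potential hQ.refl hd.refl ht
  have hm := isMuMinusColumn_minusCol hP hz
  have hex : IsMuPlusColumn (fun y => potential Q y t) z j (pcol Q t j z) := by
    rw [isMuPlusColumn_iff]
    simpa [pcol, mcol, hU] using hm
  have hsp := isMuPlusColumn_iff.1 (Classical.epsilon_spec
    (p := IsMuPlusColumn (fun y => potential Q y t) z j) ⟨_, hex⟩)
  have h := IsMuMinusColumn.eq_minusCol hP hz (by rw [hU]; exact hsp)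
  have h2 := congrFun (congrFun h (-x)) i
  simp only [neg_neg] at h2
  rw [muPlus, Matrix.of_apply, h2]
  rfl

/-! ### The symplectic pairing -/

/-- The bilinear form `fᵀ J g` with `J = [[0, 1], [-1, 0]]`. -/
def pairing (f g : Idx → ℂ) : ℂ :=
  ∑ i : Fin 2, (f (Sum.inl i) * g (Sum.inr i) - f (Sum.inr i) * g (Sum.inl i))

lemma hasDerivAt_mcol (hQ : IsSolution Q T) (hd : IsDecaying Q T) {t : ℝ} (ht : t ∈ T) {j : Idx}
    {z : ℂ} (hz : z ∈ leftHalf j) (x : ℝ) :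
    HasDerivAt (mcol Q t j z) (specMat (fun y => potential Q y t) z j x *ᵥ mcol Q t j z x) x :=
  hasDerivAt_minusCol (isPotential_potential hQ hd ht) hz x

lemma hasDerivAt_pcol (hQ : IsSolution Q T) (hd : IsDecaying Q T) {t : ℝ} (ht : t ∈ T) {j : Idx}
    {z : ℂ} (hz : -z ∈ leftHalf j) (x : ℝ) :
    HasDerivAt (pcol Q t j z) (specMat (fun y => potential Q y t) z j x *ᵥ pcol Q t j z x) x := by
  have h := (hasDerivAt_mcol hQ.refl hd.refl ht hz (-x)).scomp x (hasDerivAt_neg x)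
  refine h.congr_deriv ?_
  funext i
  simp only [Pi.smul_apply, specMat_mulVec, potential_reflQ, Matrix.neg_mulVec, Pi.neg_apply,
    neg_neg, Complex.real_smul, pcol]
  push_cast
  ring

lemma sgn_inl (i : Fin 2) : sgn (Sum.inl i) = 1 := rfl

lemma sgn_inr (i : Fin 2) : sgn (Sum.inr i) = -1 := rfl

/-- For symmetric `Q` one has `UᵀJ + JU = 0`, and `σJ + Jσ = 0`. Only the scalar shifts by `σ_j` and
`σ_k` in the two coefficient matrices survive. -/
lemma hasDerivAt_pairing (hQ : ∀ x t, t ∈ T → (Q x t).IsSymm) {t : ℝ} (ht : t ∈ T) {j k : Idx}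
    {z : ℂ} {f g : ℝ → Idx → ℂ} {x : ℝ}
    (hf : HasDerivAt f (specMat (fun y => potential Q y t) z j x *ᵥ f x) x)
    (hg : HasDerivAt g (specMat (fun y => potential Q y t) z k x *ᵥ g x) x) :
    HasDerivAt (fun x => pairing (f x) (g x))
      (Complex.I * z * (sgn j + sgn k) * pairing (f x) (g x)) x := by
  have hf' := hasDerivAt_pi.1 hf
  have hg' := hasDerivAt_pi.1 hg
  have h : HasDerivAt (fun x => pairing (f x) (g x)) _ x :=
    HasDerivAt.fun_sum fun i (_ : i ∈ Finset.univ) =>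
      ((hf' (Sum.inl i)).mul (hg' (Sum.inr i))).sub ((hf' (Sum.inr i)).mul (hg' (Sum.inl i)))
  refine h.congr_deriv ?_
  have hs : Q x t 0 1 = Q x t 1 0 := (hQ x t ht).apply 1 0
  simp only [specMat_mulVec, pairing, Fin.sum_univ_two, sgn_inl, sgn_inr]
  simp only [potential, Matrix.mulVec, dotProduct, Fin.sum_univ_two,
    Fintype.sum_sum_type, Matrix.fromBlocks_apply₁₁,
    Matrix.fromBlocks_apply₁₂, Matrix.fromBlocks_apply₂₁, Matrix.fromBlocks_apply₂₂,
    Matrix.neg_apply, Matrix.conjTranspose_apply, Matrix.zero_apply, hs]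
  ring

/-- The exponential that makes the pairing of two columns independent of `x`. -/
def pairPhase (z : ℂ) (j k : Idx) (x : ℝ) : ℂ :=
  Complex.exp (-Complex.I * z * (sgn j + sgn k) * x)

lemma hasDerivAt_pairPhase (z : ℂ) (j k : Idx) (x : ℝ) :
    HasDerivAt (pairPhase z j k) (-(Complex.I * z * (sgn j + sgn k)) * pairPhase z j k x) x := by
  have h0 : HasDerivAt (fun y : ℝ => (y : ℂ)) 1 x := Complex.ofRealCLM.hasDerivAt
  refine ((h0.const_mul (-Complex.I * z * (sgn j + sgn k))).cexp).congr_deriv ?_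
  rw [pairPhase]
  ring

lemma pairPhase_mul_pairing_eq (hQ : ∀ x t, t ∈ T → (Q x t).IsSymm) {t : ℝ} (ht : t ∈ T)
    {j k : Idx} {z : ℂ} {f g : ℝ → Idx → ℂ}
    (hf : ∀ x, HasDerivAt f (specMat (fun y => potential Q y t) z j x *ᵥ f x) x)
    (hg : ∀ x, HasDerivAt g (specMat (fun y => potential Q y t) z k x *ᵥ g x) x) (x y : ℝ) :
    pairPhase z j k x * pairing (f x) (g x) = pairPhase z j k y * pairing (f y) (g y) := by
  have h : ∀ x, HasDerivAt (fun x => pairPhase z j k x * pairing (f x) (g x)) 0 x := by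
    intro x
    have h1 := hasDerivAt_pairing hQ ht (hf x) (hg x)
    have h2 := (hasDerivAt_pairPhase z j k x).fun_mul h1
    exact h2.congr_deriv (by ring)
  exact is_const_of_deriv_eq_zero (fun x => (h x).differentiableAt) (fun x => (h x).deriv) x y

/-- Unit columns pair nontrivially only across the two blocks, where `σ_j + σ_k = 0` and the phase
is one. -/
lemma pairPhase_mul_pairing_unitCol (z : ℂ) (j k : Idx) (x : ℝ) :
    pairPhase z j k x * pairing (unitCol j) (unitCol k) = pairing (unitCol j) (unitCol k) := by
  rcases j with j | j <;> rcases k with k | k <;>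
    simp [pairPhase, sgn, pairing, unitCol]

lemma continuous_pairing : Continuous fun p : (Idx → ℂ) × (Idx → ℂ) => pairing p.1 p.2 := by
  unfold pairing
  fun_prop

lemma tendsto_pairing {l : Filter ℝ} {f g : ℝ → Idx → ℂ} {v w : Idx → ℂ} (hf : Tendsto f l (𝓝 v))
    (hg : Tendsto g l (𝓝 w)) : Tendsto (fun x => pairing (f x) (g x)) l (𝓝 (pairing v w)) := by
  rw [tendsto_pi_nhds] at hf hg
  exact tendsto_finsetSum _ fun i _ => ((hf _).mul (hg _)).sub ((hf _).mul (hg _))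

lemma tendsto_mcol_atBot (hQ : IsSolution Q T) (hd : IsDecaying Q T) {t : ℝ} (ht : t ∈ T)
    {j : Idx} {z : ℂ} (hj : z ∈ leftHalf j) :
    Tendsto (mcol Q t j z) atBot (𝓝 (unitCol j)) :=
  tendsto_minusCol_atBot (isPotential_potential hQ hd ht) hj

lemma tendsto_pcol_atTop (hQ : IsSolution Q T) (hd : IsDecaying Q T) {t : ℝ} (ht : t ∈ T)
    {j : Idx} {z : ℂ} (hj : -z ∈ leftHalf j) :
    Tendsto (pcol Q t j z) atTop (𝓝 (unitCol j)) :=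
  (tendsto_mcol_atBot hQ.refl hd.refl ht hj).comp tendsto_neg_atTop_atBot

/-- The phased pairing is constant in `x` and is evaluated at `-∞`. There the phase is at most one
in norm, because `σ_j Im z` and `σ_k Im z` are both nonnegative, so the error of the pairing tends
to zero even after multiplication by it. -/
lemma pairing_mcol (hQ : IsSolution Q T) (hd : IsDecaying Q T) {t : ℝ} (ht : t ∈ T) {j k : Idx}
    {z : ℂ} (hj : z ∈ leftHalf j) (hk : z ∈ leftHalf k) (x : ℝ) :
    pairPhase z j k x * pairing (mcol Q t j z x) (mcol Q t k z x) =
      pairing (unitCol j) (unitCol k) := by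
  have hconst := pairPhase_mul_pairing_eq hQ.symm ht (hasDerivAt_mcol hQ hd ht hj)
    (hasDerivAt_mcol hQ hd ht hk) x
  have hlim : Tendsto (fun y => pairing (mcol Q t j z y) (mcol Q t k z y)) atBot
      (𝓝 (pairing (unitCol j) (unitCol k))) :=
    tendsto_pairing (tendsto_mcol_atBot hQ hd ht hj) (tendsto_mcol_atBot hQ hd ht hk)
  have hz : Tendsto (fun y => pairPhase z j k y * (pairing (mcol Q t j z y) (mcol Q t k z y) -
      pairing (unitCol j) (unitCol k))) atBot (𝓝 0) := by
    have h0 : Tendsto (fun y => ‖pairing (mcol Q t j z y) (mcol Q t k z y) -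
        pairing (unitCol j) (unitCol k)‖) atBot (𝓝 0) :=
      tendsto_iff_norm_sub_tendsto_zero.1 hlim
    refine squeeze_zero_norm' ?_ h0
    filter_upwards [eventually_le_atBot (0 : ℝ)] with y hy
    rw [norm_mul]
    refine mul_le_of_le_one_left (norm_nonneg _) ?_
    rw [pairPhase, Complex.norm_exp, Real.exp_le_one_iff]
    have hj' : 0 ≤ (sgn j).re * z.im := hj
    have hk' : 0 ≤ (sgn k).re * z.im := hk
    rcases j with j | j <;> rcases k with k | k <;> simp [sgn] at hj' hk' ⊢ <;> nlinarith
  have h2 : Tendsto (fun y => pairPhase z j k x * pairing (mcol Q t j z x) (mcol Q t k z x) -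
      pairing (unitCol j) (unitCol k)) (atBot : Filter ℝ) (𝓝 0) := by
    refine hz.congr fun y => ?_
    rw [hconst y, mul_sub, pairPhase_mul_pairing_unitCol]
  exact sub_eq_zero.1 (tendsto_nhds_unique tendsto_const_nhds h2)

lemma pairing_pcol (hQ : IsSolution Q T) (hd : IsDecaying Q T) {t : ℝ} (ht : t ∈ T) {j k : Idx}
    {z : ℂ} (hj : -z ∈ leftHalf j) (hk : -z ∈ leftHalf k) (x : ℝ) :
    pairPhase z j k x * pairing (pcol Q t j z x) (pcol Q t k z x) =
      pairing (unitCol j) (unitCol k) := by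
  rw [← pairing_mcol hQ.refl hd.refl ht hj hk (-x)]
  simp [pairPhase, pcol]

/-! ### The transmission block `a` -/

/-- The matrix `-ψ₊R(0, 0)ᵀ J ψ₋L(0, 0)`. -/
def aMat (Q : ℝ → ℝ → Matrix (Fin 2) (Fin 2) ℂ) (z : ℂ) : Matrix (Fin 2) (Fin 2) ℂ :=
  Matrix.of fun k j => -pairing (pcol Q 0 (Sum.inr k) z 0) (mcol Q 0 (Sum.inl j) z 0)

/-- The indices lie in opposite blocks, so the phase is identically one and the bare pairing is
constant in `x`. -/
lemma aMat_apply (hQ : IsSolution Q T) (hd : IsDecaying Q T) (h0 : (0 : ℝ) ∈ T) {z : ℂ}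
    (hz : 0 ≤ z.im) (x : ℝ) (k j : Fin 2) :
    aMat Q z k j = -pairing (pcol Q 0 (Sum.inr k) z x) (mcol Q 0 (Sum.inl j) z x) := by
  have h := pairPhase_mul_pairing_eq hQ.symm h0 (z := z)
    (hasDerivAt_pcol hQ hd h0 (j := Sum.inr k) (by simpa using hz))
    (hasDerivAt_mcol hQ hd h0 (j := Sum.inl j) (by simpa using hz)) 0 x
  have h1 : ∀ x, pairPhase z (Sum.inr k) (Sum.inl j) x = 1 := by
    intro x; simp [pairPhase, sgn]
  rw [h1, h1, one_mul, one_mul] at h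
  rw [aMat, Matrix.of_apply, h]

lemma continuous_mcol (hQ : IsSolution Q T) (hd : IsDecaying Q T) {t : ℝ} (ht : t ∈ T) (j : Idx)
    (x : ℝ) : Continuous fun z => mcol Q t j z x :=
  (continuous_minusCol (isPotential_potential hQ hd ht) j).comp
    (f := fun z : ℂ => (z, x)) (by fun_prop)

lemma continuous_pcol (hQ : IsSolution Q T) (hd : IsDecaying Q T) {t : ℝ} (ht : t ∈ T) (j : Idx)
    (x : ℝ) : Continuous fun z => pcol Q t j z x :=
  (continuous_mcol hQ.refl hd.refl ht j (-x)).comp continuous_neg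

lemma differentiableOn_mcol (hQ : IsSolution Q T) (hd : IsDecaying Q T) {t : ℝ} (ht : t ∈ T)
    (j : Idx) (x : ℝ) (i : Idx) :
    DifferentiableOn ℂ (fun z => mcol Q t j z x i) (leftHalfOpen j) :=
  differentiableOn_pi.1 (differentiableOn_minusCol (isPotential_potential hQ hd ht) j x) i

lemma differentiableOn_pcol (hQ : IsSolution Q T) (hd : IsDecaying Q T) {t : ℝ} (ht : t ∈ T)
    (j : Idx) (x : ℝ) (i : Idx) :
    DifferentiableOn ℂ (fun z => pcol Q t j z x i) {z | -z ∈ leftHalfOpen j} :=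
  (differentiableOn_mcol hQ.refl hd.refl ht j (-x) i).comp (f := fun z : ℂ => -z)
    (differentiable_neg.differentiableOn) fun _ hz => hz

lemma continuous_aMat (hQ : IsSolution Q T) (hd : IsDecaying Q T) (h0 : (0 : ℝ) ∈ T)
    (k j : Fin 2) : Continuous fun z => aMat Q z k j := by
  simp only [aMat, Matrix.of_apply]
  exact (continuous_pairing.comp ((continuous_pcol hQ hd h0 (Sum.inr k) 0).prodMk
    (continuous_mcol hQ hd h0 (Sum.inl j) 0))).neg

lemma differentiableOn_aMat (hQ : IsSolution Q T) (hd : IsDecaying Q T) (h0 : (0 : ℝ) ∈ T)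
    (k j : Fin 2) : DifferentiableOn ℂ (fun z => aMat Q z k j) {z | 0 < z.im} := by
  have hp : ∀ i, DifferentiableOn ℂ (fun z => pcol Q 0 (Sum.inr k) z 0 i) {z | 0 < z.im} := by
    intro i
    simpa using differentiableOn_pcol hQ hd h0 (Sum.inr k) 0 i
  have hm : ∀ i, DifferentiableOn ℂ (fun z => mcol Q 0 (Sum.inl j) z 0 i) {z | 0 < z.im} := by
    intro i
    simpa using differentiableOn_mcol hQ hd h0 (Sum.inl j) 0 i
  simp only [aMat, Matrix.of_apply, pairing]
  exact (DifferentiableOn.fun_sum fun i _ =>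
    ((hp _).mul (hm _)).sub ((hp _).mul (hm _))).neg

lemma phase_zero (z : ℂ) : phase 0 0 z = 1 := by
  simp [phase, theta]

/-- At real `λ` all columns exist and `P = ψ₊(0, 0)` is symplectic, whence `P⁻¹ = -J Pᵀ J`. The
upper left block of `-J Pᵀ J N` involves only the columns `R` of `P` and `L` of `N`, which is why it
extends to the upper half-plane. -/
lemma scattering_toBlocks₁₁ (hQ : IsSolution Q T) (hd : IsDecaying Q T) (h0 : (0 : ℝ) ∈ T)
    (s : ℝ) : (scattering Q s).toBlocks₁₁ = aMat Q s := by
  have hreal : ∀ j : Idx, (s : ℂ) ∈ leftHalf j := by intro j; simp [leftHalf]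
  have hreal' : ∀ j : Idx, -(s : ℂ) ∈ leftHalf j := by intro j; simp [leftHalf]
  set P : Matrix Idx Idx ℂ := Matrix.of fun i j => pcol Q 0 j s 0 i with hP
  set N : Matrix Idx Idx ℂ := Matrix.of fun i j => mcol Q 0 j s 0 i with hN
  have hplus : psiPlus Q 0 0 s = P := by
    rw [psiPlus, phase_zero, mul_one]
    ext i j
    exact muPlus_apply hQ hd h0 (hreal' j) 0 i
  have hminus : psiMinus Q 0 0 s = N := by
    rw [psiMinus, phase_zero, mul_one]
    ext i j
    exact muMinus_apply hQ hd h0 (hreal j) 0 i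
  set J : Matrix Idx Idx ℂ := Matrix.fromBlocks 0 1 (-1) 0 with hJ
  have hpair : ∀ (A B : Matrix Idx Idx ℂ) (j k : Idx),
      (Aᵀ * J * B) j k = pairing (fun i => A i j) (fun i => B i k) := by
    intro A B j k
    simp only [hJ, pairing, Matrix.mul_apply, Fintype.sum_sum_type, Fin.sum_univ_two,
      Matrix.fromBlocks_apply₁₁, Matrix.fromBlocks_apply₁₂, Matrix.fromBlocks_apply₂₁,
      Matrix.fromBlocks_apply₂₂, Matrix.transpose_apply, Matrix.neg_apply, Matrix.zero_apply,
      Matrix.one_apply]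
    simp
    ring
  have hPP : Pᵀ * J * P = J := by
    ext j k
    rw [hpair]
    have h := pairing_pcol hQ hd h0 (hreal' j) (hreal' k) 0
    have h1 : pairPhase (s : ℂ) j k 0 = 1 := by simp [pairPhase]
    rw [h1, one_mul] at h
    refine Eq.trans h ?_
    rcases j with j | j <;> rcases k with k | k <;>
      simp [pairing, unitCol, hJ, Matrix.one_apply] <;>
      fin_cases j <;> fin_cases k <;> simp
  have hJJ : J * J = -1 := by
    rw [hJ, Matrix.fromBlocks_multiply]
    simp [← Matrix.fromBlocks_one, Matrix.fromBlocks_neg]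
  have hinv : P⁻¹ = -(J * (Pᵀ * J)) := by
    apply Matrix.inv_eq_left_inv
    rw [neg_mul, mul_assoc, hPP, hJJ, neg_neg]
  ext k j
  rw [scattering, hplus, hminus, hinv, neg_mul, mul_assoc]
  simp only [Matrix.toBlocks₁₁, Matrix.of_apply, Matrix.neg_apply, aMat]
  rw [Matrix.mul_apply, Fintype.sum_sum_type]
  simp only [hJ, Matrix.fromBlocks_apply₁₁, Matrix.fromBlocks_apply₁₂, Matrix.zero_apply,
    zero_mul, Finset.sum_const_zero, zero_add, Matrix.one_apply, ite_mul, one_mul,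
    Finset.sum_ite_eq, Finset.mem_univ, if_true]
  rw [← hJ, hpair]
  rfl

end

section

/-! ### Uniqueness of the continuation to the upper half-plane -/

/-- A holomorphic function on the upper half-plane, continuous up to the real line and vanishing
there, vanishes identically. -/
lemma eq_zero_of_real_boundary {g : ℂ → ℂ} (hc : ContinuousOn g {z : ℂ | 0 ≤ z.im})
    (hd : DifferentiableOn ℂ g {z : ℂ | 0 < z.im}) (h0 : ∀ s : ℝ, g s = 0) {z : ℂ}
    (hz : 0 ≤ z.im) : g z = 0 := by
  -- An open triangle with base `(-1, 1)` on the real line and apex `i`.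
  set V : Set ℂ := {z | 0 < z.im ∧ |z.re| < 1 - z.im} with hV
  set K : Set ℂ := {z | 0 ≤ z.im ∧ |z.re| ≤ 1 - z.im} with hK
  have hVo : IsOpen V := (isOpen_lt continuous_const Complex.continuous_im).inter
    (isOpen_lt Complex.continuous_re.abs (continuous_const.sub Complex.continuous_im))
  have hKc : IsClosed K := (isClosed_le continuous_const Complex.continuous_im).inter
    (isClosed_le Complex.continuous_re.abs (continuous_const.sub Complex.continuous_im))
  have hVK : V ⊆ K := fun z hz => ⟨hz.1.le, hz.2.le⟩
  have hcl : closure V ⊆ K := closure_minimal hVK hKc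
  have hKb : Bornology.IsBounded K := by
    refine (Metric.isBounded_closedBall (x := (0 : ℂ)) (r := 2)).subset fun z hz => ?_
    rw [mem_closedBall_zero_iff]
    refine (Complex.norm_le_abs_re_add_abs_im z).trans ?_
    have h1 := hz.1
    have h2 := hz.2
    have h3 := abs_nonneg z.re
    rw [abs_of_nonneg h1]
    linarith
  have hKcomp : IsCompact K := Metric.isCompact_of_isClosed_isBounded hKc hKb
  have hKup : K ⊆ {z : ℂ | 0 ≤ z.im} := fun z hz => hz.1
  obtain ⟨M, hM⟩ := hKcomp.exists_bound_of_continuousOn (hc.mono hKup)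
  -- The weight `exp (n (1 + iz)²)` has modulus one on the slanted sides and grows with `n` inside
  -- the triangle, while `g` vanishes on the base. The maximum principle bounds the weighted
  -- function by `M` for every `n`, which forces `g = 0` inside.
  have hre : ∀ z : ℂ, ((1 + Complex.I * z) ^ 2).re = (1 - z.im) ^ 2 - z.re ^ 2 := by
    intro z
    simp [pow_two]
    ring
  have hkey : ∀ z ∈ V, g z = 0 := by
    intro z hz
    have hn : ∀ n : ℕ, ‖g z‖ * Real.exp (n * ((1 - z.im) ^ 2 - z.re ^ 2)) ≤ M := by
      intro n
      have hdc : DiffContOnCl ℂ (fun z => g z * Complex.exp (n * (1 + Complex.I * z) ^ 2)) V := by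
        refine ⟨(hd.mono fun z hz => hz.1).mul (by fun_prop), ?_⟩
        exact (hc.mono (hcl.trans hKup)).mul (by fun_prop)
      have h := Complex.norm_le_of_forall_mem_frontier_norm_le (hKb.subset hVK) hdc (C := M)
        (fun w hw => ?_) (subset_closure hz)
      · rw [norm_mul, Complex.norm_exp] at h
        rw [← hre z]
        convert h using 3
        rw [← Complex.ofReal_natCast, Complex.re_ofReal_mul]
      · have hwK : w ∈ K := hcl hw.1
        have hwV : w ∉ V := by
          have := hw.2
          rwa [hVo.interior_eq] at this
        rcases eq_or_lt_of_le hwK.1 with h | h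
        · have hw0 : w = (w.re : ℂ) := Complex.ext (by simp) (by simp [← h])
          rw [hw0, h0]
          simpa using (norm_nonneg _).trans (hM w hwK)
        · have hweq : |w.re| = 1 - w.im := by
            by_contra hne
            exact hwV ⟨h, lt_of_le_of_ne hwK.2 hne⟩
          have hsq : (1 - w.im) ^ 2 - w.re ^ 2 = 0 := by
            rw [← hweq, sq_abs, sub_self]
          rw [norm_mul, Complex.norm_exp, ← Complex.ofReal_natCast, Complex.re_ofReal_mul, hre,
            hsq, mul_zero, Real.exp_zero, mul_one]
          exact hM w hwK
    have hpos : 0 < (1 - z.im) ^ 2 - z.re ^ 2 := by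
      have h1 := hz.2
      have h2 : z.re ^ 2 < (1 - z.im) ^ 2 := by
        rw [← sq_abs z.re]
        exact pow_lt_pow_left₀ h1 (abs_nonneg _) two_ne_zero
      linarith
    by_contra hne
    have hgpos : 0 < ‖g z‖ := norm_pos_iff.2 hne
    have hlim : Tendsto (fun n : ℕ => ‖g z‖ * Real.exp (n * ((1 - z.im) ^ 2 - z.re ^ 2)))
        atTop atTop :=
      (Real.tendsto_exp_atTop.comp
        (tendsto_natCast_atTop_atTop.atTop_mul_const hpos)).const_mul_atTop hgpos
    obtain ⟨n, hn'⟩ := (hlim.eventually_gt_atTop M).exists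
    exact absurd (hn n) (not_le.2 hn')
  rcases eq_or_lt_of_le hz with h | h
  · have hw0 : z = (z.re : ℂ) := Complex.ext (by simp) (by simp [← h])
    rw [hw0, h0]
  · have hopen : IsOpen {z : ℂ | 0 < z.im} := isOpen_lt continuous_const Complex.continuous_im
    have han : AnalyticOnNhd ℂ g {z : ℂ | 0 < z.im} := hd.analyticOnNhd hopen
    have hmem : (Complex.I / 2) ∈ V := by
      constructor
      · norm_num
      · norm_num
    refine han.eqOn_zero_of_preconnected_of_eventuallyEq_zero
      (convex_halfSpace_im_gt 0).isPreconnected hmem.1 ?_ h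
    filter_upwards [hVo.mem_nhds hmem] with w hw using hkey w hw

lemma IsUpperContinuation.eqOn {f : ℝ → Matrix (Fin 2) (Fin 2) ℂ}
    {A B : ℂ → Matrix (Fin 2) (Fin 2) ℂ} (hA : IsUpperContinuation f A)
    (hB : IsUpperContinuation f B) {z : ℂ} (hz : 0 ≤ z.im) : A z = B z := by
  ext i j
  refine sub_eq_zero.1 (eq_zero_of_real_boundary (g := fun z => A z i j - B z i j)
    ((hA.1 i j).sub (hB.1 i j)) ((hA.2.1 i j).sub (hB.2.1 i j)) (fun s => ?_) hz)
  rw [hA.2.2, hB.2.2, sub_self]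

variable {Q : ℝ → ℝ → Matrix (Fin 2) (Fin 2) ℂ} {T : Set ℝ}

/-- `aMat` is a continuation of the required kind, and two such continuations agree on the closed
half-plane; this pins down the chosen one. -/
lemma scatA_eq_aMat (hQ : IsSolution Q T) (hd : IsDecaying Q T) (h0 : (0 : ℝ) ∈ T) {z : ℂ}
    (hz : 0 ≤ z.im) : scatA Q z = aMat Q z := by
  have h : IsUpperContinuation (fun s => (scattering Q s).toBlocks₁₁) (aMat Q) :=
    ⟨fun i j => (continuous_aMat hQ hd h0 i j).continuousOn, differentiableOn_aMat hQ hd h0,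
      fun s => (scattering_toBlocks₁₁ hQ hd h0 s).symm⟩
  exact (Classical.epsilon_spec
    (p := IsUpperContinuation fun s => (scattering Q s).toBlocks₁₁) ⟨_, h⟩).eqOn h hz

end

section

/-! ### Zero curvature -/

section ZeroCurvature

variable {E : Type*} [NormedAddCommGroup E] [NormedSpace ℂ E]

lemma hasDerivAt_clm_apply_real {c : ℝ → E →L[ℂ] E} {c' : E →L[ℂ] E} {u : ℝ → E} {u' : E} {s : ℝ}
    (hc : HasDerivAt c c' s) (hu : HasDerivAt u u' s) :
    HasDerivAt (fun s => c s (u s)) (c' (u s) + c s u') s :=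
  ((ContinuousLinearMap.restrictScalarsL ℂ E E ℝ ℝ).hasFDerivAt.comp_hasDerivAt s hc).clm_apply hu

lemma hasDerivAt_intervalIntegral_param [CompleteSpace E] {F F' : ℝ → ℝ → E}
    (hF : Continuous fun p : ℝ × ℝ => F p.1 p.2) (hF' : Continuous fun p : ℝ × ℝ => F' p.1 p.2)
    (hd : ∀ y s, HasDerivAt (fun s => F y s) (F' y s) s) (a b s : ℝ) :
    HasDerivAt (fun s => ∫ y in a..b, F y s) (∫ y in a..b, F' y s) s := by
  have hK : IsCompact (Set.uIcc a b ×ˢ Set.Icc (s - 1) (s + 1)) := isCompact_uIcc.prod isCompact_Icc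
  obtain ⟨C, hC⟩ := hK.exists_bound_of_continuousOn hF'.continuousOn
  have hFs : ∀ s, Continuous fun y => F y s := fun s =>
    hF.comp (f := fun y : ℝ => (y, s)) (by fun_prop)
  have hFs' : ∀ s, Continuous fun y => F' y s := fun s =>
    hF'.comp (f := fun y : ℝ => (y, s)) (by fun_prop)
  refine (intervalIntegral.hasDerivAt_integral_of_dominated_loc_of_deriv_le
    (F := fun s y => F y s) (F' := fun s y => F' y s) (bound := fun _ => C)
    (Metric.ball_mem_nhds s one_pos) ?_ ?_ ?_ ?_ ?_ ?_).2
  · exact Eventually.of_forall fun r => (hFs r).aestronglyMeasurable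
  · exact (hFs s).intervalIntegrable _ _
  · exact (hFs' s).aestronglyMeasurable
  · refine ae_of_all _ fun y hy r hr => ?_
    refine hC (y, r) ⟨Set.uIoc_subset_uIcc hy, ?_⟩
    rw [Metric.mem_ball, Real.dist_eq, abs_lt] at hr
    constructor <;> simp only <;> linarith [hr.1, hr.2]
  · exact intervalIntegrable_const
  · exact ae_of_all _ fun y _ r _ => hd y r

/-- If `E_s = Y E - ∫_a^x Z E` and `E(·, 0) = 0`, then `E` vanishes for `0 ≤ s`. -/
lemma eq_zero_of_volterra_evolution [CompleteSpace E] {Y Z : ℝ → ℝ → E →L[ℂ] E} {e : ℝ → ℝ → E}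
    (hY : Continuous fun p : ℝ × ℝ => Y p.1 p.2) (hZ : Continuous fun p : ℝ × ℝ => Z p.1 p.2)
    (he : Continuous fun p : ℝ × ℝ => e p.1 p.2) (a : ℝ)
    (hd : ∀ x s, HasDerivAt (fun s => e x s)
      (Y x s (e x s) - ∫ y in a..x, Z y s (e y s)) s)
    (h0 : ∀ x, e x 0 = 0) {x s : ℝ} (hs : 0 ≤ s) : e x s = 0 := by
  have hK : IsCompact (Set.uIcc a x ×ˢ Set.Icc 0 s) := isCompact_uIcc.prod isCompact_Icc
  obtain ⟨C₁, hC₁⟩ := hK.exists_bound_of_continuousOn hY.continuousOn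
  obtain ⟨C₂, hC₂⟩ := hK.exists_bound_of_continuousOn hZ.continuousOn
  obtain ⟨M, hM⟩ := hK.exists_bound_of_continuousOn he.continuousOn
  have hmem0 : (a, (0 : ℝ)) ∈ Set.uIcc a x ×ˢ Set.Icc 0 s := ⟨Set.left_mem_uIcc, le_rfl, hs⟩
  have hC₁0 : 0 ≤ C₁ := (norm_nonneg _).trans (hC₁ _ hmem0)
  have hC₂0 : 0 ≤ C₂ := (norm_nonneg _).trans (hC₂ _ hmem0)
  have hM0 : 0 ≤ M := (norm_nonneg _).trans (hM _ hmem0)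
  -- `L` bounds the right-hand side of the evolution in supremum norm over the segment from `a` to
  -- `x`. Integrating in `s` repeatedly from zero data then yields `M (L r)^n / n!`.
  set L := C₁ + C₂ * |x - a| with hL
  have hL0 : 0 ≤ L := by positivity
  have hn : ∀ n : ℕ, ∀ w ∈ Set.uIcc a x, ∀ r ∈ Set.Icc 0 s,
      ‖e w r‖ ≤ M * (L * r) ^ n / n.factorial := by
    intro n
    induction n with
    | zero => intro w hw r hr; simpa using hM (w, r) ⟨hw, hr⟩
    | succ n ih =>
      intro w hw r hr
      have hB : ∀ r : ℝ, HasDerivAt (fun r => M * (L * r) ^ (n + 1) / (n + 1).factorial)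
          (L * (M * (L * r) ^ n / n.factorial)) r := by
        intro r
        have h := ((((hasDerivAt_id r).const_mul L).pow (n + 1)).const_mul M).div_const
          ((n + 1).factorial : ℝ)
        refine h.congr_deriv ?_
        have h1 : ((n.factorial : ℕ) : ℝ) ≠ 0 := by exact_mod_cast n.factorial_ne_zero
        have h2 : ((n : ℝ) + 1) ≠ 0 := by positivity
        rw [Nat.factorial_succ]
        push_cast
        simp only [id]
        field_simp
      refine image_norm_le_of_norm_deriv_right_le_deriv_boundary (a := 0) (b := s)
        (f := fun r => e w r)
        (fun r _ => (hd w r).continuousAt.continuousWithinAt)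
        (fun r _ => (hd w r).hasDerivWithinAt) (by simp [h0]) hB (fun r hr' => ?_) hr
      have hr : r ∈ Set.Icc 0 s := Set.Ico_subset_Icc_self hr'
      set β := M * (L * r) ^ n / n.factorial with hβ
      have hsub : Set.uIcc a w ⊆ Set.uIcc a x := Set.uIcc_subset_uIcc Set.left_mem_uIcc hw
      have h1 : ‖Y w r (e w r)‖ ≤ C₁ * β :=
        ((Y w r).le_opNorm _).trans
          (mul_le_mul (hC₁ (w, r) ⟨hw, hr⟩) (ih w hw r hr) (norm_nonneg _) hC₁0)
      have hβ0 : 0 ≤ β := (norm_nonneg _).trans (ih w hw r hr)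
      have h2 : ‖∫ y in a..w, Z y r (e y r)‖ ≤ C₂ * β * |w - a| := by
        refine intervalIntegral.norm_integral_le_of_norm_le_const fun y hy => ?_
        have hy' := hsub (Set.uIoc_subset_uIcc hy)
        exact ((Z y r).le_opNorm _).trans
          (mul_le_mul (hC₂ (y, r) ⟨hy', hr⟩) (ih y hy' r hr) (norm_nonneg _) hC₂0)
      have h3 : |w - a| ≤ |x - a| := Set.abs_sub_left_of_mem_uIcc hw
      have h4 : C₂ * β * |w - a| ≤ C₂ * β * |x - a| :=
        mul_le_mul_of_nonneg_left h3 (mul_nonneg hC₂0 hβ0)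
      refine (norm_sub_le _ _).trans ?_
      rw [hL]
      linarith
  have hlim : Tendsto (fun n : ℕ => M * (L * s) ^ n / n.factorial) atTop (𝓝 0) := by
    have := (FloorSemiring.tendsto_pow_div_factorial_atTop (L * s)).const_mul M
    simpa [mul_div_assoc] using this
  exact norm_le_zero_iff.1 (ge_of_tendsto' hlim fun n =>
    hn n x Set.right_mem_uIcc s ⟨hs, le_rfl⟩)

/-- Zero curvature `X_s + X Y = Y_x + Y X` propagates the equation `φ_x = X φ` along `φ_s = Y φ`. -/
lemma hasDerivAt_of_zero_curvature [CompleteSpace E] {X Y Xs Yx : ℝ → ℝ → E →L[ℂ] E}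
    {φ : ℝ → ℝ → E}
    (hX : Continuous fun p : ℝ × ℝ => X p.1 p.2) (hY : Continuous fun p : ℝ × ℝ => Y p.1 p.2)
    (hXs : Continuous fun p : ℝ × ℝ => Xs p.1 p.2) (hYx : Continuous fun p : ℝ × ℝ => Yx p.1 p.2)
    (hXd : ∀ x s, HasDerivAt (fun s => X x s) (Xs x s) s)
    (hYd : ∀ x s, HasDerivAt (fun x => Y x s) (Yx x s) x)
    (hzc : ∀ x s v, Xs x s v + X x s (Y x s v) = Yx x s v + Y x s (X x s v))
    (hφ : Continuous fun p : ℝ × ℝ => φ p.1 p.2)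
    (hφs : ∀ x s, HasDerivAt (fun s => φ x s) (Y x s (φ x s)) s)
    (hφ0 : ∀ x, HasDerivAt (fun x => φ x 0) (X x 0 (φ x 0)) x) (x : ℝ) {s : ℝ} (hs : 0 ≤ s) :
    HasDerivAt (fun x => φ x s) (X x s (φ x s)) x := by
  -- Differentiability of `φ` in `x` for `s > 0` is what has to be shown, so mixed derivatives of
  -- `φ` are not available. The primitive `ρ` is differentiable in `x` by construction, and it
  -- suffices to prove `ρ = φ`.
  set ρ : ℝ → ℝ → E := fun x s => φ 0 s + ∫ y in (0 : ℝ)..x, X y s (φ y s) with hρ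
  have hXφ : Continuous fun p : ℝ × ℝ => X p.1 p.2 (φ p.1 p.2) := hX.clm_apply hφ
  have hslice : ∀ {F : ℝ → ℝ → E}, (Continuous fun p : ℝ × ℝ => F p.1 p.2) → ∀ s,
      Continuous fun y => F y s := fun hF s => hF.comp (f := fun y : ℝ => (y, s)) (by fun_prop)
  have hρx : ∀ x s, HasDerivAt (fun x => ρ x s) (X x s (φ x s)) x := by
    intro x s
    have h := hslice (F := fun y s => X y s (φ y s)) hXφ s
    exact (intervalIntegral.integral_hasDerivAt_right (h.intervalIntegrable _ _)
      (h.stronglyMeasurableAtFilter _ _) h.continuousAt).const_add _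
  have hρc : Continuous fun p : ℝ × ℝ => ρ p.1 p.2 := by
    refine Continuous.add (hφ.comp (f := fun p : ℝ × ℝ => (0, p.2)) (by fun_prop)) ?_
    exact intervalIntegral.continuous_parametric_intervalIntegral_of_continuous
      (f := fun (p : ℝ × ℝ) y => X y p.2 (φ y p.2))
      (hXφ.comp (f := fun q : (ℝ × ℝ) × ℝ => (q.2, q.1.2)) (by fun_prop)) continuous_fst
  have hρs : ∀ x s, HasDerivAt (fun s => ρ x s)
      (Y x s (ρ x s) + ∫ y in (0 : ℝ)..x, Yx y s (φ y s - ρ y s)) s := by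
    intro x s
    have h1 := hasDerivAt_intervalIntegral_param (F := fun y s => X y s (φ y s))
      (F' := fun y s => Xs y s (φ y s) + X y s (Y y s (φ y s))) hXφ
      ((hXs.clm_apply hφ).add (hX.clm_apply (hY.clm_apply hφ)))
      (fun y s => hasDerivAt_clm_apply_real (hXd y s) (hφs y s)) 0 x s
    refine ((hφs 0 s).add h1).congr_deriv ?_
    have hint1 : Continuous fun y => Yx y s (ρ y s) + Y y s (X y s (φ y s)) :=
      hslice (F := fun y s => Yx y s (ρ y s) + Y y s (X y s (φ y s)))
        ((hYx.clm_apply hρc).add (hY.clm_apply hXφ)) s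
    have hint2 : Continuous fun y => Yx y s (φ y s - ρ y s) :=
      hslice (F := fun y s => Yx y s (φ y s - ρ y s)) (hYx.clm_apply (hφ.sub hρc)) s
    -- After zero curvature, replacing `φ` by `ρ` in the term `Yx φ` leaves the exact `x`-derivative
    -- of `Y ρ`; the replacement costs the remainder `∫ Yx (φ - ρ)`.
    have h2 : ∫ y in (0 : ℝ)..x, (Yx y s (ρ y s) + Y y s (X y s (φ y s))) =
        Y x s (ρ x s) - Y 0 s (ρ 0 s) :=
      intervalIntegral.integral_eq_sub_of_hasDerivAt
        (f := fun y => Y y s (ρ y s))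
        (fun y _ => hasDerivAt_clm_apply_real (hYd y s) (hρx y s)) (hint1.intervalIntegrable _ _)
    have h3 : ρ 0 s = φ 0 s := by simp [hρ]
    have h4 : ∫ y in (0 : ℝ)..x, (Xs y s (φ y s) + X y s (Y y s (φ y s))) =
        (∫ y in (0 : ℝ)..x, (Yx y s (ρ y s) + Y y s (X y s (φ y s)))) +
          ∫ y in (0 : ℝ)..x, Yx y s (φ y s - ρ y s) := by
      rw [← intervalIntegral.integral_add (hint1.intervalIntegrable _ _)
        (hint2.intervalIntegrable _ _)]
      refine intervalIntegral.integral_congr fun y _ => ?_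
      rw [hzc, map_sub]
      abel
    rw [h4, h2, h3]
    abel
  -- The difference satisfies a homogeneous Volterra evolution in `s` with zero initial value.
  have hz : ∀ x, φ x s - ρ x s = 0 := by
    intro x
    refine eq_zero_of_volterra_evolution (e := fun x s => φ x s - ρ x s) hY hYx
      (hφ.sub hρc) 0 (fun x s => ?_) (fun x => ?_) hs
    · refine ((hφs x s).sub (hρs x s)).congr_deriv ?_
      rw [map_sub]
      abel
    · have h := intervalIntegral.integral_eq_sub_of_hasDerivAt (a := 0) (b := x)
        (fun y _ => hφ0 y) ((hslice (F := fun y s => X y s (φ y s)) hXφ 0).intervalIntegrable _ _)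
      simp only [hρ, h]
      abel
  have heq : (fun x => φ x s) = fun x => ρ x s := funext fun x => sub_eq_zero.1 (hz x)
  rw [heq]
  exact hρx x s

end ZeroCurvature

end

section

/-! ### Time evolution -/

/-- The coefficient matrix of the time evolution of the `j`-th column, as a function of the values
`A` of `Q` and `B` of `Q_x`. -/
def timeGen (z : ℂ) (j : Idx) (A B : Matrix (Fin 2) (Fin 2) ℂ) : Matrix Idx Idx ℂ :=
  Matrix.diagonal (fun i => -2 * Complex.I * z ^ 2 * (sgn i - sgn j)) +
    Matrix.fromBlocks (Complex.I • (A * Aᴴ)) ((2 * z) • A + Complex.I • B)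
      ((-2 * z) • Aᴴ + Complex.I • Bᴴ) (-Complex.I • (Aᴴ * A))

/-- The space derivative of `timeGen`. -/
def timeGenDx (z : ℂ) (A B C : Matrix (Fin 2) (Fin 2) ℂ) : Matrix Idx Idx ℂ :=
  Matrix.fromBlocks (Complex.I • (B * Aᴴ + A * Bᴴ)) ((2 * z) • B + Complex.I • C)
    ((-2 * z) • Bᴴ + Complex.I • Cᴴ) (-Complex.I • (Bᴴ * A + Aᴴ * B))

/-- With `A, B, C` in the roles of `Q, Q_x, Q_xx`, the first block matrix is `U_t` as prescribed by
the equation, and this is the compatibility condition of the Lax pair. The shifts by `σ_j` are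
scalar and commute with everything. -/
lemma zero_curvature (z : ℂ) (j : Idx) (A B C : Matrix (Fin 2) (Fin 2) ℂ) :
    Matrix.fromBlocks 0 (Complex.I • (C + (2 : ℂ) • (A * Aᴴ * A)))
        (-(Complex.I • (C + (2 : ℂ) • (A * Aᴴ * A)))ᴴ) 0 +
      (Matrix.diagonal (fun i => -Complex.I * z * (sgn i - sgn j)) +
        Matrix.fromBlocks 0 A (-Aᴴ) 0) * timeGen z j A B =
    timeGenDx z A B C + timeGen z j A B *
      (Matrix.diagonal (fun i => -Complex.I * z * (sgn i - sgn j)) +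
        Matrix.fromBlocks 0 A (-Aᴴ) 0) := by
  rw [add_mul, mul_add]
  ext i l
  rcases i with i | i <;> rcases l with l | l <;>
  simp only [Matrix.add_apply, Matrix.mul_apply (M := Matrix.fromBlocks _ _ _ _),
    Matrix.mul_apply (N := Matrix.fromBlocks _ _ _ _), Fintype.sum_sum_type, timeGen, timeGenDx,
    Matrix.fromBlocks_apply₁₁, Matrix.fromBlocks_apply₁₂, Matrix.fromBlocks_apply₂₁,
    Matrix.fromBlocks_apply₂₂, Matrix.zero_apply, zero_mul, mul_zero, Finset.sum_const_zero,
    zero_add, add_zero, Fin.sum_univ_two, Matrix.smul_apply, Matrix.neg_apply,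
    Matrix.conjTranspose_apply, Matrix.mul_apply, smul_eq_mul, star_add, star_mul',
    Complex.star_def, Complex.conj_I, Complex.conj_conj, map_ofNat] <;>
  fin_cases i <;> fin_cases l <;> simp [sgn_inl, sgn_inr] <;> ring_nf <;>
  simp only [Complex.I_sq] <;> ring_nf

end

/-! ### A smooth path of times and the generator along it. -/

section

/-- A smooth path of times from `0` to `t`. -/
def timePath (t s : ℝ) : ℝ := t * Real.smoothTransition s

/-- The velocity of `timePath`. -/
def timeSpeed (t s : ℝ) : ℝ := t * deriv Real.smoothTransition s

lemma hasDerivAt_timePath (t s : ℝ) : HasDerivAt (timePath t) (timeSpeed t s) s := by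
  have h : DifferentiableAt ℝ Real.smoothTransition s :=
    (Real.smoothTransition.contDiff (n := 1)).differentiable (by norm_num) s
  exact h.hasDerivAt.const_mul t

lemma continuous_timeSpeed (t : ℝ) : Continuous (timeSpeed t) :=
  continuous_const.mul ((Real.smoothTransition.contDiff (n := 1)).continuous_deriv le_rfl)

lemma continuous_timePath (t : ℝ) : Continuous (timePath t) :=
  continuous_const.mul Real.smoothTransition.continuous

lemma timeSpeed_of_nonpos (t : ℝ) {s : ℝ} (hs : s ≤ 0) : timeSpeed t s = 0 := by
  have h : IsLocalMin Real.smoothTransition s := Eventually.of_forall fun r => by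
    rw [Real.smoothTransition.zero_of_nonpos hs]
    exact Real.smoothTransition.nonneg r
  rw [timeSpeed, h.deriv_eq_zero, mul_zero]

lemma timeSpeed_of_one_le (t : ℝ) {s : ℝ} (hs : 1 ≤ s) : timeSpeed t s = 0 := by
  have h : IsLocalMax Real.smoothTransition s := Eventually.of_forall fun r => by
    rw [Real.smoothTransition.one_of_one_le hs]
    exact Real.smoothTransition.le_one r
  rw [timeSpeed, h.deriv_eq_zero, mul_zero]

/-- The speed vanishes outside `[0, 1]`, so an initial value problem at `s = 0` becomes a Volterra
equation on `(-∞, s]` with integrable kernel, and the solver above applies. -/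
lemma integrable_timeSpeed (t : ℝ) : Integrable (timeSpeed t) := by
  refine (continuous_timeSpeed t).integrable_of_hasCompactSupport
    (HasCompactSupport.intro (isCompact_Icc (a := (0 : ℝ)) (b := 1)) fun s hs => ?_)
  rcases le_or_gt s 0 with h | h
  · exact timeSpeed_of_nonpos t h
  · refine timeSpeed_of_one_le t (le_of_lt (not_le.1 fun h' => hs ⟨h.le, h'⟩))

@[simp] lemma timePath_zero (t : ℝ) : timePath t 0 = 0 := by simp [timePath]

@[simp] lemma timePath_one (t : ℝ) : timePath t 1 = t := by simp [timePath]

lemma timePath_mem_uIcc (t s : ℝ) : timePath t s ∈ Set.uIcc 0 t := by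
  have h0 := Real.smoothTransition.nonneg s
  have h1 := Real.smoothTransition.le_one s
  rw [timePath, Set.mem_uIcc]
  rcases le_total 0 t with h | h
  · left; constructor <;> nlinarith
  · right; constructor <;> nlinarith

variable {Q : ℝ → ℝ → Matrix (Fin 2) (Fin 2) ℂ} {T : Set ℝ}

lemma timePath_mem (hT : T.OrdConnected) (h0 : (0 : ℝ) ∈ T) {t : ℝ} (ht : t ∈ T) (s : ℝ) :
    timePath t s ∈ T :=
  hT.uIcc_subset h0 ht (timePath_mem_uIcc t s)

lemma continuous_timeGen {X : Type*} [TopologicalSpace X] {ζ : X → ℂ}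
    {A B : X → Matrix (Fin 2) (Fin 2) ℂ} (hζ : Continuous ζ) (hA : Continuous A)
    (hB : Continuous B) (j : Idx) : Continuous fun x => timeGen (ζ x) j (A x) (B x) := by
  unfold timeGen
  refine Continuous.add (Continuous.matrix_diagonal (by fun_prop)) ?_
  exact Continuous.matrix_fromBlocks (by fun_prop) (by fun_prop) (by fun_prop) (by fun_prop)

/-- The time evolution matrix along the solution `Q`. -/
def timeMat (Q : ℝ → ℝ → Matrix (Fin 2) (Fin 2) ℂ) (z : ℂ) (j : Idx) (x t : ℝ) :
    Matrix Idx Idx ℂ :=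
  timeGen z j (Q x t) (dx Q x t)

lemma exists_bound_timeMat (hd : IsDecaying Q T) {K : Set ℝ} (hKT : K ⊆ T) (hK : IsCompact K)
    {Z : Set ℂ} (hZ : IsCompact Z) (j : Idx) :
    ∃ D, 0 ≤ D ∧ ∀ z ∈ Z, ∀ x, ∀ t ∈ K, ∑ i, ∑ l, ‖timeMat Q z j x t i l‖ ≤ D := by
  obtain ⟨C, hC⟩ := hd.bounded K hKT hK
  set S : Set (Matrix (Fin 2) (Fin 2) ℂ) :=
    Set.pi Set.univ fun _ => Set.pi Set.univ fun _ => Metric.closedBall (0 : ℂ) C with hS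
  have hSc : IsCompact S :=
    isCompact_univ_pi fun _ => isCompact_univ_pi fun _ => isCompact_closedBall _ _
  have hcont : Continuous fun p : ℂ × Matrix (Fin 2) (Fin 2) ℂ × Matrix (Fin 2) (Fin 2) ℂ =>
      ∑ i, ∑ l, ‖timeGen p.1 j p.2.1 p.2.2 i l‖ :=
    continuous_finsetSum _ fun i _ => continuous_finsetSum _ fun l _ =>
      ((continuous_timeGen continuous_fst (continuous_fst.comp continuous_snd)
        (continuous_snd.comp continuous_snd) j).matrix_elem i l).norm
  obtain ⟨D, hD⟩ := (hZ.prod (hSc.prod hSc)).exists_bound_of_continuousOn hcont.continuousOn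
  refine ⟨max D 0, le_max_right _ _, fun z hz x t ht => le_trans ?_ (le_max_left _ _)⟩
  have h1 : Q x t ∈ S := fun i _ l _ => by
    rw [mem_closedBall_zero_iff]; exact (hC x t ht i l).1
  have h2 : dx Q x t ∈ S := fun i _ l _ => by
    rw [mem_closedBall_zero_iff]; exact (hC x t ht i l).2
  exact (le_abs_self _).trans (hD (z, Q x t, dx Q x t) ⟨hz, h1, h2⟩)

lemma continuous_along_timePath (hT : T.OrdConnected) (h0 : (0 : ℝ) ∈ T) {t : ℝ} (ht : t ∈ T)
    {f : ℝ → ℝ → Matrix (Fin 2) (Fin 2) ℂ}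
    (hf : ∀ i j, ContinuousOn (fun p : ℝ × ℝ => f p.1 p.2 i j) (Set.univ ×ˢ T)) :
    Continuous fun p : ℝ × ℝ => f p.1 (timePath t p.2) := by
  refine continuous_matrix fun i j => ?_
  refine (hf i j).comp_continuous (f := fun p : ℝ × ℝ => (p.1, timePath t p.2)) ?_
    fun p => ⟨trivial, timePath_mem hT h0 ht p.2⟩
  exact continuous_fst.prodMk ((continuous_timePath t).comp continuous_snd)

lemma hasDerivAt_apply_dx (hQ : IsSolution Q T) {t : ℝ} (ht : t ∈ T) (x : ℝ) (i j : Fin 2) :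
    HasDerivAt (fun x => Q x t i j) (dx Q x t i j) x :=
  ((hQ.contDiff_space t ht i j).differentiable (by norm_num) x).hasDerivAt

lemma hasDerivAt_dx_apply_dx (hQ : IsSolution Q T) {t : ℝ} (ht : t ∈ T) (x : ℝ) (i j : Fin 2) :
    HasDerivAt (fun x => dx Q x t i j) (dx (dx Q) x t i j) x := by
  have h : ContDiff ℝ 1 (deriv fun x => Q x t i j) :=
    (contDiff_succ_iff_deriv.1 (hQ.contDiff_space t ht i j : ContDiff ℝ (1 + 1) _)).2.2
  exact (h.differentiable (by norm_num) x).hasDerivAt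

section MatrixDeriv

variable {A B : ℝ → Matrix (Fin 2) (Fin 2) ℂ} {A' B' : Matrix (Fin 2) (Fin 2) ℂ} {x : ℝ}

lemma hasDerivAt_matrix_mul (hA : ∀ i j, HasDerivAt (fun x => A x i j) (A' i j) x)
    (hB : ∀ i j, HasDerivAt (fun x => B x i j) (B' i j) x) (i j : Fin 2) :
    HasDerivAt (fun x => (A x * B x) i j) ((A' * B x + A x * B') i j) x := by
  simp only [Matrix.mul_apply, Matrix.add_apply, ← Finset.sum_add_distrib]
  exact HasDerivAt.fun_sum fun k _ => (hA i k).mul (hB k j)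

lemma hasDerivAt_matrix_conjTranspose (hA : ∀ i j, HasDerivAt (fun x => A x i j) (A' i j) x)
    (i j : Fin 2) : HasDerivAt (fun x => (A x)ᴴ i j) (A'ᴴ i j) x := by
  simp only [Matrix.conjTranspose_apply]
  exact (hA j i).star

end MatrixDeriv

lemma hasDerivAt_timeMat (hQ : IsSolution Q T) {t : ℝ} (ht : t ∈ T) (z : ℂ) (j : Idx) (x : ℝ)
    (i l : Idx) : HasDerivAt (fun x => timeMat Q z j x t i l)
      (timeGenDx z (Q x t) (dx Q x t) (dx (dx Q) x t) i l) x := by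
  have h1 := hasDerivAt_apply_dx hQ ht x
  have h2 := hasDerivAt_dx_apply_dx hQ ht x
  have h3 := hasDerivAt_matrix_conjTranspose h1
  have h4 := hasDerivAt_matrix_conjTranspose h2
  simp only [timeMat, timeGen, timeGenDx, Matrix.add_apply]
  rcases i with i | i <;> rcases l with l | l <;>
    simp only [Matrix.fromBlocks_apply₁₁, Matrix.fromBlocks_apply₁₂, Matrix.fromBlocks_apply₂₁,
      Matrix.fromBlocks_apply₂₂, Matrix.smul_apply, Matrix.add_apply, smul_eq_mul] <;>
    refine HasDerivAt.const_add _ ?_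
  · exact (hasDerivAt_matrix_mul h1 h3 i l).const_mul _
  · exact ((h1 i l).const_mul _).add ((h2 i l).const_mul _)
  · exact ((h3 i l).const_mul _).add ((h4 i l).const_mul _)
  · exact (hasDerivAt_matrix_mul h3 h1 i l).const_mul _

/-- The time derivative of `Q` according to the equation. -/
def timeDer (Q : ℝ → ℝ → Matrix (Fin 2) (Fin 2) ℂ) (x t : ℝ) : Matrix (Fin 2) (Fin 2) ℂ :=
  Complex.I • (dx (dx Q) x t + (2 : ℂ) • (Q x t * (Q x t)ᴴ * Q x t))

/-- The path never leaves `T`, so a derivative within `T` composes to a two-sided derivative in `s`,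
even where the path touches an endpoint of `T`. -/
lemma hasDerivAt_along_timePath (hQ : IsSolution Q T) (hT : T.OrdConnected) (h0 : (0 : ℝ) ∈ T)
    {t : ℝ} (ht : t ∈ T) (x s : ℝ) (i j : Fin 2) :
    HasDerivAt (fun s => Q x (timePath t s) i j)
      (((timeSpeed t s : ℂ) • timeDer Q x (timePath t s)) i j) s := by
  obtain ⟨q', h1, h2⟩ := hQ.equation x (timePath t s) (timePath_mem hT h0 ht s) i j
  have hq : q' = timeDer Q x (timePath t s) i j := by
    simp only [timeDer, Matrix.smul_apply, Matrix.add_apply, smul_eq_mul]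
    linear_combination (-Complex.I) * h2 + q' * Complex.I_sq
  have h := h1.scomp_hasDerivAt s (hasDerivAt_timePath t s) (timePath_mem hT h0 ht)
  rw [hq] at h
  exact h.congr_deriv (by simp)

end

/-! ### The columns of `μ₋` obey the time evolution. -/

section

variable {Q : ℝ → ℝ → Matrix (Fin 2) (Fin 2) ℂ} {T : Set ℝ}

lemma continuous_matCLM' {X : Type*} [TopologicalSpace X] {A : X → Matrix Idx Idx ℂ}
    (hA : Continuous A) : Continuous fun x => matCLM (A x) :=
  continuous_matCLM fun i l => hA.matrix_elem i l

/-- The generator of the evolution along `timePath t`. -/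
def pathGen (Q : ℝ → ℝ → Matrix (Fin 2) (Fin 2) ℂ) (t : ℝ) (z : ℂ) (j : Idx) (x s : ℝ) :
    (Idx → ℂ) →L[ℂ] (Idx → ℂ) :=
  matCLM ((timeSpeed t s : ℂ) • timeMat Q z j x (timePath t s))

lemma continuous_pathGen (hQ : IsSolution Q T) (hT : T.OrdConnected) (h0 : (0 : ℝ) ∈ T) {t : ℝ}
    (ht : t ∈ T) (z : ℂ) (j : Idx) : Continuous fun p : ℝ × ℝ => pathGen Q t z j p.1 p.2 := by
  refine continuous_matCLM' (Continuous.fun_smul ?_ ?_)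
  · exact Complex.continuous_ofReal.comp ((continuous_timeSpeed t).comp continuous_snd)
  · exact continuous_timeGen continuous_const (continuous_along_timePath hT h0 ht hQ.cont)
      (continuous_along_timePath hT h0 ht hQ.cont_dx) j

lemma norm_pathGen_le {t : ℝ} {z : ℂ} {j : Idx} {D : ℝ}
    (hD : ∀ x, ∀ r ∈ Set.uIcc 0 t, ∑ i, ∑ l, ‖timeMat Q z j x r i l‖ ≤ D) (x s : ℝ) :
    ‖pathGen Q t z j x s‖ ≤ |timeSpeed t s| * D := by
  refine (norm_matCLM_le _).trans ?_
  simp only [Matrix.smul_apply, smul_eq_mul, norm_mul, ← Finset.mul_sum, Complex.norm_real,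
    Real.norm_eq_abs]
  exact mul_le_mul_of_nonneg_left (hD x _ (timePath_mem_uIcc t s)) (abs_nonneg _)

/-- The roles change: the space variable is now the parameter, and the Volterra variable is the path
parameter `s`. -/
lemma dominatedKernel_pathGen (hQ : IsSolution Q T) (hT : T.OrdConnected)
    (h0 : (0 : ℝ) ∈ T) {t : ℝ} (ht : t ∈ T) {z : ℂ} {j : Idx} {D : ℝ} (hD0 : 0 ≤ D)
    (hD : ∀ x, ∀ r ∈ Set.uIcc 0 t, ∑ i, ∑ l, ‖timeMat Q z j x r i l‖ ≤ D) :
    DominatedKernel (fun x _ r => pathGen Q t z j x r) (fun r => |timeSpeed t r| * D) where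
  cont_bound := (continuous_timeSpeed t).abs.mul continuous_const
  integrable_bound := (integrable_timeSpeed t).abs.mul_const D
  nonneg := fun r => mul_nonneg (abs_nonneg _) hD0
  cont := (continuous_pathGen hQ hT h0 ht z j).comp (f := fun q : ℝ × ℝ × ℝ => (q.1, q.2.2))
    (by fun_prop)
  le := fun x _ r _ => norm_pathGen_le hD x r

/-- The solution of the time evolution starting at the `j`-th column of `μ₋(·, 0)`. -/
def evolved (Q : ℝ → ℝ → Matrix (Fin 2) (Fin 2) ℂ) (t : ℝ) (z : ℂ) (j : Idx) (x s : ℝ) :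
    Idx → ℂ :=
  volterraSol (fun x _ r => pathGen Q t z j x r) (fun x _ => mcol Q 0 j z x) x s

/-- The limit generator at `x = -∞` is diagonal with entries proportional to `σ_i - σ_j`. Hence the
evolution preserves the normalization of the `j`-th column. -/
lemma timeGen_zero_mulVec_unitCol (z : ℂ) (j : Idx) : timeGen z j 0 0 *ᵥ unitCol j = 0 := by
  have h : Matrix.fromBlocks (0 : Matrix (Fin 2) (Fin 2) ℂ) (0 : Matrix (Fin 2) (Fin 2) ℂ)
      (0 : Matrix (Fin 2) (Fin 2) ℂ) (0 : Matrix (Fin 2) (Fin 2) ℂ) = 0 := Matrix.fromBlocks_zero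
  funext i
  simp only [timeGen, Matrix.conjTranspose_zero, mul_zero, smul_zero, add_zero, h,
    Matrix.mulVec_diagonal, Pi.zero_apply]
  by_cases hij : i = j
  · simp [hij]
  · simp [unitCol, hij]

lemma tendsto_matrix_of_entries {l : Filter ℝ} {f : ℝ → Matrix (Fin 2) (Fin 2) ℂ}
    (h : ∀ i j, Tendsto (fun x => f x i j) l (𝓝 0)) : Tendsto f l (𝓝 0) :=
  tendsto_pi_nhds.2 fun i => tendsto_pi_nhds.2 fun j => h i j

lemma tendsto_pathGen (hd : IsDecaying Q T) (hT : T.OrdConnected)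
    (h0 : (0 : ℝ) ∈ T) {t : ℝ} (ht : t ∈ T) (z : ℂ) (j : Idx) (s : ℝ) :
    Tendsto (fun x => pathGen Q t z j x s) atBot
      (𝓝 (matCLM ((timeSpeed t s : ℂ) • timeGen z j 0 0))) := by
  have hs := timePath_mem hT h0 ht s
  have hQ0 : Tendsto (fun x => Q x (timePath t s)) atBot (𝓝 0) :=
    tendsto_matrix_of_entries fun i j => (hd.tendsto _ hs i j).mono_left le_sup_left
  have hQ1 : Tendsto (fun x => dx Q x (timePath t s)) atBot (𝓝 0) :=
    tendsto_matrix_of_entries fun i j => (hd.tendsto_dx _ hs i j).mono_left le_sup_left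
  have hcont : Continuous fun p : Matrix (Fin 2) (Fin 2) ℂ × Matrix (Fin 2) (Fin 2) ℂ =>
      matCLM ((timeSpeed t s : ℂ) • timeGen z j p.1 p.2) :=
    continuous_matCLM' (Continuous.fun_smul continuous_const
      (continuous_timeGen continuous_const continuous_fst continuous_snd j))
  exact Tendsto.comp (g := fun p : Matrix (Fin 2) (Fin 2) ℂ × Matrix (Fin 2) (Fin 2) ℂ =>
      matCLM ((timeSpeed t s : ℂ) • timeGen z j p.1 p.2))
    (f := fun x => (Q x (timePath t s), dx Q x (timePath t s)))
    (hcont.tendsto (0, 0)) (hQ0.prodMk_nhds hQ1)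

/-- Limits are taken term by term in the Neumann series: the zeroth iterate tends to the unit
column, the limit generator kills it, so all further iterates tend to zero. The bounds of the series
are uniform in `x` and justify both dominated convergences. -/
lemma tendsto_evolved (hQ : IsSolution Q T) (hd : IsDecaying Q T) (hT : T.OrdConnected)
    (h0 : (0 : ℝ) ∈ T) {t : ℝ} (ht : t ∈ T) {z : ℂ} {j : Idx} (hz : z ∈ leftHalf j) {D M : ℝ}
    (hD0 : 0 ≤ D) (hD : ∀ x, ∀ r ∈ Set.uIcc 0 t, ∑ i, ∑ l, ‖timeMat Q z j x r i l‖ ≤ D)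
    (hM : ∀ x, ‖mcol Q 0 j z x‖ ≤ M) (s : ℝ) :
    Tendsto (fun x => evolved Q t z j x s) atBot (𝓝 (unitCol j)) := by
  have hk := dominatedKernel_pathGen hQ hT h0 ht hD0 hD
  have hmc : Continuous (mcol Q 0 j z) :=
    continuous_iff_continuousAt.2 fun x => (hasDerivAt_mcol hQ hd h0 hz x).continuousAt
  have hg : Continuous fun q : ℝ × ℝ => (fun x _ => mcol Q 0 j z x : ℝ → ℝ → Idx → ℂ) q.1 q.2 :=
    hmc.comp continuous_fst
  have hgM : ∀ p x : ℝ, ‖(fun x _ => mcol Q 0 j z x : ℝ → ℝ → Idx → ℂ) p x‖ ≤ M :=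
    fun p _ => hM p
  set c : ℕ → Idx → ℂ := fun n => if n = 0 then unitCol j else 0 with hc
  have hcz : ∀ n, timeGen z j 0 0 *ᵥ c n = 0 := by
    intro n
    by_cases hn : n = 0
    · simp [hc, hn, timeGen_zero_mulVec_unitCol]
    · simp [hc, hn]
  have hpic : ∀ n, ∀ s, Tendsto (fun x => picard (fun x _ r => pathGen Q t z j x r)
      (fun x _ => mcol Q 0 j z x) n x s) atBot (𝓝 (c n)) := by
    intro n
    induction n with
    | zero => intro s; exact tendsto_mcol_atBot hQ hd h0 hz
    | succ n ih =>
      intro s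
      have hlim := tendsto_integral_filter_of_dominated_convergence
        (μ := volume.restrict (Set.Iic s)) (l := (atBot : Filter ℝ))
        (F := fun x r => pathGen Q t z j x r (picard (fun x _ r => pathGen Q t z j x r)
          (fun x _ => mcol Q 0 j z x) n x r)) (f := fun r => (0 : Idx → ℂ))
        (fun r => |timeSpeed t r| * D *
          (M * leftMass (fun r => |timeSpeed t r| * D) r ^ n / n.factorial)) ?_ ?_ ?_ ?_
      · simpa [hc, picard] using hlim
      · refine Eventually.of_forall fun x => Continuous.aestronglyMeasurable ?_
        have h1 : Continuous fun r => pathGen Q t z j x r :=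
          (continuous_pathGen hQ hT h0 ht z j).comp (f := fun r : ℝ => (x, r)) (by fun_prop)
        have h2 := (picard_spec hk hg hgM n).1.comp (f := fun r : ℝ => (x, r)) (by fun_prop)
        exact h1.clm_apply h2
      · exact Eventually.of_forall fun x => ae_of_all _ fun r =>
          hk.norm_apply_le (p := x) le_rfl ((picard_spec hk hg hgM n).2 x r)
      · exact (integrable_mul_leftMass_pow' hk.cont_bound hk.integrable_bound hk.nonneg n
          M).integrableOn
      · refine ae_of_all _ fun r => ?_
        have h := Tendsto.comp (isBoundedBilinearMap_apply.continuous.tendsto _)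
          ((tendsto_pathGen hd hT h0 ht z j r).prodMk_nhds (ih r))
        rwa [matCLM_apply, Matrix.smul_mulVec, hcz, smul_zero] at h
  have hsum : ∑' n, c n = unitCol j := by
    rw [tsum_eq_single 0 (fun n hn => by simp [hc, hn])]
    simp [hc]
  rw [← hsum]
  exact tendsto_tsum_of_dominated_convergence
    (summable_volterra_bound (M := M) (∫ y, |timeSpeed t y| * D)) (fun n => hpic n s)
    (Eventually.of_forall fun x n => norm_picard_le hk hg hgM n x s)

/-- The columns of `μ₋` obey the time evolution. -/
lemma exists_evolution_mcol (hQ : IsSolution Q T) (hd : IsDecaying Q T) (hT : T.OrdConnected)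
    (h0 : (0 : ℝ) ∈ T) {t : ℝ} (ht : t ∈ T) {z : ℂ} {j : Idx} (hz : z ∈ leftHalf j) :
    ∃ φ : ℝ → ℝ → Idx → ℂ, (∀ x s, 0 ≤ s → φ x s = mcol Q (timePath t s) j z x) ∧
      ∀ x s, HasDerivAt (φ x) (pathGen Q t z j x s (φ x s)) s := by
  obtain ⟨D, hD0, hD'⟩ := exists_bound_timeMat hd (hT.uIcc_subset h0 ht)
    (isCompact_uIcc (a := (0 : ℝ)) (b := t)) (isCompact_singleton (x := z)) j
  have hD : ∀ x, ∀ r ∈ Set.uIcc 0 t, ∑ i, ∑ l, ‖timeMat Q z j x r i l‖ ≤ D :=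
    fun x r hr => hD' z rfl x r hr
  obtain ⟨M, hM0, hM⟩ := (isMuMinusColumn_minusCol (isPotential_potential hQ hd h0)
    hz).exists_bound
  have hk := dominatedKernel_pathGen hQ hT h0 ht hD0 hD
  have hmc : Continuous (mcol Q 0 j z) :=
    continuous_iff_continuousAt.2 fun x => (hasDerivAt_mcol hQ hd h0 hz x).continuousAt
  have hg : Continuous fun q : ℝ × ℝ => (fun x _ => mcol Q 0 j z x : ℝ → ℝ → Idx → ℂ) q.1 q.2 :=
    hmc.comp continuous_fst
  have hgM : ∀ p x : ℝ, ‖(fun x _ => mcol Q 0 j z x : ℝ → ℝ → Idx → ℂ) p x‖ ≤ M :=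
    fun p _ => hM p
  set φ := evolved Q t z j with hφ
  have hφc : Continuous fun q : ℝ × ℝ => φ q.1 q.2 := continuous_volterraSol hk hg hgM
  have hφb := norm_volterraSol_le hk hg hgM
  set B := ∑' n : ℕ, M * (∫ y, |timeSpeed t y| * D) ^ n / n.factorial with hB
  have heq : ∀ x s, φ x s = mcol Q 0 j z x + ∫ r in Set.Iic s, pathGen Q t z j x r (φ x r) :=
    volterraSol_eq hk hg hgM
  have hφs : ∀ x s, HasDerivAt (φ x) (pathGen Q t z j x s (φ x s)) s := by
    intro x s
    have hc : Continuous fun r => pathGen Q t z j x r (φ x r) :=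
      ((continuous_pathGen hQ hT h0 ht z j).clm_apply hφc).comp (f := fun r : ℝ => (x, r))
        (by fun_prop)
    have hi : ∀ s, IntegrableOn (fun r => pathGen Q t z j x r (φ x r)) (Set.Iic s) := by
      intro s
      refine Integrable.integrableOn ?_
      exact (hk.integrable_bound.mul_const B).mono' hc.aestronglyMeasurable
        (ae_of_all _ fun r => hk.norm_apply_le (p := x) le_rfl (hφb x r))
    have h := (hasDerivAt_integral_Iic hc hi s).const_add (mcol Q 0 j z x)
    exact h.congr_of_eventuallyEq (Eventually.of_forall (heq x))
  -- The generator vanishes for `s ≤ 0`, so the Volterra solution starts at the prescribed datum.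
  have hφ0 : ∀ x, φ x 0 = mcol Q 0 j z x := by
    intro x
    have h : ∫ r in Set.Iic (0 : ℝ), pathGen Q t z j x r (φ x r) = 0 := by
      refine setIntegral_eq_zero_of_forall_eq_zero fun r hr => ?_
      simp [pathGen, timeSpeed_of_nonpos t hr]
    rw [heq, h, add_zero]
  have hX : ∀ x s, HasDerivAt
      (fun s => matCLM (specMat (fun y => potential Q y (timePath t s)) z j x))
      (matCLM ((timeSpeed t s : ℂ) • Matrix.fromBlocks 0 (timeDer Q x (timePath t s))
        (-(timeDer Q x (timePath t s))ᴴ) 0)) s := by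
    intro x s
    refine hasDerivAt_matCLM fun i l => ?_
    have hq := hasDerivAt_along_timePath hQ hT h0 ht x s
    simp only [specMat, Matrix.add_apply]
    rcases i with i | i <;> rcases l with l | l <;>
      simp only [potential, Matrix.fromBlocks_apply₁₁, Matrix.fromBlocks_apply₁₂,
        Matrix.fromBlocks_apply₂₁, Matrix.fromBlocks_apply₂₂, Matrix.smul_apply,
        Matrix.neg_apply, Matrix.zero_apply, smul_zero] <;>
      refine HasDerivAt.const_add _ ?_
    · exact hasDerivAt_const _ _
    · exact hq i l
    · refine (hasDerivAt_matrix_conjTranspose hq i l).neg.congr_deriv ?_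
      simp
    · exact hasDerivAt_const _ _
  have hY : ∀ x s, HasDerivAt (fun x => pathGen Q t z j x s)
      (matCLM ((timeSpeed t s : ℂ) • timeGenDx z (Q x (timePath t s)) (dx Q x (timePath t s))
        (dx (dx Q) x (timePath t s)))) x := by
    intro x s
    refine hasDerivAt_matCLM fun i l => ?_
    exact (hasDerivAt_timeMat hQ (timePath_mem hT h0 ht s) z j x i l).const_mul _
  have hcQ := continuous_along_timePath hT h0 ht hQ.cont
  have hcQx := continuous_along_timePath hT h0 ht hQ.cont_dx
  have hcQxx := continuous_along_timePath hT h0 ht hQ.cont_dxx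
  have hsp : Continuous fun p : ℝ × ℝ => (timeSpeed t p.2 : ℂ) :=
    Complex.continuous_ofReal.comp ((continuous_timeSpeed t).comp continuous_snd)
  have hcX : Continuous fun p : ℝ × ℝ =>
      matCLM (specMat (fun y => potential Q y (timePath t p.2)) z j p.1) := by
    refine continuous_matCLM' ?_
    unfold specMat potential
    exact continuous_const.add (Continuous.matrix_fromBlocks continuous_const hcQ
      hcQ.matrix_conjTranspose.neg continuous_const)
  have hcder : Continuous fun p : ℝ × ℝ => timeDer Q p.1 (timePath t p.2) :=
    (hcQxx.add (((hcQ.matrix_mul hcQ.matrix_conjTranspose).matrix_mul hcQ).const_smul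
      (2 : ℂ))).const_smul Complex.I
  have hcXs : Continuous fun p : ℝ × ℝ =>
      matCLM ((timeSpeed t p.2 : ℂ) • Matrix.fromBlocks 0 (timeDer Q p.1 (timePath t p.2))
        (-(timeDer Q p.1 (timePath t p.2))ᴴ) 0) :=
    continuous_matCLM' (hsp.smul (Continuous.matrix_fromBlocks continuous_const hcder
      hcder.matrix_conjTranspose.neg continuous_const))
  have hcYx : Continuous fun p : ℝ × ℝ =>
      matCLM ((timeSpeed t p.2 : ℂ) • timeGenDx z (Q p.1 (timePath t p.2))
        (dx Q p.1 (timePath t p.2)) (dx (dx Q) p.1 (timePath t p.2))) := by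
    refine continuous_matCLM' (hsp.smul ?_)
    unfold timeGenDx
    have h1 := hcQ.matrix_conjTranspose
    have h2 := hcQx.matrix_conjTranspose
    have h3 := hcQxx.matrix_conjTranspose
    exact Continuous.matrix_fromBlocks
      (((hcQx.matrix_mul h1).add (hcQ.matrix_mul h2)).const_smul Complex.I)
      ((hcQx.const_smul (2 * z)).add (hcQxx.const_smul Complex.I))
      ((h2.const_smul (-2 * z)).add (h3.const_smul Complex.I))
      (((h2.matrix_mul hcQ).add (h1.matrix_mul hcQx)).const_smul (-Complex.I))
  have hx : ∀ x s, 0 ≤ s → HasDerivAt (fun x => φ x s)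
      (specMat (fun y => potential Q y (timePath t s)) z j x *ᵥ φ x s) x := by
    intro x s hs
    have h := hasDerivAt_of_zero_curvature hcX (continuous_pathGen hQ hT h0 ht z j) hcXs hcYx hX hY
      (fun x s v => ?_) hφc hφs (fun x => ?_) x hs
    · rwa [matCLM_apply] at h
    · simp only [pathGen, matCLM_apply, Matrix.mulVec_mulVec, ← Matrix.add_mulVec]
      congr 1
      rw [Matrix.smul_mul, Matrix.mul_smul, ← smul_add, ← smul_add]
      congr 1
      exact zero_curvature z j _ _ _
    · simp only [hφ0, timePath_zero, matCLM_apply]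
      exact hasDerivAt_mcol hQ hd h0 hz x
  refine ⟨φ, fun x s hs => ?_, hφs⟩
  -- At path parameter `s` the evolved function is bounded, solves the spectral problem and has the
  -- right limit at `-∞`; uniqueness identifies it with the column of `μ₋` at that time.
  have hcol := isMuMinusColumn_of_hasDerivAt
    (isPotential_potential hQ hd (timePath_mem hT h0 ht s)) hz (f := fun x => φ x s)
    (fun x => hφb x s) (fun x => hx x s hs) (tendsto_evolved hQ hd hT h0 ht hz hD0 hD hM s)
  exact congrFun (hcol.eq_minusCol
    (isPotential_potential hQ hd (timePath_mem hT h0 ht s)) hz) x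

end

section

/-! ### Grönwall estimates, vanishing order and Leibniz formulas -/

lemma norm_le_exp_mul_of_linear_ode_of_le {E : Type*} [NormedAddCommGroup E] [NormedSpace ℂ E]
    {A : ℝ → E →L[ℂ] E} {f : ℝ → E} (hf : ∀ s, HasDerivAt f (A s (f s)) s) {a b C : ℝ}
    (hab : a ≤ b) (hA : ∀ s ∈ Set.Icc a b, ‖A s‖ ≤ C) :
    ‖f b‖ ≤ Real.exp (C * (b - a)) * ‖f a‖ := by
  have h := norm_le_gronwallBound_of_norm_deriv_right_le (f := f) (f' := fun s => A s (f s))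
    (δ := ‖f a‖) (K := C) (ε := 0) (a := a) (b := b)
    (fun s _ => (hf s).continuousAt.continuousWithinAt) (fun s _ => (hf s).hasDerivWithinAt)
    le_rfl (fun s hs => by
      rw [add_zero]
      exact ((A s).le_opNorm _).trans (mul_le_mul_of_nonneg_right
        (hA s (Set.Ico_subset_Icc_self hs)) (norm_nonneg _))) b ⟨hab, le_rfl⟩
  rwa [gronwallBound_ε0, mul_comm] at h

lemma norm_le_exp_mul_of_linear_ode {E : Type*} [NormedAddCommGroup E] [NormedSpace ℂ E]
    {A : ℝ → E →L[ℂ] E} {f : ℝ → E} (hf : ∀ s, HasDerivAt f (A s (f s)) s) {a b C : ℝ}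
    (hA : ∀ s ∈ Set.uIcc a b, ‖A s‖ ≤ C) :
    ‖f b‖ ≤ Real.exp (C * |b - a|) * ‖f a‖ := by
  rcases le_total a b with hab | hab
  · rw [abs_of_nonneg (sub_nonneg.2 hab)]
    rw [Set.uIcc_of_le hab] at hA
    exact norm_le_exp_mul_of_linear_ode_of_le hf hab hA
  · rw [abs_of_nonpos (sub_nonpos.2 hab)]
    rw [Set.uIcc_of_ge hab] at hA
    have h := norm_le_exp_mul_of_linear_ode_of_le (A := fun s => -A (-s)) (f := fun s => f (-s))
      (a := -a) (b := -b) (C := C) (fun s => ?_) (neg_le_neg hab) (fun s hs => ?_)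
    · simp only [neg_neg] at h
      convert h using 3
      ring
    · refine ((hf (-s)).scomp s (hasDerivAt_neg s)).congr_deriv ?_
      simp
    · rw [norm_neg]
      exact hA _ ⟨by linarith [hs.2], by linarith [hs.1]⟩

/-- If `f` had order `k < n`, dividing the bound by `|z - z₀|^k` would leave a function with nonzero
value at `z₀` dominated by a multiple of `|z - z₀|^(n-k) ‖G z‖`, which tends to zero. -/
lemma natCast_le_analyticOrderAt_of_norm_le {f g : ℂ → ℂ} {z₀ : ℂ} (hf : AnalyticAt ℂ f z₀)
    (hg : AnalyticAt ℂ g z₀) {C : ℝ} (hfg : ∀ᶠ z in 𝓝 z₀, ‖f z‖ ≤ C * ‖g z‖) {n : ℕ}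
    (hn : (n : ℕ∞) ≤ analyticOrderAt g z₀) : (n : ℕ∞) ≤ analyticOrderAt f z₀ := by
  by_contra hlt
  rw [not_le] at hlt
  obtain ⟨k, hk⟩ := ENat.ne_top_iff_exists.1 (ne_top_of_lt hlt)
  rw [← hk] at hlt
  have hkn : k < n := by exact_mod_cast hlt
  obtain ⟨F, hF, hF0, hfF⟩ := (hf.analyticOrderAt_eq_natCast).1 hk.symm
  obtain ⟨G, hG, hgG⟩ := (natCast_le_analyticOrderAt hg).1 hn
  have h1 : ∀ᶠ z in 𝓝[≠] z₀, ‖F z‖ ≤ C * (‖z - z₀‖ ^ (n - k) * ‖G z‖) := by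
    filter_upwards [hfg.filter_mono nhdsWithin_le_nhds, hfF.filter_mono nhdsWithin_le_nhds,
      hgG.filter_mono nhdsWithin_le_nhds, self_mem_nhdsWithin] with z h h2 h3 hz
    have hpos : 0 < ‖z - z₀‖ ^ k := pow_pos (norm_pos_iff.2 (sub_ne_zero.2 hz)) k
    rw [h2, h3, norm_smul, norm_smul, norm_pow, norm_pow] at h
    have h4 : ‖z - z₀‖ ^ n = ‖z - z₀‖ ^ k * ‖z - z₀‖ ^ (n - k) := by
      rw [← pow_add, Nat.add_sub_cancel' hkn.le]
    rw [h4] at h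
    refine le_of_mul_le_mul_left ?_ hpos
    calc _ ≤ _ := h
      _ = _ := by ring
  have h2 : Tendsto (fun z => C * (‖z - z₀‖ ^ (n - k) * ‖G z‖)) (𝓝[≠] z₀) (𝓝 0) := by
    have hc : ContinuousAt (fun z => C * (‖z - z₀‖ ^ (n - k) * ‖G z‖)) z₀ :=
      continuousAt_const.mul (((continuousAt_id.sub continuousAt_const).norm.pow _).mul
        hG.continuousAt.norm)
    have h := hc.tendsto
    have hne : n - k ≠ 0 := by omega
    simp only [sub_self, norm_zero, zero_pow hne, zero_mul, mul_zero] at h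
    exact h.mono_left nhdsWithin_le_nhds
  have h3 : Tendsto (fun z => ‖F z‖) (𝓝[≠] z₀) (𝓝 ‖F z₀‖) :=
    hF.continuousAt.norm.tendsto.mono_left nhdsWithin_le_nhds
  have h4 : ‖F z₀‖ ≤ 0 := le_of_tendsto_of_tendsto h3 h2 h1
  exact hF0 (norm_le_zero_iff.1 h4)

/-- Entrywise analyticity of a matrix-valued function at a point. -/
def MatAnalyticAt {r c : Type*} (F : ℂ → Matrix r c ℂ) (z : ℂ) : Prop :=
  ∀ i j, AnalyticAt ℂ (fun w => F w i j) z

lemma MatAnalyticAt.mul {r c : Type*} {F : ℂ → Matrix r (Fin 2) ℂ} {G : ℂ → Matrix (Fin 2) c ℂ}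
    {z : ℂ} (hF : MatAnalyticAt F z) (hG : MatAnalyticAt G z) :
    MatAnalyticAt (fun w => F w * G w) z := fun i j => by
  simp only [Matrix.mul_apply]
  exact Finset.analyticAt_fun_sum _ fun k _ => (hF i k).mul (hG k j)

lemma MatAnalyticAt.smul {r c : Type*} {F : ℂ → Matrix r c ℂ} {f : ℂ → ℂ} {z : ℂ}
    (hf : AnalyticAt ℂ f z) (hF : MatAnalyticAt F z) : MatAnalyticAt (fun w => f w • F w) z :=
  fun i j => hf.mul (hF i j)

lemma MatAnalyticAt.det {F : ℂ → Matrix (Fin 2) (Fin 2) ℂ} {z : ℂ} (hF : MatAnalyticAt F z) :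
    AnalyticAt ℂ (fun w => (F w).det) z := by
  simp only [Matrix.det_fin_two]
  exact ((hF 0 0).mul (hF 1 1)).sub ((hF 0 1).mul (hF 1 0))

lemma MatAnalyticAt.adjugate {F : ℂ → Matrix (Fin 2) (Fin 2) ℂ} {z : ℂ}
    (hF : MatAnalyticAt F z) : MatAnalyticAt (fun w => (F w).adjugate) z := by
  intro i j
  fin_cases i <;> fin_cases j <;> simp only [Matrix.adjugate_fin_two] <;> simp
  · exact hF 1 1
  · exact (hF 0 1).neg
  · exact (hF 1 0).neg
  · exact hF 0 0

lemma MatAnalyticAt.inv {F : ℂ → Matrix (Fin 2) (Fin 2) ℂ} {z : ℂ} (hF : MatAnalyticAt F z)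
    (h0 : (F z).det ≠ 0) : MatAnalyticAt (fun w => (F w)⁻¹) z := by
  simp only [Matrix.inv_def, Ring.inverse_eq_inv']
  exact MatAnalyticAt.smul (hF.det.inv h0) hF.adjugate

lemma iteratedDeriv_mul_div_factorial {f g : ℂ → ℂ} {z : ℂ} (hf : AnalyticAt ℂ f z)
    (hg : AnalyticAt ℂ g z) (n : ℕ) :
    (n.factorial : ℂ)⁻¹ * iteratedDeriv n (fun w => f w * g w) z =
      ∑ p ∈ Finset.HasAntidiagonal.antidiagonal n, ((p.1.factorial : ℂ) * p.2.factorial)⁻¹ *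
        (iteratedDeriv p.1 f z * iteratedDeriv p.2 g z) := by
  have h : iteratedDeriv n (fun w => f w * g w) z = _ :=
    iteratedDeriv_mul (n := n) hf.contDiffAt hg.contDiffAt
  rw [h, Finset.Nat.sum_antidiagonal_eq_sum_range_succ_mk, Finset.mul_sum]
  refine Finset.sum_congr rfl fun k hk => ?_
  have hkn : k ≤ n := Nat.lt_succ_iff.1 (Finset.mem_range.1 hk)
  have hc : (n.choose k : ℂ) = n.factorial / (k.factorial * (n - k).factorial) :=
    Nat.cast_choose ℂ hkn
  have h1 : (n.factorial : ℂ) ≠ 0 := by exact_mod_cast n.factorial_ne_zero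
  have h2 : (k.factorial : ℂ) ≠ 0 := by exact_mod_cast k.factorial_ne_zero
  have h3 : ((n - k).factorial : ℂ) ≠ 0 := by exact_mod_cast (n - k).factorial_ne_zero
  rw [hc]
  field_simp

lemma matDeriv_congr {r c : Type*} {F G : ℂ → Matrix r c ℂ} {z : ℂ} (h : F =ᶠ[𝓝 z] G) (n : ℕ) :
    matDeriv n F z = matDeriv n G z := by
  ext i j
  exact Filter.EventuallyEq.iteratedDeriv_eq n (h.mono fun w hw => by simp only [hw])

/-- The first index of each pair belongs to the right factor, so that it becomes the index of the
norming matrix. -/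
lemma matDeriv_mul {r c : Type*} {F : ℂ → Matrix r (Fin 2) ℂ} {G : ℂ → Matrix (Fin 2) c ℂ} {z : ℂ}
    (hF : MatAnalyticAt F z) (hG : MatAnalyticAt G z) (n : ℕ) :
    (n.factorial : ℂ)⁻¹ • matDeriv n (fun w => F w * G w) z =
      ∑ p ∈ Finset.HasAntidiagonal.antidiagonal n, ((p.1.factorial : ℂ) * p.2.factorial)⁻¹ •
        (matDeriv p.2 F z * matDeriv p.1 G z) := by
  ext i j
  simp only [matDeriv, Matrix.smul_apply, Matrix.of_apply, Matrix.sum_apply, Matrix.mul_apply,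
    smul_eq_mul]
  have hs : iteratedDeriv n (fun w => ∑ k, F w i k * G w k j) z =
      ∑ k, iteratedDeriv n (fun w => F w i k * G w k j) z :=
    iteratedDeriv_fun_sum fun k _ =>
      (show AnalyticAt ℂ (fun w => F w i k * G w k j) z from (hF i k).mul (hG k j)).contDiffAt
  rw [hs]
  simp only [Finset.mul_sum]
  rw [Finset.sum_comm]
  refine Finset.sum_congr rfl fun k _ => ?_
  simp only [mul_comm (F _ i k)]
  rw [iteratedDeriv_mul_div_factorial (hG k j) (hF i k)]
  refine Finset.sum_congr rfl fun p _ => ?_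
  ring

lemma matDeriv_smul {r c : Type*} {f : ℂ → ℂ} {F : ℂ → Matrix r c ℂ} {z : ℂ}
    (hf : AnalyticAt ℂ f z) (hF : MatAnalyticAt F z) (n : ℕ) :
    (n.factorial : ℂ)⁻¹ • matDeriv n (fun w => f w • F w) z =
      ∑ p ∈ Finset.HasAntidiagonal.antidiagonal n, (((p.1.factorial : ℂ) * p.2.factorial)⁻¹ *
        iteratedDeriv p.1 f z) • matDeriv p.2 F z := by
  ext i j
  simp only [matDeriv, Matrix.smul_apply, Matrix.of_apply, Matrix.sum_apply, smul_eq_mul]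
  rw [iteratedDeriv_mul_div_factorial hf (hF i j)]
  refine Finset.sum_congr rfl fun p _ => ?_
  ring

lemma matDeriv_add_of_eq_zero {r c : Type*} {F R : ℂ → Matrix r c ℂ} {z : ℂ} {n : ℕ}
    (hF : MatAnalyticAt F z) (hR : MatAnalyticAt R z) (h0 : matDeriv n R z = 0) :
    matDeriv n (fun w => F w + R w) z = matDeriv n F z := by
  ext i j
  have h := congrFun (congrFun h0 i) j
  simp only [matDeriv, Matrix.of_apply, Matrix.add_apply, Matrix.zero_apply] at h ⊢
  rw [iteratedDeriv_fun_add (hF i j).contDiffAt (hR i j).contDiffAt, h, add_zero]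

/-- Conjugation combined with the swap of the blocks, `M ↦ J⁻¹ conj M`. -/
def conjSwap {c : Type*} (M : Matrix Idx c ℂ) : Matrix Idx c ℂ :=
  Matrix.of fun i j => Sum.elim (fun a => -conj (M (Sum.inr a) j)) (fun a => conj (M (Sum.inl a) j)) i

@[simp] lemma conjSwap_inl {c : Type*} (M : Matrix Idx c ℂ) (a : Fin 2) (j : c) :
    conjSwap M (Sum.inl a) j = -conj (M (Sum.inr a) j) := rfl

@[simp] lemma conjSwap_inr {c : Type*} (M : Matrix Idx c ℂ) (a : Fin 2) (j : c) :
    conjSwap M (Sum.inr a) j = conj (M (Sum.inl a) j) := rfl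

lemma conjSwap_mul {c : Type*} (M : Matrix Idx (Fin 2) ℂ) (N : Matrix (Fin 2) c ℂ) :
    conjSwap (M * N) = conjSwap M * N.map conj := by
  ext i j
  rcases i with i | i <;> simp [Matrix.mul_apply]

lemma conjSwap_smul {c : Type*} (a : ℂ) (M : Matrix Idx c ℂ) :
    conjSwap (a • M) = conj a • conjSwap M := by
  ext i j
  rcases i with i | i <;> simp

lemma conjSwap_sum {c ι : Type*} (s : Finset ι) (M : ι → Matrix Idx c ℂ) :
    conjSwap (∑ k ∈ s, M k) = ∑ k ∈ s, conjSwap (M k) := by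
  ext i j
  rcases i with i | i <;> simp [Matrix.sum_apply]

lemma iteratedDeriv_conj_comp_conj (f : ℂ → ℂ) (n : ℕ) (z : ℂ) :
    iteratedDeriv n (fun w => conj (f (conj w))) (conj z) = conj (iteratedDeriv n f z) := by
  have h : ∀ n, iteratedDeriv n (conj ∘ f ∘ conj) = conj ∘ iteratedDeriv n f ∘ conj := by
    intro n
    induction n with
    | zero => simp
    | succ n ih => rw [iteratedDeriv_succ, ih, deriv_conj_conj, iteratedDeriv_succ]
  have h2 := congrFun (h n) (conj z)
  simpa [Function.comp_def] using h2

lemma matDeriv_conjSwap {c : Type*} (F : ℂ → Matrix Idx c ℂ) (n : ℕ) (z : ℂ) :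
    matDeriv n (fun w => conjSwap (F (conj w))) (conj z) = conjSwap (matDeriv n F z) := by
  ext i j
  rcases i with i | i
  · simp only [matDeriv, Matrix.of_apply, conjSwap_inl]
    rw [iteratedDeriv_fun_neg]
    exact congrArg Neg.neg (iteratedDeriv_conj_comp_conj (fun w => F w (Sum.inr i) j) n z)
  · simp only [matDeriv, Matrix.of_apply, conjSwap_inr]
    exact iteratedDeriv_conj_comp_conj (fun w => F w (Sum.inl i) j) n z

lemma matDeriv_neg {r c : Type*} (F : ℂ → Matrix r c ℂ) (n : ℕ) (z : ℂ) :
    matDeriv n (fun w => -F w) z = -matDeriv n F z := by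
  ext i j
  simp only [matDeriv, Matrix.of_apply, Matrix.neg_apply]
  rw [iteratedDeriv_fun_neg]

end

section

variable {Q : ℝ → ℝ → Matrix (Fin 2) (Fin 2) ℂ} {T : Set ℝ}

/-! ### Joint evolution of the columns `μ₋L` and `Θ μ₊R` -/

lemma hasDerivAt_Theta_space (t : ℝ) (z : ℂ) (x : ℝ) :
    HasDerivAt (fun x => Theta x t z) (2 * Complex.I * z * Theta x t z) x := by
  have h0 : HasDerivAt (fun y : ℝ => (y : ℂ)) 1 x := Complex.ofRealCLM.hasDerivAt
  have h1 : HasDerivAt (fun y : ℝ => 2 * Complex.I * theta y t z) (2 * Complex.I * z) x := by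
    simp only [theta]
    exact (((h0.const_mul z).add_const _).const_mul _).congr_deriv (by ring)
  exact h1.cexp.congr_deriv (by rw [Theta]; ring)

lemma hasDerivAt_Theta_path (t : ℝ) (z : ℂ) (x s : ℝ) :
    HasDerivAt (fun s => Theta x (timePath t s) z)
      (4 * Complex.I * z ^ 2 * timeSpeed t s * Theta x (timePath t s) z) s := by
  have h0 : HasDerivAt (fun s : ℝ => (timePath t s : ℂ)) (timeSpeed t s) s :=
    (hasDerivAt_timePath t s).ofReal_comp
  have h1 : HasDerivAt (fun s : ℝ => 2 * Complex.I * theta x (timePath t s) z)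
      (4 * Complex.I * z ^ 2 * timeSpeed t s) s := by
    simp only [theta]
    exact (((h0.const_mul (2 * z ^ 2)).const_add _).const_mul _).congr_deriv (by ring)
  exact h1.cexp.congr_deriv (by rw [Theta]; ring)

lemma Theta_ne_zero (x t : ℝ) (z : ℂ) : Theta x t z ≠ 0 := Complex.exp_ne_zero _

/-- The generators of the `L` and `R` columns differ by the scalar `2iλ`, the logarithmic
`x`-derivative of `Θ`. Hence `Θ μ₊R` solves the system of `μ₋L`; the scalar `4iλ²` below plays this
role in time. -/
lemma specMat_inr_mulVec (U : ℝ → Matrix Idx Idx ℂ) (z : ℂ) (j k : Fin 2) (x : ℝ) (v : Idx → ℂ) :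
    specMat U z (Sum.inl j) x *ᵥ v = specMat U z (Sum.inr k) x *ᵥ v + (2 * Complex.I * z) • v := by
  funext i
  simp only [Pi.add_apply, Pi.smul_apply, specMat_mulVec, sgn_inl, sgn_inr, smul_eq_mul]
  ring

lemma timeGen_inr_mulVec (z : ℂ) (j k : Fin 2) (A B : Matrix (Fin 2) (Fin 2) ℂ) (v : Idx → ℂ) :
    timeGen z (Sum.inl j) A B *ᵥ v =
      timeGen z (Sum.inr k) A B *ᵥ v + (4 * Complex.I * z ^ 2) • v := by
  funext i
  simp only [timeGen, Matrix.add_mulVec, Matrix.mulVec_diagonal, Pi.add_apply, Pi.smul_apply,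
    sgn_inl, sgn_inr, smul_eq_mul]
  ring

lemma pathGen_inr_apply (t : ℝ) (z : ℂ) (j k : Fin 2) (x s : ℝ) (v : Idx → ℂ) :
    pathGen Q t z (Sum.inl j) x s v = pathGen Q t z (Sum.inr k) x s v +
      (4 * Complex.I * z ^ 2 * timeSpeed t s) • v := by
  simp only [pathGen, matCLM_apply, Matrix.smul_mulVec, timeMat]
  rw [timeGen_inr_mulVec z j k, smul_add, smul_smul, mul_comm (timeSpeed t s : ℂ)]

/-- Under `Q ↦ -Q(-x)` and `λ ↦ -λ` the field changes sign and `Q_x` does not, so every term of the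
generator is invariant. -/
lemma pathGen_reflQ (t : ℝ) (z : ℂ) (j : Idx) (x s : ℝ) :
    pathGen (reflQ Q) t (-z) j (-x) s = pathGen Q t z j x s := by
  simp only [pathGen, timeMat, timeGen, dx_reflQ, reflQ, neg_neg, neg_sq, Matrix.conjTranspose_neg,
    mul_neg, neg_mul, smul_neg, neg_smul]

/-- The evolution of a column of `μ₊` along `timePath t`. -/
lemma exists_evolution_pcol (hQ : IsSolution Q T) (hd : IsDecaying Q T) (hT : T.OrdConnected)
    (h0 : (0 : ℝ) ∈ T) {t : ℝ} (ht : t ∈ T) {z : ℂ} {j : Idx} (hz : -z ∈ leftHalf j) :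
    ∃ φ : ℝ → ℝ → Idx → ℂ, (∀ x s, 0 ≤ s → φ x s = pcol Q (timePath t s) j z x) ∧
      ∀ x s, HasDerivAt (φ x) (pathGen Q t z j x s (φ x s)) s := by
  obtain ⟨φ, h1, h2⟩ := exists_evolution_mcol hQ.refl hd.refl hT h0 ht hz
  refine ⟨fun x => φ (-x), fun x s hs => h1 (-x) s hs, fun x s => ?_⟩
  have h := h2 (-x) s
  rwa [pathGen_reflQ] at h

/-- A linear combination of the columns of `μ₋L` and `Θ μ₊R`. -/
def jostComb (Q : ℝ → ℝ → Matrix (Fin 2) (Fin 2) ℂ) (t : ℝ) (z : ℂ) (α β : Fin 2 → ℂ) (x : ℝ) :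
    Idx → ℂ :=
  ∑ j, α j • mcol Q t (Sum.inl j) z x + ∑ k, β k • (Theta x t z • pcol Q t (Sum.inr k) z x)

lemma hasDerivAt_jostComb (hQ : IsSolution Q T) (hd : IsDecaying Q T) {t : ℝ} (ht : t ∈ T) {z : ℂ}
    (hz : 0 ≤ z.im) (α β : Fin 2 → ℂ) (x : ℝ) : HasDerivAt (jostComb Q t z α β)
      (matCLM (specMat (fun y => potential Q y t) z (Sum.inl 0) x) (jostComb Q t z α β x)) x := by
  have hm : ∀ j, HasDerivAt (fun x => α j • mcol Q t (Sum.inl j) z x)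
      (matCLM (specMat (fun y => potential Q y t) z (Sum.inl 0) x)
        (α j • mcol Q t (Sum.inl j) z x)) x := fun j => by
    rw [map_smul, matCLM_apply]
    exact (hasDerivAt_mcol hQ hd ht (j := Sum.inl j) (by simpa using hz) x).const_smul (α j)
  have hp : ∀ k, HasDerivAt (fun x => β k • (Theta x t z • pcol Q t (Sum.inr k) z x))
      (matCLM (specMat (fun y => potential Q y t) z (Sum.inl 0) x)
        (β k • (Theta x t z • pcol Q t (Sum.inr k) z x))) x := fun k => by
    rw [map_smul, map_smul, matCLM_apply, specMat_inr_mulVec _ z 0 k]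
    refine (((hasDerivAt_Theta_space t z x).smul (hasDerivAt_pcol hQ hd ht (j := Sum.inr k)
      (by simpa using hz) x)).const_smul (β k)).congr_deriv ?_
    module
  have h := (HasDerivAt.fun_sum fun j (_ : j ∈ Finset.univ) => hm j).fun_add
    (HasDerivAt.fun_sum fun k (_ : k ∈ Finset.univ) => hp k)
  rw [← map_sum, ← map_sum, ← map_add] at h
  exact h

lemma exists_evolution_jostComb (hQ : IsSolution Q T) (hd : IsDecaying Q T) (hT : T.OrdConnected)
    (h0 : (0 : ℝ) ∈ T) {t : ℝ} (ht : t ∈ T) {z : ℂ} (hz : 0 ≤ z.im) (α β : Fin 2 → ℂ) (x : ℝ) :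
    ∃ φ : ℝ → Idx → ℂ, (∀ s, 0 ≤ s → φ s = jostComb Q (timePath t s) z α β x) ∧
      ∀ s, HasDerivAt φ (pathGen Q t z (Sum.inl 0) x s (φ s)) s := by
  choose f hf1 hf2 using fun j : Fin 2 =>
    exists_evolution_mcol hQ hd hT h0 ht (z := z) (j := Sum.inl j) (by simpa using hz)
  choose g hg1 hg2 using fun k : Fin 2 =>
    exists_evolution_pcol hQ hd hT h0 ht (z := z) (j := Sum.inr k) (by simpa using hz)
  refine ⟨fun s => ∑ j, α j • f j x s + ∑ k, β k • (Theta x (timePath t s) z • g k x s),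
    fun s hs => ?_, fun s => ?_⟩
  · simp only [hf1 _ x s hs, hg1 _ x s hs, jostComb]
  have hm : ∀ j, HasDerivAt (fun s => α j • f j x s)
      (pathGen Q t z (Sum.inl 0) x s (α j • f j x s)) s := fun j => by
    rw [map_smul]
    exact (hf2 j x s).const_smul (α j)
  have hp : ∀ k, HasDerivAt (fun s => β k • (Theta x (timePath t s) z • g k x s))
      (pathGen Q t z (Sum.inl 0) x s (β k • (Theta x (timePath t s) z • g k x s))) s := fun k => by
    rw [map_smul, map_smul, pathGen_inr_apply t z 0 k]
    refine (((hasDerivAt_Theta_path t z x s).smul (hg2 k x s)).const_smul (β k)).congr_deriv ?_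
    module
  have h := (HasDerivAt.fun_sum fun j (_ : j ∈ Finset.univ) => hm j).fun_add
    (HasDerivAt.fun_sum fun k (_ : k ∈ Finset.univ) => hp k)
  rw [← map_sum, ← map_sum, ← map_add] at h
  exact h

/-- The combinations at `(x, t)` are controlled by those at `(x₀, 0)`, locally uniformly in the
spectral parameter. -/
lemma exists_norm_jostComb_le (hQ : IsSolution Q T) (hd : IsDecaying Q T) (hT : T.OrdConnected)
    (h0 : (0 : ℝ) ∈ T) {t : ℝ} (ht : t ∈ T) (x₀ x : ℝ) {Z : Set ℂ} (hZc : IsCompact Z)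
    (hZ : ∀ z ∈ Z, 0 ≤ z.im) : ∃ C, 0 ≤ C ∧ ∀ z ∈ Z, ∀ α β,
      ‖jostComb Q t z α β x‖ ≤ C * ‖jostComb Q 0 z α β x₀‖ := by
  obtain ⟨D, -, hD⟩ := exists_bound_timeMat hd (hT.uIcc_subset h0 ht)
    (isCompact_uIcc (a := (0 : ℝ)) (b := t)) hZc (Sum.inl 0)
  have hU := (isPotential_potential hQ hd h0).cont
  have hsc : Continuous fun p : ℂ × ℝ =>
      matCLM (specMat (fun y => potential Q y 0) p.1 (Sum.inl 0) p.2) := by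
    refine continuous_matCLM fun i l => ?_
    simp only [specMat, Matrix.add_apply]
    refine Continuous.add ?_ ((hU i l).comp continuous_snd)
    exact (Continuous.matrix_diagonal (by fun_prop)).matrix_elem i l
  obtain ⟨E, hE⟩ := (hZc.prod (isCompact_uIcc (a := x₀) (b := x))).exists_bound_of_continuousOn
    hsc.continuousOn
  obtain ⟨S, hS⟩ := (isCompact_uIcc (a := (0 : ℝ)) (b := 1)).exists_bound_of_continuousOn
    (continuous_timeSpeed t).continuousOn
  -- Two Grönwall estimates are composed: in space at time zero from `x₀` to `x` with rate `E`, then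
  -- along the path from `s = 0` to `s = 1` at fixed `x` with rate `S * D`.
  refine ⟨Real.exp (S * D * |1 - 0|) * Real.exp (E * |x - x₀|), by positivity,
    fun z hz α β => ?_⟩
  have h1 := norm_le_exp_mul_of_linear_ode (hasDerivAt_jostComb hQ hd h0 (hZ z hz) α β)
    (a := x₀) (b := x) fun y hy => hE (z, y) ⟨hz, hy⟩
  obtain ⟨φ, hφ1, hφ2⟩ := exists_evolution_jostComb hQ hd hT h0 ht (hZ z hz) α β x
  have hD0 : 0 ≤ D := (Finset.sum_nonneg fun i _ => Finset.sum_nonneg fun l _ =>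
    norm_nonneg _).trans (hD z hz x 0 Set.left_mem_uIcc)
  have h2 := norm_le_exp_mul_of_linear_ode hφ2 (a := 0) (b := 1) (C := S * D) fun s hs =>
    (norm_pathGen_le (hD z hz) x s).trans (mul_le_mul_of_nonneg_right (hS s hs) hD0)
  rw [hφ1 1 zero_le_one, hφ1 0 le_rfl, timePath_one, timePath_zero] at h2
  rw [mul_assoc]
  exact h2.trans (mul_le_mul_of_nonneg_left h1 (Real.exp_pos _).le)

end

section

variable {Q : ℝ → ℝ → Matrix (Fin 2) (Fin 2) ℂ} {T : Set ℝ}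

/-! ### The norming matrix -/

/-! ### Identities for the blocks of two isotropic frames. -/

section Algebra

variable {E D P N a : Matrix (Fin 2) (Fin 2) ℂ}

/-- Isotropy of `(E, D)` gives `Dᵀ (P - E D⁻¹ N) = DᵀP - EᵀN = a`; multiplication by `D⁻ᵀ` on the
left and `adj a` on the right finishes. -/
lemma upper_block_eq (hED : Eᵀ * D = Dᵀ * E) (ha : a = Dᵀ * P - Eᵀ * N) (hD : IsUnit D.det) :
    P * a.adjugate - E * (D⁻¹ * N * a.adjugate) = a.det • D⁻¹ᵀ := by
  have hDT : IsUnit Dᵀ.det := by rwa [Matrix.det_transpose]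
  have h1 : Dᵀ * (P - E * (D⁻¹ * N)) = a := by
    rw [mul_sub, ← mul_assoc, ← hED, mul_assoc Eᵀ, ← mul_assoc D, Matrix.mul_nonsing_inv D hD,
      one_mul, ha]
  have h2 : P - E * (D⁻¹ * N) = D⁻¹ᵀ * a := by
    rw [← h1, Matrix.transpose_nonsing_inv, ← mul_assoc Dᵀ⁻¹, Matrix.nonsing_inv_mul _ hDT, one_mul]
  rw [← mul_assoc E, ← sub_mul, h2, mul_assoc, Matrix.mul_adjugate, Matrix.mul_smul, mul_one]

/-- The matrix is the congruence by `adj a` of `aᵀ D⁻¹ N = PᵀN - Nᵀ (E D⁻¹) N`. Both terms are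
symmetric: the first by isotropy of `(P, N)`, the second because `E D⁻¹` is symmetric by isotropy of
`(E, D)`. The factor `det a` appears since `adj(a)ᵀ aᵀ = det a`. -/
lemma det_smul_isSymm (hED : Eᵀ * D = Dᵀ * E) (hPN : Pᵀ * N = Nᵀ * P)
    (ha : a = Dᵀ * P - Eᵀ * N) (hD : IsUnit D.det) :
    (a.det • (D⁻¹ * N * a.adjugate)).IsSymm := by
  have hDT : IsUnit Dᵀ.det := by rwa [Matrix.det_transpose]
  have hS : (E * D⁻¹)ᵀ = E * D⁻¹ := by
    rw [Matrix.transpose_mul, Matrix.transpose_nonsing_inv]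
    calc Dᵀ⁻¹ * Eᵀ = Dᵀ⁻¹ * (Eᵀ * D) * D⁻¹ := by
          rw [← mul_assoc, mul_assoc, Matrix.mul_nonsing_inv D hD, mul_one]
      _ = E * D⁻¹ := by
          rw [hED, ← mul_assoc, Matrix.nonsing_inv_mul _ hDT, one_mul]
  have hW : aᵀ * (D⁻¹ * N) = Pᵀ * N - Nᵀ * (E * D⁻¹) * N := by
    rw [ha, Matrix.transpose_sub, Matrix.transpose_mul, Matrix.transpose_mul,
      Matrix.transpose_transpose, Matrix.transpose_transpose, sub_mul]
    congr 1
    · rw [mul_assoc, ← mul_assoc D, Matrix.mul_nonsing_inv D hD, one_mul]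
    · simp only [mul_assoc]
  have hWs : (aᵀ * (D⁻¹ * N))ᵀ = aᵀ * (D⁻¹ * N) := by
    rw [hW, Matrix.transpose_sub, Matrix.transpose_mul, Matrix.transpose_mul, Matrix.transpose_mul,
      hS, Matrix.transpose_transpose, Matrix.transpose_transpose, hPN, mul_assoc Nᵀ]
  have hN : a.det • (D⁻¹ * N * a.adjugate) =
      a.adjugateᵀ * (aᵀ * (D⁻¹ * N)) * a.adjugate := by
    rw [← mul_assoc a.adjugateᵀ, ← Matrix.transpose_mul, Matrix.mul_adjugate,
      Matrix.transpose_smul, Matrix.transpose_one, Matrix.smul_mul, one_mul, Matrix.smul_mul]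
  rw [hN, Matrix.IsSymm, Matrix.transpose_mul, Matrix.transpose_mul, hWs,
    Matrix.transpose_transpose, ← mul_assoc]

end Algebra

/-- The columns `L` of `μ₋`. -/
def minusL (Q : ℝ → ℝ → Matrix (Fin 2) (Fin 2) ℂ) (x t : ℝ) (z : ℂ) : Matrix Idx (Fin 2) ℂ :=
  Matrix.of fun i j => mcol Q t (Sum.inl j) z x i

/-- The columns `R` of `μ₊`. -/
def plusR (Q : ℝ → ℝ → Matrix (Fin 2) (Fin 2) ℂ) (x t : ℝ) (z : ℂ) : Matrix Idx (Fin 2) ℂ :=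
  Matrix.of fun i j => pcol Q t (Sum.inr j) z x i

lemma isOpen_upper : IsOpen {z : ℂ | 0 < z.im} := isOpen_lt continuous_const Complex.continuous_im

lemma matAnalyticAt_minusL (hQ : IsSolution Q T) (hd : IsDecaying Q T) {t : ℝ} (ht : t ∈ T)
    (x : ℝ) {z : ℂ} (hz : 0 < z.im) : MatAnalyticAt (minusL Q x t) z := fun i j =>
  (differentiableOn_mcol hQ hd ht (Sum.inl j) x i).analyticAt
    (by simpa using isOpen_upper.mem_nhds hz)

lemma matAnalyticAt_plusR (hQ : IsSolution Q T) (hd : IsDecaying Q T) {t : ℝ} (ht : t ∈ T)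
    (x : ℝ) {z : ℂ} (hz : 0 < z.im) : MatAnalyticAt (plusR Q x t) z := fun i j =>
  (differentiableOn_pcol hQ hd ht (Sum.inr j) x i).analyticAt
    (by simpa using isOpen_upper.mem_nhds hz)

lemma matAnalyticAt_aMat (hQ : IsSolution Q T) (hd : IsDecaying Q T) (h0 : (0 : ℝ) ∈ T) {z : ℂ}
    (hz : 0 < z.im) : MatAnalyticAt (aMat Q) z := fun i j =>
  (differentiableOn_aMat hQ hd h0 i j).analyticAt (isOpen_upper.mem_nhds hz)

lemma differentiable_Theta (x t : ℝ) : Differentiable ℂ (Theta x t) := by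
  unfold Theta theta
  fun_prop

lemma analyticAt_Theta (x t : ℝ) (z : ℂ) : AnalyticAt ℂ (Theta x t) z :=
  (differentiable_Theta x t).analyticAt z

lemma pairing_eq_rows (M N : Matrix Idx (Fin 2) ℂ) (j k : Fin 2) :
    pairing (fun i => M i j) (fun i => N i k) =
      (M.toRows₁ᵀ * N.toRows₂ - M.toRows₂ᵀ * N.toRows₁) j k := by
  simp [pairing, Matrix.mul_apply, Matrix.toRows₁, Matrix.toRows₂, Finset.sum_sub_distrib]

lemma plusR_isotropic (hQ : IsSolution Q T) (hd : IsDecaying Q T) {t : ℝ} (ht : t ∈ T) (x : ℝ)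
    {z : ℂ} (hz : 0 ≤ z.im) :
    (plusR Q x t z).toRows₁ᵀ * (plusR Q x t z).toRows₂ =
      (plusR Q x t z).toRows₂ᵀ * (plusR Q x t z).toRows₁ := by
  refine sub_eq_zero.1 (Matrix.ext fun j k => ?_)
  rw [← pairing_eq_rows]
  have h := pairing_pcol hQ hd ht (z := z) (j := Sum.inr j) (k := Sum.inr k) (by simpa using hz)
    (by simpa using hz) x
  rw [show pairing (unitCol (Sum.inr j)) (unitCol (Sum.inr k)) = 0 by simp [pairing, unitCol]] at h
  exact (mul_eq_zero.1 h).resolve_left (Complex.exp_ne_zero _)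

lemma minusL_isotropic (hQ : IsSolution Q T) (hd : IsDecaying Q T) {t : ℝ} (ht : t ∈ T) (x : ℝ)
    {z : ℂ} (hz : 0 ≤ z.im) :
    (minusL Q x t z).toRows₁ᵀ * (minusL Q x t z).toRows₂ =
      (minusL Q x t z).toRows₂ᵀ * (minusL Q x t z).toRows₁ := by
  refine sub_eq_zero.1 (Matrix.ext fun j k => ?_)
  rw [← pairing_eq_rows]
  have h := pairing_mcol hQ hd ht (z := z) (j := Sum.inl j) (k := Sum.inl k) (by simpa using hz)
    (by simpa using hz) x
  rw [show pairing (unitCol (Sum.inl j)) (unitCol (Sum.inl k)) = 0 by simp [pairing, unitCol]] at h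
  exact (mul_eq_zero.1 h).resolve_left (Complex.exp_ne_zero _)

lemma aMat_eq_rows (hQ : IsSolution Q T) (hd : IsDecaying Q T) (h0 : (0 : ℝ) ∈ T) {z : ℂ}
    (hz : 0 ≤ z.im) (x : ℝ) :
    aMat Q z = (plusR Q x 0 z).toRows₂ᵀ * (minusL Q x 0 z).toRows₁ -
      (plusR Q x 0 z).toRows₁ᵀ * (minusL Q x 0 z).toRows₂ := by
  ext k j
  rw [aMat_apply hQ hd h0 hz x, ← neg_sub, Matrix.neg_apply, ← pairing_eq_rows]
  rfl

/-- The defect `μ₋L adj a - Θ μ₊R B` of the dependence relation. -/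
def defect (Q : ℝ → ℝ → Matrix (Fin 2) (Fin 2) ℂ) (B : ℂ → Matrix (Fin 2) (Fin 2) ℂ) (x t : ℝ)
    (z : ℂ) : Matrix Idx (Fin 2) ℂ :=
  minusL Q x t z * (aMat Q z).adjugate - Theta x t z • (plusR Q x t z * B z)

lemma defect_col (B : ℂ → Matrix (Fin 2) (Fin 2) ℂ) (x t : ℝ) (z : ℂ) (c : Fin 2) :
    (fun i => defect Q B x t z i c) =
      jostComb Q t z (fun j => (aMat Q z).adjugate j c) (fun k => -B z k c) x := by
  funext i
  simp only [defect, jostComb, Matrix.sub_apply, Matrix.smul_apply, Matrix.mul_apply, minusL, plusR,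
    Matrix.of_apply, Fin.sum_univ_two, Pi.add_apply, Pi.smul_apply, smul_eq_mul]
  ring

lemma matAnalyticAt_defect (hQ : IsSolution Q T) (hd : IsDecaying Q T) (h0 : (0 : ℝ) ∈ T)
    {B : ℂ → Matrix (Fin 2) (Fin 2) ℂ} {z : ℂ} (hz : 0 < z.im) (hB : MatAnalyticAt B z) (x : ℝ)
    {t : ℝ} (ht : t ∈ T) : MatAnalyticAt (defect Q B x t) z := fun i c =>
  ((matAnalyticAt_minusL hQ hd ht x hz).mul (matAnalyticAt_aMat hQ hd h0 hz).adjugate i c).sub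
    (MatAnalyticAt.smul (analyticAt_Theta x t z) ((matAnalyticAt_plusR hQ hd ht x hz).mul hB) i c)

/-- If the defect is a multiple of `det a` at one point `(x₀, 0)`, then it vanishes to the order
of `det a` at every point. -/
lemma le_analyticOrderAt_defect (hQ : IsSolution Q T) (hd : IsDecaying Q T) (hT : T.OrdConnected)
    (h0 : (0 : ℝ) ∈ T) {z₀ : ℂ} (hz₀ : 0 < z₀.im) {n : ℕ}
    (hn : (n : ℕ∞) ≤ analyticOrderAt (fun z => (aMat Q z).det) z₀)
    {B : ℂ → Matrix (Fin 2) (Fin 2) ℂ} (hB : MatAnalyticAt B z₀) {x₀ : ℝ}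
    {G : ℂ → Matrix Idx (Fin 2) ℂ} (hG : MatAnalyticAt G z₀)
    (hBG : ∀ᶠ z in 𝓝 z₀, defect Q B x₀ 0 z = (aMat Q z).det • G z) (x : ℝ) {t : ℝ} (ht : t ∈ T)
    (i : Idx) (c : Fin 2) : (n : ℕ∞) ≤ analyticOrderAt (fun z => defect Q B x t z i c) z₀ := by
  obtain ⟨Z, hZn, hZs, hZc⟩ := local_compact_nhds (isOpen_upper.mem_nhds hz₀)
  obtain ⟨C, hC0, hC⟩ := exists_norm_jostComb_le hQ hd hT h0 ht x₀ x hZc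
    fun z hz => (hZs hz : 0 < z.im).le
  have hGc : ContinuousAt (fun z => ‖fun i => G z i c‖) z₀ :=
    (continuousAt_pi.2 fun i => (hG i c).continuousAt).norm
  have hGb : ∀ᶠ z in 𝓝 z₀, ‖fun i => G z i c‖ ≤ ‖fun i => G z₀ i c‖ + 1 :=
    (hGc.eventually_lt_const (lt_add_one _)).mono fun z hz => hz.le
  -- A column of the defect is a `jostComb` with coefficients depending on `z` alone, so its value
  -- at `(x, t)` is controlled by `C` times `|det a| ‖G‖`, with `G` bounded near `z₀`.
  refine natCast_le_analyticOrderAt_of_norm_le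
    (matAnalyticAt_defect hQ hd h0 hz₀ hB x ht i c) (matAnalyticAt_aMat hQ hd h0 hz₀).det
    (C := C * (‖fun i => G z₀ i c‖ + 1)) ?_ hn
  filter_upwards [hZn, hBG, hGb] with z hz h1 h2
  have h3 : (fun i => defect Q B x₀ 0 z i c) = (aMat Q z).det • fun i => G z i c := by
    rw [h1]; rfl
  calc ‖defect Q B x t z i c‖ ≤ ‖fun i => defect Q B x t z i c‖ :=
        norm_le_pi_norm (fun i => defect Q B x t z i c) i
    _ ≤ C * ‖fun i => defect Q B x₀ 0 z i c‖ := by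
        rw [defect_col, defect_col]; exact hC z hz _ _
    _ = C * (‖(aMat Q z).det‖ * ‖fun i => G z i c‖) := by rw [h3, norm_smul]
    _ ≤ C * (‖(aMat Q z).det‖ * (‖fun i => G z₀ i c‖ + 1)) := by gcongr
    _ = _ := by ring

lemma tendsto_plusR_toRows₂ (hQ : IsSolution Q T) (hd : IsDecaying Q T) {t : ℝ} (ht : t ∈ T)
    {z : ℂ} (hz : 0 ≤ z.im) :
    Tendsto (fun x => (plusR Q x t z).toRows₂.det) atTop (𝓝 1) := by
  have h : Tendsto (fun x => (plusR Q x t z).toRows₂) atTop (𝓝 1) := by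
    refine tendsto_pi_nhds.2 fun i => tendsto_pi_nhds.2 fun j => ?_
    have h1 := tendsto_pi_nhds.1 (tendsto_pcol_atTop hQ hd ht (z := z) (j := Sum.inr j)
      (by simpa using hz)) (Sum.inr i)
    have h2 : unitCol (Sum.inr j) (Sum.inr i) = (1 : Matrix (Fin 2) (Fin 2) ℂ) i j := by
      simp [unitCol, Matrix.one_apply]
    rwa [h2] at h1
  have h3 : Continuous fun M : Matrix (Fin 2) (Fin 2) ℂ => M.det := continuous_id.matrix_det
  rw [← Matrix.det_one (n := Fin 2) (R := ℂ)]
  exact (h3.tendsto 1).comp h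

/-- The norming matrix as an analytic function near a zero of `det a`. -/
theorem exists_normingMatrix (hQ : IsSolution Q T) (hd : IsDecaying Q T) (hT : T.OrdConnected)
    (h0 : (0 : ℝ) ∈ T) {z₀ : ℂ} (hz₀ : 0 < z₀.im) {n : ℕ}
    (hn : analyticOrderAt (fun z => (aMat Q z).det) z₀ = n) :
    ∃ B : ℂ → Matrix (Fin 2) (Fin 2) ℂ, MatAnalyticAt B z₀ ∧ (∀ᶠ z in 𝓝 z₀, (B z).IsSymm) ∧
      ((aMat Q z₀) = 0 → B z₀ = 0) ∧
      ∀ x, ∀ t ∈ T, ∀ i c, (n : ℕ∞) ≤ analyticOrderAt (fun z => defect Q B x t z i c) z₀ := by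
  -- The lower block of `μ₊R` tends to the identity as `x → +∞`.
  obtain ⟨x₀, hx₀⟩ : ∃ x₀, (plusR Q x₀ 0 z₀).toRows₂.det ≠ 0 :=
    ((tendsto_plusR_toRows₂ hQ hd h0 hz₀.le).eventually_ne one_ne_zero).exists
  have hA := matAnalyticAt_aMat hQ hd h0 hz₀
  have hD : MatAnalyticAt (fun z => (plusR Q x₀ 0 z).toRows₂) z₀ := fun i j =>
    matAnalyticAt_plusR hQ hd h0 x₀ hz₀ (Sum.inr i) j
  have hN : MatAnalyticAt (fun z => (minusL Q x₀ 0 z).toRows₂) z₀ := fun i j =>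
    matAnalyticAt_minusL hQ hd h0 x₀ hz₀ (Sum.inr i) j
  have hDi := hD.inv hx₀
  have hB0 := (hDi.mul hN).mul hA.adjugate
  have hΘ : AnalyticAt ℂ (fun z => (Theta x₀ 0 z)⁻¹) z₀ :=
    (analyticAt_Theta x₀ 0 z₀).inv (Theta_ne_zero _ _ _)
  have hB := MatAnalyticAt.smul hΘ hB0
  have hDu : ∀ᶠ z in 𝓝 z₀, IsUnit (plusR Q x₀ 0 z).toRows₂.det :=
    (hD.det.continuousAt.eventually_ne hx₀).mono fun z hz => isUnit_iff_ne_zero.2 hz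
  have hup : ∀ᶠ z in 𝓝 z₀, 0 < z.im := isOpen_upper.mem_nhds hz₀
  refine ⟨_, hB, ?_, fun ha => ?_, fun x t ht i c => ?_⟩
  -- The order is finite, so `det a` can be cancelled in a punctured neighbourhood; the identity
  -- theorem then extends the symmetry of `B` across `z₀`.
  · have hne : ∀ᶠ z in 𝓝[≠] z₀, (aMat Q z).det ≠ 0 := by
      refine (hA.det.eventually_eq_zero_or_eventually_ne_zero).resolve_left fun h => ?_
      rw [analyticOrderAt_eq_top.2 h] at hn
      exact ENat.top_ne_natCast n hn
    have hsym : ∀ i j, ∀ᶠ z in 𝓝 z₀, ((Theta x₀ 0 z)⁻¹ • ((plusR Q x₀ 0 z).toRows₂⁻¹ *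
        (minusL Q x₀ 0 z).toRows₂ * (aMat Q z).adjugate)) j i = ((Theta x₀ 0 z)⁻¹ •
        ((plusR Q x₀ 0 z).toRows₂⁻¹ * (minusL Q x₀ 0 z).toRows₂ * (aMat Q z).adjugate)) i j := by
      intro i j
      refine ((hB j i).frequently_eq_iff_eventually_eq (hB i j)).1 (Eventually.frequently ?_)
      filter_upwards [hne, hDu.filter_mono nhdsWithin_le_nhds,
        hup.filter_mono nhdsWithin_le_nhds] with z h1 h2 h3
      have h := det_smul_isSymm (plusR_isotropic hQ hd h0 x₀ h3.le)
        (minusL_isotropic hQ hd h0 x₀ h3.le) (aMat_eq_rows hQ hd h0 h3.le x₀) h2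
      have h4 := h.apply i j
      simp only [Matrix.smul_apply, smul_eq_mul] at h4 ⊢
      rw [mul_left_cancel₀ h1 h4]
    filter_upwards [eventually_all.2 fun i => eventually_all.2 fun j => hsym i j] with z hz
    exact Matrix.ext fun i j => hz i j
  · simp [ha]
  -- With this `B` the lower block of the defect at `(x₀, 0)` is zero and the upper block is `det a`
  -- times the analytic matrix `D⁻ᵀ`.
  · refine le_analyticOrderAt_defect hQ hd hT h0 hz₀ hn.ge hB (x₀ := x₀)
      (G := fun z => Matrix.fromRows (plusR Q x₀ 0 z).toRows₂⁻¹ᵀ 0) ?_ ?_ x ht i c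
    · rintro (i | i) j
      · exact hDi j i
      · exact analyticAt_const
    · filter_upwards [hDu, hup] with z h1 h2
      have h := upper_block_eq (plusR_isotropic hQ hd h0 x₀ h2.le)
        (aMat_eq_rows hQ hd h0 h2.le x₀) h1
      have hl : (plusR Q x₀ 0 z).toRows₂ * ((plusR Q x₀ 0 z).toRows₂⁻¹ *
          (minusL Q x₀ 0 z).toRows₂ * (aMat Q z).adjugate) =
          (minusL Q x₀ 0 z).toRows₂ * (aMat Q z).adjugate := by
        rw [← mul_assoc, ← mul_assoc, Matrix.mul_nonsing_inv _ h1, one_mul]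
      rw [defect, Matrix.mul_smul, smul_smul, mul_inv_cancel₀ (Theta_ne_zero _ _ _), one_smul]
      ext i j
      rcases i with i | i
      · exact congrFun (congrFun h i) j
      · have h3 := congrFun (congrFun hl i) j
        rw [Matrix.sub_apply, Matrix.smul_apply, Matrix.fromRows_apply_inr, Matrix.zero_apply,
          smul_zero, sub_eq_zero]
        exact h3.symm

end

section

variable {Q : ℝ → ℝ → Matrix (Fin 2) (Fin 2) ℂ} {T : Set ℝ}

/-! ### The conjugation symmetry of the eigenfunctions -/

/-- The column version of `conjSwap`. -/
def swapCol (v : Idx → ℂ) : Idx → ℂ :=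
  Sum.elim (fun a => -conj (v (Sum.inr a))) (fun a => conj (v (Sum.inl a)))

lemma swapCol_swapCol (v : Idx → ℂ) : swapCol (swapCol v) = -v := by
  funext i
  rcases i with i | i <;> simp [swapCol]

lemma swapCol_unitCol (j : Fin 2) : swapCol (unitCol (Sum.inl j)) = unitCol (Sum.inr j) := by
  funext i
  rcases i with i | i
  · simp [swapCol, unitCol]
  · by_cases h : i = j <;> simp [swapCol, unitCol, Matrix.one_apply, h]

lemma continuous_swapCol : Continuous swapCol := by
  refine continuous_pi fun i => ?_
  rcases i with i | i
  · exact (Complex.continuous_conj.comp (continuous_apply (Sum.inr i))).neg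
  · exact Complex.continuous_conj.comp (continuous_apply (Sum.inl i))

lemma norm_swapCol_le (v : Idx → ℂ) : ‖swapCol v‖ ≤ ‖v‖ := by
  refine (pi_norm_le_iff_of_nonneg (norm_nonneg _)).2 fun i => ?_
  rcases i with i | i
  · simpa [swapCol] using norm_le_pi_norm v (Sum.inr i)
  · simpa [swapCol] using norm_le_pi_norm v (Sum.inl i)

/-- For symmetric `Q` one has `J⁻¹ conj(U) J = U`, so `J⁻¹ conj` carries solutions at `conj z` to
solutions at `z`. It also maps the unit column `L` to the unit column `R`, and uniqueness concludes.
-/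
lemma mcol_inr_eq (hQ : IsSolution Q T) (hd : IsDecaying Q T) {t : ℝ} (ht : t ∈ T) (j : Fin 2)
    {z : ℂ} (hz : z.im ≤ 0) (x : ℝ) :
    mcol Q t (Sum.inr j) z x = swapCol (mcol Q t (Sum.inl j) (conj z) x) := by
  have hP := isPotential_potential hQ hd ht
  have hz' : conj z ∈ leftHalf (Sum.inl j) := by simpa using hz
  obtain ⟨C, -, hC⟩ := (isMuMinusColumn_minusCol hP hz').exists_bound
  have hcol := isMuMinusColumn_of_hasDerivAt hP (z := z) (j := Sum.inr j) (by simpa using hz)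
    (f := fun x => swapCol (mcol Q t (Sum.inl j) (conj z) x))
    (fun x => (norm_swapCol_le _).trans (hC x)) (fun x => ?_) ?_
  · exact (congrFun (hcol.eq_minusCol hP (by simpa using hz)) x).symm
  · have h := hasDerivAt_pi.1 (hasDerivAt_mcol hQ hd ht hz' x)
    have hs : Q x t 0 1 = Q x t 1 0 := (hQ.symm x t ht).apply 1 0
    refine hasDerivAt_pi.2 fun i => ?_
    rcases i with i | i
    · refine ((h (Sum.inr i)).star.neg).congr_deriv ?_
      rw [specMat_mulVec, specMat_mulVec]
      fin_cases i <;> simp [potential, Matrix.mulVec, dotProduct, swapCol, sgn_inl, sgn_inr, hs] <;>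
        ring
    · refine ((h (Sum.inl i)).star).congr_deriv ?_
      rw [specMat_mulVec, specMat_mulVec]
      fin_cases i <;> simp [potential, Matrix.mulVec, dotProduct, swapCol, sgn_inl, sgn_inr, hs]
  · rw [← swapCol_unitCol]
    exact (continuous_swapCol.tendsto _).comp (tendsto_mcol_atBot hQ hd ht hz')

/-- The reflected form of the previous symmetry, solved for the other column; the sign appears
because `swapCol` squares to `-1`. -/
lemma pcol_inl_eq (hQ : IsSolution Q T) (hd : IsDecaying Q T) {t : ℝ} (ht : t ∈ T) (j : Fin 2)
    {z : ℂ} (hz : z.im ≤ 0) (x : ℝ) :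
    pcol Q t (Sum.inl j) z x = -swapCol (pcol Q t (Sum.inr j) (conj z) x) := by
  rw [pcol, pcol, mcol_inr_eq hQ.refl hd.refl ht j (by simpa using hz), swapCol_swapCol, neg_neg,
    map_neg, Complex.conj_conj]

lemma muMinus_toCols₁ (hQ : IsSolution Q T) (hd : IsDecaying Q T) {t : ℝ} (ht : t ∈ T) {z : ℂ}
    (hz : 0 ≤ z.im) (x : ℝ) : (muMinus Q x t z).toCols₁ = minusL Q x t z := by
  ext i j
  exact muMinus_apply hQ hd ht (by simpa using hz) x i

lemma muPlus_toCols₂ (hQ : IsSolution Q T) (hd : IsDecaying Q T) {t : ℝ} (ht : t ∈ T) {z : ℂ}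
    (hz : 0 ≤ z.im) (x : ℝ) : (muPlus Q x t z).toCols₂ = plusR Q x t z := by
  ext i j
  exact muPlus_apply hQ hd ht (by simpa using hz) x i

lemma muMinus_toCols₂ (hQ : IsSolution Q T) (hd : IsDecaying Q T) {t : ℝ} (ht : t ∈ T) {z : ℂ}
    (hz : z.im ≤ 0) (x : ℝ) :
    (muMinus Q x t z).toCols₂ = conjSwap (muMinus Q x t (conj z)).toCols₁ := by
  rw [muMinus_toCols₁ hQ hd ht (by simpa using hz)]
  ext i j
  refine (muMinus_apply hQ hd ht (j := Sum.inr j) (by simpa using hz) x i).trans ?_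
  rw [mcol_inr_eq hQ hd ht j hz]
  rfl

lemma muPlus_toCols₁ (hQ : IsSolution Q T) (hd : IsDecaying Q T) {t : ℝ} (ht : t ∈ T) {z : ℂ}
    (hz : z.im ≤ 0) (x : ℝ) :
    (muPlus Q x t z).toCols₁ = -conjSwap (muPlus Q x t (conj z)).toCols₂ := by
  rw [muPlus_toCols₂ hQ hd ht (by simpa using hz)]
  ext i j
  refine (muPlus_apply hQ hd ht (j := Sum.inl j) (by simpa using hz) x i).trans ?_
  rw [pcol_inl_eq hQ hd ht j hz]
  rfl

lemma toCols₁_mul_phase (M : Matrix Idx Idx ℂ) (x t : ℝ) (z : ℂ) :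
    (M * phase x t z).toCols₁ = Complex.exp (-Complex.I * theta x t z) • M.toCols₁ := by
  ext i j
  simp [Matrix.toCols₁, phase, Matrix.mul_diagonal, sgn_inl, mul_comm]

lemma toCols₂_mul_phase (M : Matrix Idx Idx ℂ) (x t : ℝ) (z : ℂ) :
    (M * phase x t z).toCols₂ = Complex.exp (Complex.I * theta x t z) • M.toCols₂ := by
  ext i j
  simp [Matrix.toCols₂, phase, Matrix.mul_diagonal, sgn_inr, mul_comm]

lemma theta_conj (x t : ℝ) (z : ℂ) : theta x t (conj z) = conj (theta x t z) := by
  simp only [theta, map_add, map_mul, map_pow, map_ofNat, Complex.conj_ofReal]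

lemma psiMinus_toCols₂ (hQ : IsSolution Q T) (hd : IsDecaying Q T) {t : ℝ} (ht : t ∈ T) {z : ℂ}
    (hz : z.im ≤ 0) (x : ℝ) :
    (psiMinus Q x t z).toCols₂ = conjSwap (psiMinus Q x t (conj z)).toCols₁ := by
  rw [psiMinus, psiMinus, toCols₁_mul_phase, toCols₂_mul_phase, conjSwap_smul,
    muMinus_toCols₂ hQ hd ht hz, ← Complex.exp_conj, theta_conj]
  simp

lemma psiPlus_toCols₁ (hQ : IsSolution Q T) (hd : IsDecaying Q T) {t : ℝ} (ht : t ∈ T) {z : ℂ}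
    (hz : z.im ≤ 0) (x : ℝ) :
    (psiPlus Q x t z).toCols₁ = -conjSwap (psiPlus Q x t (conj z)).toCols₂ := by
  rw [psiPlus, psiPlus, toCols₁_mul_phase, toCols₂_mul_phase, conjSwap_smul,
    muPlus_toCols₁ hQ hd ht hz, ← Complex.exp_conj, theta_conj]
  simp

lemma adjugate_map_conj (A : Matrix (Fin 2) (Fin 2) ℂ) :
    (A.map conj).adjugate = A.adjugate.map conj := by
  rw [Matrix.adjugate_fin_two, Matrix.adjugate_fin_two]
  ext i j
  fin_cases i <;> fin_cases j <;> simp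

lemma conjTranspose_eq_map_conj {A : Matrix (Fin 2) (Fin 2) ℂ} (hA : A.IsSymm) :
    Aᴴ = A.map conj := by
  ext i j
  rw [Matrix.conjTranspose_apply, hA.apply]
  rfl

lemma eventually_conj_im_neg {z₀ : ℂ} (hz₀ : 0 < z₀.im) : ∀ᶠ z in 𝓝 (conj z₀), z.im < 0 :=
  (isOpen_lt Complex.continuous_im continuous_const).mem_nhds
    (show (conj z₀).im < 0 by simpa using hz₀)

/-- Passage of a derivative of `M adj a` to the lower half-plane. -/
lemma matDeriv_mul_adjugate_scatABar {M N : ℂ → Matrix Idx (Fin 2) ℂ} {z₀ : ℂ} (hz₀ : 0 < z₀.im)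
    (hMN : ∀ z : ℂ, z.im ≤ 0 → N z = conjSwap (M (conj z))) (n : ℕ) :
    matDeriv n (fun z => N z * (scatABar Q z).adjugate) (conj z₀) =
      conjSwap (matDeriv n (fun z => M z * (scatA Q z).adjugate) z₀) := by
  rw [← matDeriv_conjSwap]
  refine matDeriv_congr ?_ n
  filter_upwards [eventually_conj_im_neg hz₀] with z hz
  rw [hMN z hz.le, scatABar, adjugate_map_conj, conjSwap_mul]

lemma matDeriv_of_eq_neg_conjSwap {M N : ℂ → Matrix Idx (Fin 2) ℂ} {z₀ : ℂ} (hz₀ : 0 < z₀.im)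
    (hMN : ∀ z : ℂ, z.im ≤ 0 → N z = -conjSwap (M (conj z))) (n : ℕ) :
    matDeriv n N (conj z₀) = -conjSwap (matDeriv n M z₀) := by
  rw [← matDeriv_conjSwap, ← matDeriv_neg]
  refine matDeriv_congr ?_ n
  filter_upwards [eventually_conj_im_neg hz₀] with z hz using hMN z hz.le

lemma matDeriv_eq_zero_of_order {r c : Type*} {F : ℂ → Matrix r c ℂ} {z : ℂ}
    (hF : MatAnalyticAt F z) {m n : ℕ} (hn : n ≤ m)
    (h : ∀ i j, ((m + 1 : ℕ) : ℕ∞) ≤ analyticOrderAt (fun w => F w i j) z) :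
    matDeriv n F z = 0 := by
  ext i j
  exact (natCast_le_analyticOrderAt_iff_iteratedDeriv_eq_zero (hF i j)).1 (h i j) n
    (Nat.lt_succ_iff.2 hn)

lemma eq_zero_of_adjugate_eq_zero {A : Matrix (Fin 2) (Fin 2) ℂ} (h : A.adjugate = 0) : A = 0 := by
  rw [Matrix.adjugate_fin_two] at h
  have h00 := congrFun (congrFun h 0) 0
  have h01 := congrFun (congrFun h 0) 1
  have h10 := congrFun (congrFun h 1) 0
  have h11 := congrFun (congrFun h 1) 1
  simp at h00 h01 h10 h11
  ext i j
  fin_cases i <;> fin_cases j <;> simp [h00, h01, h10, h11]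

/-- The upper block of `μ₋L` tends to the identity as `x → -∞`. -/
lemma eq_zero_of_minusL_mul_eq_zero (hQ : IsSolution Q T) (hd : IsDecaying Q T) {t : ℝ}
    (ht : t ∈ T) {z : ℂ} (hz : 0 ≤ z.im) {A : Matrix (Fin 2) (Fin 2) ℂ}
    (h : ∀ x, minusL Q x t z * A = 0) : A = 0 := by
  ext i c
  have hlim : Tendsto (fun x => ∑ j, mcol Q t (Sum.inl j) z x (Sum.inl i) * A j c) atBot
      (𝓝 (∑ j, unitCol (Sum.inl j) (Sum.inl i) * A j c)) :=
    tendsto_finsetSum _ fun j _ => (tendsto_pi_nhds.1 (tendsto_mcol_atBot hQ hd ht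
      (by simpa using hz)) (Sum.inl i)).mul_const _
  have h0 : ∀ x, ∑ j, mcol Q t (Sum.inl j) z x (Sum.inl i) * A j c = 0 := fun x =>
    congrFun (congrFun (h x) (Sum.inl i)) c
  simp only [h0] at hlim
  have h1 := tendsto_nhds_unique hlim tendsto_const_nhds
  simpa [unitCol, Matrix.one_apply] using h1

end

section

variable {Q : ℝ → ℝ → Matrix (Fin 2) (Fin 2) ℂ} {T : Set ℝ}

/-! ### The dependence relations -/

lemma minusL_mul_adjugate_eq (B : ℂ → Matrix (Fin 2) (Fin 2) ℂ) (x t : ℝ) (z : ℂ) :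
    minusL Q x t z * (aMat Q z).adjugate =
      (Theta x t z • plusR Q x t z) * B z + defect Q B x t z := by
  rw [defect, Matrix.smul_mul, add_sub_cancel]

/-- The defect has order at least `m + 1`, so its derivatives up to order `m` vanish at `z₀`; the
triple sum is the Leibniz rule applied twice to `(Θ μ₊R) B`. -/
lemma matDeriv_muMinus_mul (hQ : IsSolution Q T) (hd : IsDecaying Q T) (h0 : (0 : ℝ) ∈ T) {z₀ : ℂ}
    (hz₀ : 0 < z₀.im) {m n : ℕ} (hn : n ≤ m) {B : ℂ → Matrix (Fin 2) (Fin 2) ℂ}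
    (hB : MatAnalyticAt B z₀) {x t : ℝ} (ht : t ∈ T)
    (hR : ∀ i c, ((m + 1 : ℕ) : ℕ∞) ≤ analyticOrderAt (fun z => defect Q B x t z i c) z₀) :
    (n.factorial : ℂ)⁻¹ •
        matDeriv n (fun z => (muMinus Q x t z).toCols₁ * (scatA Q z).adjugate) z₀ =
      ∑ p ∈ Finset.HasAntidiagonal.antidiagonal n, ∑ r ∈ Finset.HasAntidiagonal.antidiagonal p.2,
        (((p.1.factorial : ℂ) * r.1.factorial * r.2.factorial)⁻¹ *
          iteratedDeriv r.1 (Theta x t) z₀) •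
            (matDeriv r.2 (fun z => (muPlus Q x t z).toCols₂) z₀ * matDeriv p.1 B z₀) := by
  have hup : ∀ᶠ z in 𝓝 z₀, 0 < z.im := isOpen_upper.mem_nhds hz₀
  have hP := matAnalyticAt_plusR hQ hd ht x hz₀
  have hF := MatAnalyticAt.smul (analyticAt_Theta x t z₀) hP
  have hdef := matAnalyticAt_defect hQ hd h0 hz₀ hB x ht
  have h1 : matDeriv n (fun z => (muMinus Q x t z).toCols₁ * (scatA Q z).adjugate) z₀ =
      matDeriv n (fun z => (Theta x t z • plusR Q x t z) * B z) z₀ := by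
    rw [← matDeriv_add_of_eq_zero (hF.mul hB) hdef (matDeriv_eq_zero_of_order hdef hn hR)]
    refine matDeriv_congr ?_ n
    filter_upwards [hup] with z hz
    rw [muMinus_toCols₁ hQ hd ht hz.le, scatA_eq_aMat hQ hd h0 hz.le]
    exact minusL_mul_adjugate_eq B x t z
  have h2 : ∀ k, matDeriv k (fun z => (muPlus Q x t z).toCols₂) z₀ =
      matDeriv k (plusR Q x t) z₀ := fun k =>
    matDeriv_congr (hup.mono fun z hz => muPlus_toCols₂ hQ hd ht hz.le x) k
  rw [h1, matDeriv_mul hF hB]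
  refine Finset.sum_congr rfl fun p _ => ?_
  rw [mul_inv, ← smul_smul, ← Matrix.smul_mul, matDeriv_smul (analyticAt_Theta x t z₀) hP,
    Matrix.sum_mul, Finset.smul_sum]
  refine Finset.sum_congr rfl fun r _ => ?_
  rw [Matrix.smul_mul, smul_smul, h2]
  congr 1
  ring

/-- Multiplying the decomposition by `e^{-iθ}` turns `Θ μ₊R` into `e^{iθ} μ₊R = ψ₊R`, and an
analytic factor cannot lower the order of the defect. -/
lemma matDeriv_psiMinus_mul (hQ : IsSolution Q T) (hd : IsDecaying Q T) (h0 : (0 : ℝ) ∈ T) {z₀ : ℂ}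
    (hz₀ : 0 < z₀.im) {m n : ℕ} (hn : n ≤ m) {B : ℂ → Matrix (Fin 2) (Fin 2) ℂ}
    (hB : MatAnalyticAt B z₀) {x t : ℝ} (ht : t ∈ T)
    (hR : ∀ i c, ((m + 1 : ℕ) : ℕ∞) ≤ analyticOrderAt (fun z => defect Q B x t z i c) z₀) :
    (n.factorial : ℂ)⁻¹ •
        matDeriv n (fun z => (psiMinus Q x t z).toCols₁ * (scatA Q z).adjugate) z₀ =
      ∑ p ∈ Finset.HasAntidiagonal.antidiagonal n, ((p.1.factorial : ℂ) * p.2.factorial)⁻¹ •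
        (matDeriv p.2 (fun z => (psiPlus Q x t z).toCols₂) z₀ * matDeriv p.1 B z₀) := by
  have hup : ∀ᶠ z in 𝓝 z₀, 0 < z.im := isOpen_upper.mem_nhds hz₀
  have hth : Differentiable ℂ (theta x t) := by
    unfold theta
    fun_prop
  have he : ∀ c : ℂ, AnalyticAt ℂ (fun z => Complex.exp (c * theta x t z)) z₀ := fun c =>
    ((hth.const_mul c).cexp).analyticAt z₀
  have hdef := matAnalyticAt_defect hQ hd h0 hz₀ hB x ht
  have hF := MatAnalyticAt.smul (he Complex.I) (matAnalyticAt_plusR hQ hd ht x hz₀)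
  have hE := MatAnalyticAt.smul (he (-Complex.I)) hdef
  have hE0 : matDeriv n (fun z => Complex.exp (-Complex.I * theta x t z) • defect Q B x t z) z₀ =
      0 := by
    refine matDeriv_eq_zero_of_order hE hn fun i c => ?_
    have h : analyticOrderAt (fun z => (Complex.exp (-Complex.I * theta x t z) •
        defect Q B x t z) i c) z₀ = _ := analyticOrderAt_mul (he (-Complex.I)) (hdef i c)
    rw [h]
    exact (hR i c).trans le_add_self
  have h1 : matDeriv n (fun z => (psiMinus Q x t z).toCols₁ * (scatA Q z).adjugate) z₀ =
      matDeriv n (fun z => (Complex.exp (Complex.I * theta x t z) • plusR Q x t z) * B z) z₀ := by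
    rw [← matDeriv_add_of_eq_zero (hF.mul hB) hE hE0]
    refine matDeriv_congr ?_ n
    filter_upwards [hup] with z hz
    rw [psiMinus, toCols₁_mul_phase, muMinus_toCols₁ hQ hd ht hz.le,
      scatA_eq_aMat hQ hd h0 hz.le, Matrix.smul_mul, minusL_mul_adjugate_eq B x t z, smul_add,
      Matrix.smul_mul, smul_smul, Matrix.smul_mul, Theta, ← Complex.exp_add]
    congr 3
    ring_nf
  have h2 : ∀ k, matDeriv k (fun z => (psiPlus Q x t z).toCols₂) z₀ =
      matDeriv k (fun z => Complex.exp (Complex.I * theta x t z) • plusR Q x t z) z₀ := fun k =>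
    matDeriv_congr (hup.mono fun z hz => by
      simp only [psiPlus, toCols₂_mul_phase, muPlus_toCols₂ hQ hd ht hz.le]) k
  rw [h1, matDeriv_mul hF hB]
  exact Finset.sum_congr rfl fun p _ => by rw [h2]

end

end SpinorGP

end

theorem mainTheorem6
    (Q : ℝ → ℝ → Matrix (Fin 2) (Fin 2) ℂ) (T : Set ℝ)
    (hT : T.OrdConnected) (h0T : (0 : ℝ) ∈ T)
    (hQ : SpinorGP.IsSolution Q T) (hdecay : SpinorGP.IsDecaying Q T)
    (lam₀ : ℂ) (hlam₀ : 0 < lam₀.im) (m : ℕ)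
    (hmult : analyticOrderAt (fun z => (SpinorGP.scatA Q z).det) lam₀ = ((m + 1 : ℕ) : ℕ∞)) :
    ∃ B : ℕ → Matrix (Fin 2) (Fin 2) ℂ,
      (∀ j ≤ m, (B j).IsSymm) ∧
      (B 0 ≠ 0 ↔ SpinorGP.scatA Q lam₀ ≠ 0) ∧
      (∀ x : ℝ, ∀ t ∈ T, ∀ n ≤ m,
        ((n.factorial : ℂ)⁻¹ •
            SpinorGP.matDeriv n
              (fun z => (SpinorGP.psiMinus Q x t z).toCols₁ * (SpinorGP.scatA Q z).adjugate) lam₀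
          = ∑ p ∈ Finset.HasAntidiagonal.antidiagonal n,
              ((p.1.factorial : ℂ) * p.2.factorial)⁻¹ •
                (SpinorGP.matDeriv p.2 (fun z => (SpinorGP.psiPlus Q x t z).toCols₂) lam₀
                  * B p.1)) ∧
        ((n.factorial : ℂ)⁻¹ •
            SpinorGP.matDeriv n
              (fun z => (SpinorGP.psiMinus Q x t z).toCols₂ * (SpinorGP.scatABar Q z).adjugate)
              (conj lam₀)
          = -∑ p ∈ Finset.HasAntidiagonal.antidiagonal n,
              ((p.1.factorial : ℂ) * p.2.factorial)⁻¹ •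
                (SpinorGP.matDeriv p.2 (fun z => (SpinorGP.psiPlus Q x t z).toCols₁) (conj lam₀)
                  * (B p.1)ᴴ))) ∧
      (∀ x : ℝ, ∀ t ∈ T, ∀ n ≤ m,
        ((n.factorial : ℂ)⁻¹ •
            SpinorGP.matDeriv n
              (fun z => (SpinorGP.muMinus Q x t z).toCols₁ * (SpinorGP.scatA Q z).adjugate) lam₀
          = ∑ p ∈ Finset.HasAntidiagonal.antidiagonal n, ∑ r ∈ Finset.HasAntidiagonal.antidiagonal p.2,
              (((p.1.factorial : ℂ) * r.1.factorial * r.2.factorial)⁻¹ *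
                  iteratedDeriv r.1 (SpinorGP.Theta x t) lam₀) •
                (SpinorGP.matDeriv r.2 (fun z => (SpinorGP.muPlus Q x t z).toCols₂) lam₀
                  * B p.1)) ∧
        ((n.factorial : ℂ)⁻¹ •
            SpinorGP.matDeriv n
              (fun z => (SpinorGP.muMinus Q x t z).toCols₂ * (SpinorGP.scatABar Q z).adjugate)
              (conj lam₀)
          = -∑ p ∈ Finset.HasAntidiagonal.antidiagonal n, ∑ r ∈ Finset.HasAntidiagonal.antidiagonal p.2,
              (((p.1.factorial : ℂ) * r.1.factorial * r.2.factorial)⁻¹ *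
                  conj (iteratedDeriv r.1 (SpinorGP.Theta x t) lam₀)) •
                (SpinorGP.matDeriv r.2 (fun z => (SpinorGP.muPlus Q x t z).toCols₁) (conj lam₀)
                  * (B p.1)ᴴ))) := by
  have hup : ∀ᶠ z in 𝓝 lam₀, 0 < z.im := SpinorGP.isOpen_upper.mem_nhds hlam₀
  have hmult' : analyticOrderAt (fun z => (SpinorGP.aMat Q z).det) lam₀ = ((m + 1 : ℕ) : ℕ∞) := by
    rw [← hmult]
    exact analyticOrderAt_congr
      (hup.mono fun z hz => by simp only [SpinorGP.scatA_eq_aMat hQ hdecay h0T hz.le])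
  obtain ⟨B, hB, hBs, hB0, hBd⟩ :=
    SpinorGP.exists_normingMatrix hQ hdecay hT h0T hlam₀ hmult'
  have hsymm : ∀ j, (SpinorGP.matDeriv j B lam₀).IsSymm := fun j => by
    have h : SpinorGP.matDeriv j (fun z => (B z)ᵀ) lam₀ = SpinorGP.matDeriv j B lam₀ :=
      SpinorGP.matDeriv_congr (hBs.mono fun z hz => hz) j
    exact h
  have hzero : SpinorGP.matDeriv 0 B lam₀ = B lam₀ := by
    ext i j
    simp [SpinorGP.matDeriv]
  have hψ := fun (x t : ℝ) (ht : t ∈ T) (n : ℕ) (hn : n ≤ m) =>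
    SpinorGP.matDeriv_psiMinus_mul hQ hdecay h0T hlam₀ hn hB ht (hBd x t ht)
  have hμ := fun (x t : ℝ) (ht : t ∈ T) (n : ℕ) (hn : n ≤ m) =>
    SpinorGP.matDeriv_muMinus_mul hQ hdecay h0T hlam₀ hn hB ht (hBd x t ht)
  refine ⟨fun j => SpinorGP.matDeriv j B lam₀, fun j _ => hsymm j, ?_,
    fun x t ht n hn => ⟨hψ x t ht n hn, ?_⟩, fun x t ht n hn => ⟨hμ x t ht n hn, ?_⟩⟩
  · beta_reduce
    rw [not_iff_not, hzero, SpinorGP.scatA_eq_aMat hQ hdecay h0T hlam₀.le]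
    refine ⟨fun h => ?_, hB0⟩
    -- With `B(λ₀) = 0` and a vanishing defect, `μ₋L adj a = 0` at `λ₀` for every `x`.
    refine SpinorGP.eq_zero_of_adjugate_eq_zero
      (SpinorGP.eq_zero_of_minusL_mul_eq_zero hQ hdecay h0T hlam₀.le fun x => ?_)
    have hdef : SpinorGP.defect Q B x 0 lam₀ = 0 := by
      have h1 := SpinorGP.matDeriv_eq_zero_of_order
        (SpinorGP.matAnalyticAt_defect hQ hdecay h0T hlam₀ hB x h0T) (Nat.zero_le m)
        (hBd x 0 h0T)
      ext i c
      simpa [SpinorGP.matDeriv] using congrFun (congrFun h1 i) c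
    rw [SpinorGP.minusL_mul_adjugate_eq B, hdef, h, Matrix.mul_zero, add_zero]
  · rw [SpinorGP.matDeriv_mul_adjugate_scatABar
      (M := fun z => (SpinorGP.psiMinus Q x t z).toCols₁) hlam₀
      fun z hz => SpinorGP.psiMinus_toCols₂ hQ hdecay ht hz x]
    -- The relation at `λ₀` is conjugated. The minus sign comes from the symmetry of `ψ₊`, and `conj
    -- B_j = B_j†` because `B_j` is symmetric.
    have h := congrArg SpinorGP.conjSwap (hψ x t ht n hn)
    simp only [SpinorGP.conjSwap_smul, SpinorGP.conjSwap_sum, SpinorGP.conjSwap_mul, map_inv₀,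
      map_mul, map_natCast] at h
    rw [h, ← Finset.sum_neg_distrib]
    refine Finset.sum_congr rfl fun p _ => ?_
    rw [SpinorGP.matDeriv_of_eq_neg_conjSwap
      (M := fun z => (SpinorGP.psiPlus Q x t z).toCols₂) hlam₀
      fun z hz => SpinorGP.psiPlus_toCols₁ hQ hdecay ht hz x,
      SpinorGP.conjTranspose_eq_map_conj (hsymm p.1), Matrix.neg_mul, smul_neg, neg_neg]
  · rw [SpinorGP.matDeriv_mul_adjugate_scatABar
      (M := fun z => (SpinorGP.muMinus Q x t z).toCols₁) hlam₀
      fun z hz => SpinorGP.muMinus_toCols₂ hQ hdecay ht hz x]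
    have h := congrArg SpinorGP.conjSwap (hμ x t ht n hn)
    simp only [SpinorGP.conjSwap_smul, SpinorGP.conjSwap_sum, SpinorGP.conjSwap_mul, map_inv₀,
      map_mul, map_natCast] at h
    rw [h, ← Finset.sum_neg_distrib]
    refine Finset.sum_congr rfl fun p _ => ?_
    rw [← Finset.sum_neg_distrib]
    refine Finset.sum_congr rfl fun r _ => ?_
    rw [SpinorGP.matDeriv_of_eq_neg_conjSwap
      (M := fun z => (SpinorGP.muPlus Q x t z).toCols₂) hlam₀
      fun z hz => SpinorGP.muPlus_toCols₁ hQ hdecay ht hz x,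
      SpinorGP.conjTranspose_eq_map_conj (hsymm p.1), Matrix.neg_mul, smul_neg, neg_neg]
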